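/- **Theorem 3.6.** Let $1<p<\infty$, let $\Omega\subset\mathbb R^n$ be a bounded domain (open and connected) of class $C^1$, let $\Gamma_D\subseteq\partial\Omega$ and $\Gamma_N:=\partial\Omega\setminus\overline{\Gamma_D}$. On $\mathbb R^{N\times n}$ use $\langle x,y\rangle=\mathrm{tr}(xy^T)$ and $|x|=\langle x,x\rangle^{1/2}$, and put $V(\xi):=(1+|\xi|^2)^{\frac{p-2}{4}}\xi$. For $\omega\subseteq\Omega$ open, $C^1(\overline\omega,\mathbb R^N)$ denotes the functions that are continuous on $\overline\omega$ and differentiable in $\omega$ with a gradient that extends continuously to $\overline\omega$, and $\mathrm{Var}(\omega,\mathbb R^N)$ denotes the closure in $W^{1,p}(\omega,\mathbb R^N)$ of $$\{\varphi\in C^1(\overline\omega,\mathbb R^N):\ \varphi(x)=0\ \text{ for all } x\in(\Gamma_D\cap\overline\omega)\cup(\partial\omega\cap\Omega)\}.$$ Let $F\colon\mathbb R^{N\times n}\to\mathbb R$, $u\in C^1(\overline\Omega,\mathbb R^N)$ and $c_2>0$ satisfy: * (H0) $F\in C^2(\mathbb R^{N\times n})$; * (H1) there is $c_1>0$ with $|F(z)|\le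 c_1(1+|z|^p)$ for all $z\in\mathbb R^{N\times n}$; * (H2) with $Q=(0,1)^n$, for every $z\in\mathbb R^{N\times n}$ and every $\varphi\in W^{1,\infty}_0(Q,\mathbb R^N)$, $$c_2\int_Q|V(\nabla\varphi)|^2\,dx\le\int_Q\bigl(F(z+\nabla\varphi)-F(z)\bigr)\,dx;$$ * (H2') for every $x_0\in\Gamma_N$, with $\mathrm n(x_0)$ the outer unit normal to $\partial\Omega$ at $x_0$ and $B^-:=\{y\in B(x_0,1):\langle y-x_0,\mathrm n(x_0)\rangle<0\}$, and for every $\varphi\in C^\infty(\overline{B^-},\mathbb R^N)$ with $\varphi=0$ on $\partial B(x_0,1)\cap\overline{B^-}$, $$c_2\int_{B^-}|V(\nabla\varphi)|^2\,dx\le\int_{B^-}\bigl(F(\nabla u(x_0)+\nabla\varphi)-F(\nabla u(x_0))\bigr)\,dx;$$ * $u$ is an $F$-extremal: $\int_\Omega\langle F'(\nabla u),\nabla\varphi\rangle\,dx=0$ for every $\varphi\in\mathrm{Var}(\Omega,\mathbb R^N)$. Then there exists $\overline R>0$ such that, for every $x_0\in\overline\Omega$, with $\Omega(x_0,\overline R):=\Omega\cap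 B(x_0,\overline R)$, and every $\varphi\in\mathrm{Var}(\Omega(x_0,\overline R),\mathbb R^N)$, $$\frac{c_2}{2}\int_{\Omega(x_0,\overline R)}|V(\nabla\varphi)|^2\,dx\le\int_{\Omega(x_0,\overline R)}\bigl(F(\nabla u+\nabla\varphi)-F(\nabla u)\bigr)\,dx.$$ -/

import Mathlib

open scoped ContDiff

noncomputable section

namespace Zhang

/-- `ℝⁿ` with its Euclidean norm and inner product. -/
abbrev Vec (n : ℕ) : Type := EuclideanSpace ℝ (Fin n)

/-- `ℝ^{N×n}` with `⟨x, y⟩ = tr (x yᵀ)` and `|x| = ⟨x, x⟩^{1/2}`; the entry in row `i` and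
column `j` of `z` is `z (i, j)`. -/
abbrev Mat (N n : ℕ) : Type := EuclideanSpace ℝ (Fin N × Fin n)

/-- The matrix of a linear map `ℝⁿ → ℝᴺ` in the canonical bases. -/
def toMat {N n : ℕ} (L : Vec n →L[ℝ] Vec N) : Mat N n :=
  WithLp.toLp 2 fun ij => L (EuclideanSpace.single ij.2 1) ij.1

/-- The classical gradient (Jacobian matrix) of `φ` at `x`. -/
def grad {N n : ℕ} (φ : Vec n → Vec N) (x : Vec n) : Mat N n :=
  toMat (fderiv ℝ φ x)

/-- `V_β(ξ) = (1 + |ξ|²)^{(β-1)/2} ξ`. -/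
def Vaux {N n : ℕ} (β : ℝ) (ξ : Mat N n) : Mat N n :=
  (1 + ‖ξ‖ ^ 2) ^ ((β - 1) / 2) • ξ

/-- `V = V_{p/2}`. -/
def V {N n : ℕ} (p : ℝ) (ξ : Mat N n) : Mat N n :=
  Vaux (p / 2) ξ

/-! ### Function spaces -/

/-- `φ ∈ C¹(Ū, ℝᴺ)` with gradient `Dφ`, for an open set `U`: `φ` is continuous on `Ū`,
differentiable in `U`, and its gradient in `U` extends to the continuous function `Dφ` on `Ū`. -/
structure IsC1Closure {N n : ℕ} (U : Set (Vec n)) (φ : Vec n → Vec N)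
    (Dφ : Vec n → Mat N n) : Prop where
  continuousOn : ContinuousOn φ (closure U)
  differentiableAt : ∀ x ∈ U, DifferentiableAt ℝ φ x
  grad_eq : ∀ x ∈ U, grad φ x = Dφ x
  continuousOn_grad : ContinuousOn Dφ (closure U)

/-- `η ∈ C_c^∞(U, E)`. -/
structure IsTestFunction {n : ℕ} {E : Type*} [NormedAddCommGroup E] [NormedSpace ℝ E]
    (U : Set (Vec n)) (η : Vec n → E) : Prop where
  contDiff : ContDiff ℝ ∞ η
  hasCompactSupport : HasCompactSupport η
  tsupport_subset : tsupport η ⊆ U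

/-- `φ ∈ W^{1,q}(U, ℝᴺ)` with weak gradient `Dφ`. -/
structure IsSobolev {N n : ℕ} (U : Set (Vec n)) (q : ENNReal) (φ : Vec n → Vec N)
    (Dφ : Vec n → Mat N n) : Prop where
  memLp : MeasureTheory.MemLp φ q (MeasureTheory.volume.restrict U)
  memLp_grad : MeasureTheory.MemLp Dφ q (MeasureTheory.volume.restrict U)
  weak_grad : ∀ η : Vec n → ℝ, IsTestFunction U η → ∀ (i : Fin N) (j : Fin n),
    ∫ x in U, φ x i * fderiv ℝ η x (EuclideanSpace.single j 1) = -∫ x in U, Dφ x (i, j) * η x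

/-- The `W^{1,q}(U)`-distance of two functions with gradients `Dφ` and `Dψ`. -/
def sobolevDist {N n : ℕ} (U : Set (Vec n)) (q : ENNReal) (φ : Vec n → Vec N)
    (Dφ : Vec n → Mat N n) (ψ : Vec n → Vec N) (Dψ : Vec n → Mat N n) : ENNReal :=
  MeasureTheory.eLpNorm (φ - ψ) q (MeasureTheory.volume.restrict U) +
    MeasureTheory.eLpNorm (Dφ - Dψ) q (MeasureTheory.volume.restrict U)

/-- `φ ∈ W_0^{1,∞}(U, ℝᴺ) = W^{1,∞}(U, ℝᴺ) ∩ W_0^{1,1}(U, ℝᴺ)` with weak gradient `Dφ`, where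
`W_0^{1,1}` is the closure of `C_c^∞` in `W^{1,1}`. -/
structure IsSobolevZeroInfty {N n : ℕ} (U : Set (Vec n)) (φ : Vec n → Vec N)
    (Dφ : Vec n → Mat N n) : Prop where
  isSobolev : IsSobolev U ⊤ φ Dφ
  approx : ∀ ε : ENNReal, 0 < ε → ∃ ψ : Vec n → Vec N,
    IsTestFunction U ψ ∧ sobolevDist U 1 φ Dφ ψ (grad ψ) < ε

/-- `φ ∈ Var(U, ℝᴺ)` with weak gradient `Dφ`: the closure in `W^{1,p}(U, ℝᴺ)` of the functions in
`C¹(Ū, ℝᴺ)` that vanish on `(Γ_D ∩ Ū) ∪ (∂U ∩ Ω)`. -/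
structure IsVariation {N n : ℕ} (Ω ΓD : Set (Vec n)) (p : ℝ) (U : Set (Vec n))
    (φ : Vec n → Vec N) (Dφ : Vec n → Mat N n) : Prop where
  isSobolev : IsSobolev U (ENNReal.ofReal p) φ Dφ
  approx : ∀ ε : ENNReal, 0 < ε → ∃ (ψ : Vec n → Vec N) (Dψ : Vec n → Mat N n),
    IsC1Closure U ψ Dψ ∧ (∀ x ∈ (ΓD ∩ closure U) ∪ (frontier U ∩ Ω), ψ x = 0) ∧
      sobolevDist U (ENNReal.ofReal p) φ Dφ ψ Dψ < ε

/-! ### The domain -/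

/-- Near `x₀`, in the ball of radius `r`, the set `Ω` is the part below the graph of the `C¹`
function `g`, where "up" is the unit vector `e` and `g` is a function of the component
orthogonal to `e` only. -/
structure IsC1Graph {n : ℕ} (Ω : Set (Vec n)) (x₀ : Vec n) (r : ℝ) (e : Vec n)
    (g : Vec n → ℝ) : Prop where
  radius_pos : 0 < r
  norm_eq_one : ‖e‖ = 1
  contDiff : ContDiff ℝ 1 g
  invariant : ∀ (x : Vec n) (t : ℝ), g (x + t • e) = g x
  mem_iff : ∀ x ∈ Metric.ball x₀ r, x ∈ Ω ↔ inner ℝ e x < g x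

/-- `Ω` is a bounded domain (open and connected) of class `C¹`. -/
structure IsBoundedC1Domain {n : ℕ} (Ω : Set (Vec n)) : Prop where
  isOpen : IsOpen Ω
  isConnected : IsConnected Ω
  isBounded : Bornology.IsBounded Ω
  isC1 : ∀ x₀ ∈ frontier Ω, ∃ (r : ℝ) (e : Vec n) (g : Vec n → ℝ), IsC1Graph Ω x₀ r e g

/-- `ν` is the outer unit normal to `∂Ω` at `x₀ ∈ ∂Ω`: the normalization of `e - ∇g(x₀)` when
`Ω` is, near `x₀`, the part below the graph of `g` in direction `e`. -/
def IsOuterUnitNormal {n : ℕ} (Ω : Set (Vec n)) (x₀ ν : Vec n) : Prop :=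
  ∃ (r : ℝ) (e : Vec n) (g : Vec n → ℝ), IsC1Graph Ω x₀ r e g ∧
    ν = ‖e - gradient g x₀‖⁻¹ • (e - gradient g x₀)

/-- The free part `Γ_N = ∂Ω ∖ closure Γ_D` of the boundary. -/
def freeBoundary {n : ℕ} (Ω ΓD : Set (Vec n)) : Set (Vec n) :=
  frontier Ω \ closure ΓD

/-- `B⁻_ν`: the half of the unit ball at `x₀` where `⟨y - x₀, ν⟩ < 0`. -/
def halfBall {n : ℕ} (x₀ ν : Vec n) : Set (Vec n) :=
  {y ∈ Metric.ball x₀ 1 | inner ℝ (y - x₀) ν < 0}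

/-- The open unit cube `Q = (0,1)ⁿ`. -/
def unitCube (n : ℕ) : Set (Vec n) :=
  {x | ∀ i, x i ∈ Set.Ioo (0 : ℝ) 1}

/-! ### The hypotheses on the integrand -/

/-- `p`-growth: `|F(z)| ≤ c₁ (1 + |z|^p)`. -/
def HasPGrowth {N n : ℕ} (p : ℝ) (F : Mat N n → ℝ) : Prop :=
  ∃ c₁ : ℝ, 0 < c₁ ∧ ∀ z : Mat N n, |F z| ≤ c₁ * (1 + ‖z‖ ^ p)

/-- Strong `p`-quasiconvexity with constant `c₂`. -/
def IsStronglyQuasiconvex {N n : ℕ} (p c₂ : ℝ) (F : Mat N n → ℝ) : Prop :=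
  ∀ (z : Mat N n) (φ : Vec n → Vec N) (Dφ : Vec n → Mat N n),
    IsSobolevZeroInfty (unitCube n) φ Dφ →
      c₂ * ∫ x in unitCube n, ‖V p (Dφ x)‖ ^ 2 ≤ ∫ x in unitCube n, (F (z + Dφ x) - F z)

/-- Strong quasiconvexity on the free boundary with constant `c₂`, at the gradient `Du` of a
function in `C¹(Ω̄, ℝᴺ)`. -/
def IsStronglyQuasiconvexAtFreeBoundary {N n : ℕ} (p c₂ : ℝ) (F : Mat N n → ℝ)
    (Ω ΓD : Set (Vec n)) (Du : Vec n → Mat N n) : Prop :=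
  ∀ x₀ ∈ freeBoundary Ω ΓD, ∀ ν : Vec n, IsOuterUnitNormal Ω x₀ ν →
    ∀ φ : Vec n → Vec N, ContDiffOn ℝ ∞ φ (closure (halfBall x₀ ν)) →
      (∀ x ∈ Metric.sphere x₀ 1 ∩ closure (halfBall x₀ ν), φ x = 0) →
        c₂ * ∫ x in halfBall x₀ ν, ‖V p (grad φ x)‖ ^ 2 ≤
          ∫ x in halfBall x₀ ν, (F (Du x₀ + grad φ x) - F (Du x₀))

/-- `u ∈ W^{1,p}(Ω, ℝᴺ)`, with weak gradient `Du`, is an `F`-extremal. -/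
structure IsExtremal {N n : ℕ} (p : ℝ) (F : Mat N n → ℝ) (Ω ΓD : Set (Vec n))
    (u : Vec n → Vec N) (Du : Vec n → Mat N n) : Prop where
  isSobolev : IsSobolev Ω (ENNReal.ofReal p) u Du
  euler_lagrange : ∀ (φ : Vec n → Vec N) (Dφ : Vec n → Mat N n), IsVariation Ω ΓD p Ω φ Dφ →
    ∫ x in Ω, inner ℝ (gradient F (Du x)) (Dφ x) = 0

end Zhang

end

/-! Write E(z, ξ) = F(z + ξ) - F(z) - F'(z)ξ (`excess`). Extremality makes the linear term integrate
to zero against admissible variations, so the claim is a lower bound for ∫ E(∇u, ∇φ). On a small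
ball ∇u is nearly constant, and E(z, ξ) changes by at most ε|V(ξ)|² when a bounded z moves slightly
(`excess_sub_base`). It therefore suffices to have the bound for a frozen z with constant 3c₂/4; the
remaining quarter of c₂ pays for freezing.

For a fixed z there are two cases. If the closure of Ω ∩ B meets ∂Ω only in the closure of Γ_D, the
variation extends by zero to a compactly supported function and (H2), rescaled from the cube to a
ball, applies. Otherwise there is a free boundary point x₁ nearby. Take z = ∇u(x₁), flatten ∂Ω by a
shear, which preserves volume, and use (H2') on half balls. The derivative of the shear is close to
the identity near x₁, so |V|² and E(z, ·) change by small multiples of |V|² (`vfun_lower_of_close`,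
`excess_sub_arg`); this is `excessBound_of_graph`. Compactness of ∂Ω and uniform continuity of ∇u
make the radius independent of the centre.

The perturbation estimates need |F'(z)| ≤ C(1 + |z|)^(p-1). Quasiconvexity makes F convex in each
matrix entry, and a convex function with p-growth has such a derivative (`exists_hasGradGrowth`).

The zero extension of a C¹ variation from Ω ∩ B need not be C¹. The variation is first truncated to
vanish around its zero set, after which the extension is C¹ up to ∂Ω (`isC1Closure_trunc`); a
translation and a cutoff then turn it into a C¹ function on the whole space
(`excessBound_of_shift`). The truncation is removed by dominated convergence, since a gradient
vanishes a.e. where the function does. The general variation follows by density, through local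
Lipschitz bounds of order p - 1 (`integral_nonneg_of_approx`). -/

noncomputable section

namespace Zhang

open MeasureTheory Filter Topology Metric Set

/-! ### The integrand `|V|²` -/

/-- `|V(ξ)|²` as a function of `|ξ|`. -/
def vfun (p s : ℝ) : ℝ := (1 + s ^ 2) ^ ((p - 2) / 2) * s ^ 2

lemma norm_V_sq {N n : ℕ} (p : ℝ) (ξ : Mat N n) : ‖V p ξ‖ ^ 2 = vfun p ‖ξ‖ := by
  have h : (0 : ℝ) ≤ 1 + ‖ξ‖ ^ 2 := by positivity
  rw [V, Vaux, norm_smul, mul_pow, vfun, Real.norm_of_nonneg (Real.rpow_nonneg h _),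
    ← Real.rpow_natCast, ← Real.rpow_mul h]
  congr 2
  push_cast
  ring

lemma vfun_nonneg (p s : ℝ) : 0 ≤ vfun p s := by
  unfold vfun; positivity

lemma continuous_vfun (p : ℝ) : Continuous (vfun p) := by
  unfold vfun
  refine Continuous.mul (Continuous.rpow_const (by fun_prop) fun s => Or.inl ?_) (by fun_prop)
  positivity

lemma min_one_rpow_le {b q : ℝ} (h1 : 1 ≤ b) (h2 : b ≤ 2) : min 1 ((2 : ℝ) ^ q) ≤ b ^ q := by
  rcases le_total 0 q with hq | hq
  · exact (min_le_left _ _).trans (Real.one_le_rpow h1 hq)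
  · exact (min_le_right _ _).trans (Real.rpow_le_rpow_of_nonpos (by linarith) h2 hq)

/-- Either 1 + s² or (1 + s²)/s² lies in [1, 2], so its power (p-2)/2 is at least min(1,
2^((p-2)/2)). Thus |V|² dominates the quadratic behaviour near 0 and the p-growth at infinity; the
two perturbation estimates for the excess treat these regimes separately. -/
lemma exists_vfun_lower (p : ℝ) : ∃ c : ℝ, 0 < c ∧
    (∀ s, 0 ≤ s → s ≤ 1 → c * s ^ 2 ≤ vfun p s) ∧ ∀ s, 1 ≤ s → c * s ^ p ≤ vfun p s := by
  refine ⟨min 1 ((2 : ℝ) ^ ((p - 2) / 2)), by positivity, fun s h0 h1 => ?_, fun s h1 => ?_⟩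
  · exact mul_le_mul_of_nonneg_right (min_one_rpow_le (by nlinarith) (by nlinarith)) (sq_nonneg s)
  · have hs : 0 < s := by linarith
    have hb : 1 + s ^ 2 = (1 + (s ^ 2)⁻¹) * s ^ 2 := by field_simp; ring
    have hi : (s ^ 2)⁻¹ ≤ 1 := inv_le_one_of_one_le₀ (by nlinarith)
    have hi0 : 0 ≤ (s ^ 2)⁻¹ := by positivity
    have hsp : s ^ p = (s ^ 2) ^ ((p - 2) / 2) * s ^ 2 := by
      rw [← Real.rpow_natCast s 2, ← Real.rpow_mul hs.le, ← Real.rpow_add hs]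
      congr 1; push_cast; ring
    rw [vfun, hb, Real.mul_rpow (by positivity) (by positivity), hsp, mul_assoc]
    exact mul_le_mul_of_nonneg_right (min_one_rpow_le (by linarith) (by linarith)) (by positivity)

lemma vfun_mono {p : ℝ} (hp : 1 < p) {s t : ℝ} (hs : 0 ≤ s) (hst : s ≤ t) :
    vfun p s ≤ vfun p t := by
  have hsq : s ^ 2 ≤ t ^ 2 := pow_le_pow_left₀ hs hst 2
  rcases le_total 0 ((p - 2) / 2) with hq | hq
  · exact mul_le_mul (Real.rpow_le_rpow (by positivity) (by linarith) hq) hsq (by positivity)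
      (by positivity)
  -- For p ≤ 2 the weight decreases; in this form the first power increases because p > 0, and the
  -- subtracted one does not increase.
  · have key : ∀ r : ℝ, vfun p r = (1 + r ^ 2) ^ (p / 2) - (1 + r ^ 2) ^ ((p - 2) / 2) := by
      intro r
      have : (1 + r ^ 2) ^ (p / 2) = (1 + r ^ 2) ^ ((p - 2) / 2) * (1 + r ^ 2) := by
        conv_rhs => rw [← Real.rpow_add_one (by positivity)]
        congr 1; ring
      rw [this, vfun]; ring
    rw [key, key]
    have h1 := Real.rpow_le_rpow (by positivity) (by linarith : 1 + s ^ 2 ≤ 1 + t ^ 2)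
      (by linarith : 0 ≤ p / 2)
    have h2 := Real.rpow_le_rpow_of_nonpos (by positivity) (by linarith : 1 + s ^ 2 ≤ 1 + t ^ 2) hq
    linarith

/-- One exponent serves both signs of p - 2. For p ≥ 2 the bound l²(1 + s²) ≤ 1 + (ls)² is raised to
the power (p-2)/2; for p ≤ 2 shrinking s only enlarges the weight, and the factor l^|p-2| ≤ 1 is
given away. -/
lemma rpow_mul_vfun_le (p : ℝ) {l s : ℝ} (hl : 0 < l) (hl1 : l ≤ 1) :
    l ^ (|p - 2| + 2) * vfun p s ≤ vfun p (l * s) := by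
  have hb : l ^ 2 * (1 + s ^ 2) ≤ 1 + (l * s) ^ 2 := by nlinarith
  have hl2 : l ^ (|p - 2| + 2) = l ^ |p - 2| * l ^ 2 := by
    rw [Real.rpow_add hl]; norm_num
  have key : l ^ |p - 2| * (1 + s ^ 2) ^ ((p - 2) / 2) ≤ (1 + (l * s) ^ 2) ^ ((p - 2) / 2) := by
    rcases le_total 0 (p - 2) with hq | hq
    · rw [abs_of_nonneg hq]
      have h1 : l ^ (p - 2) = (l ^ 2) ^ ((p - 2) / 2) := by
        rw [← Real.rpow_natCast l 2, ← Real.rpow_mul hl.le]; congr 1; push_cast; ring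
      rw [h1, ← Real.mul_rpow (by positivity) (by positivity)]
      exact Real.rpow_le_rpow (by positivity) hb (by linarith)
    · calc _ ≤ 1 * (1 + s ^ 2) ^ ((p - 2) / 2) := by
            gcongr
            exact Real.rpow_le_one hl.le hl1 (abs_nonneg _)
        _ ≤ _ := by
            rw [one_mul]
            refine Real.rpow_le_rpow_of_nonpos (by positivity) ?_ (by linarith)
            have : (l * s) ^ 2 ≤ s ^ 2 := by
              rw [mul_pow]
              exact mul_le_of_le_one_left (sq_nonneg s) (pow_le_one₀ hl.le hl1)
            linarith
  calc l ^ (|p - 2| + 2) * vfun p s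
      = (l ^ |p - 2| * (1 + s ^ 2) ^ ((p - 2) / 2)) * (l ^ 2 * s ^ 2) := by rw [hl2, vfun]; ring
    _ ≤ _ := by
      rw [vfun, mul_pow]
      exact mul_le_mul_of_nonneg_right (by simpa [mul_pow] using key) (by positivity)

/-- Bernoulli's inequality for (1 - d)^(|p-2|+2) makes the loss linear in the relative error d,
which is what a small change of the gradient by flattening requires. -/
lemma vfun_lower_of_close {p : ℝ} (hp : 1 < p) {d s t : ℝ} (hd : 0 ≤ d) (hd1 : d < 1)
    (hs : 0 ≤ s) (hst : (1 - d) * s ≤ t) :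
    (1 - (|p - 2| + 2) * d) * vfun p s ≤ vfun p t := by
  have hB := one_add_mul_self_le_rpow_one_add (s := -d) (by linarith)
    (p := |p - 2| + 2) (by linarith [abs_nonneg (p - 2)])
  calc _ ≤ (1 - d) ^ (|p - 2| + 2) * vfun p s := by
        refine mul_le_mul_of_nonneg_right ?_ (vfun_nonneg _ _)
        rw [← sub_eq_add_neg] at hB
        linarith
    _ ≤ vfun p ((1 - d) * s) := rpow_mul_vfun_le p (by linarith) (by linarith)
    _ ≤ _ := vfun_mono hp (mul_nonneg (by linarith) hs) hst

lemma exists_vfun_lipschitz {p : ℝ} (hp : 1 < p) : ∃ C : ℝ, 0 < C ∧ ∀ s t, 0 ≤ s → 0 ≤ t →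
    |vfun p s - vfun p t| ≤ C * (1 + s + t) ^ (p - 1) * |s - t| := by
  refine ⟨|p - 2| + 2, by positivity, fun s t hs ht => ?_⟩
  set q := (p - 2) / 2 with hq
  have hd : ∀ r : ℝ, HasDerivAt (vfun p)
      ((2 * r) * q * (1 + r ^ 2) ^ (q - 1) * r ^ 2 + (1 + r ^ 2) ^ q * (2 * r)) r := by
    intro r
    have h1 : HasDerivAt (fun r : ℝ => 1 + r ^ 2) (2 * r) r := by
      simpa using (hasDerivAt_pow 2 r).const_add 1
    have h2 := h1.rpow_const (p := q) (Or.inl (by positivity))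
    have h3 : HasDerivAt (fun r : ℝ => r ^ 2) (2 * r) r := by simpa using hasDerivAt_pow 2 r
    exact h2.mul h3
  have hb : ∀ r ∈ Icc 0 (s + t), ‖(2 * r) * q * (1 + r ^ 2) ^ (q - 1) * r ^ 2 +
      (1 + r ^ 2) ^ q * (2 * r)‖ ≤ (|p - 2| + 2) * (1 + s + t) ^ (p - 1) := by
    rintro r ⟨hr0, hr1⟩
    have hpos : (0 : ℝ) < 1 + r ^ 2 := by positivity
    have e1 : (1 + r ^ 2) ^ q = (1 + r ^ 2) ^ (q - 1) * (1 + r ^ 2) := by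
      conv_rhs => rw [← Real.rpow_add_one hpos.ne']
      congr 1; ring
    have e2 : (1 + r ^ 2) ^ (q - 1) * r ^ 2 ≤ (1 + r ^ 2) ^ q := by
      rw [e1]; gcongr; linarith
    have e3 : (1 + r ^ 2) ^ q * r ≤ (1 + s + t) ^ (p - 1) := by
      calc (1 + r ^ 2) ^ q * r ≤ (1 + r ^ 2) ^ q * (1 + r ^ 2) ^ ((1 : ℝ) / 2) := by
            gcongr
            rw [← Real.sqrt_eq_rpow]
            exact Real.le_sqrt_of_sq_le (by linarith)
        _ = (1 + r ^ 2) ^ ((p - 1) / 2) := by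
            rw [← Real.rpow_add hpos]; congr 1; rw [hq]; ring
        _ ≤ ((1 + s + t) ^ 2) ^ ((p - 1) / 2) :=
            Real.rpow_le_rpow hpos.le (by nlinarith) (by linarith)
        _ = (1 + s + t) ^ (p - 1) := by
            rw [← Real.rpow_natCast (1 + s + t) 2, ← Real.rpow_mul (by positivity)]
            congr 1; push_cast; ring
    calc _ ≤ |(2 * r) * q * (1 + r ^ 2) ^ (q - 1) * r ^ 2| + |(1 + r ^ 2) ^ q * (2 * r)| :=
          abs_add_le _ _
      _ = |p - 2| * r * ((1 + r ^ 2) ^ (q - 1) * r ^ 2) + 2 * ((1 + r ^ 2) ^ q * r) := by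
          have : |q| = |p - 2| / 2 := by rw [hq, abs_div]; norm_num
          simp only [abs_mul, this, abs_of_nonneg hr0, abs_of_nonneg (Real.rpow_nonneg hpos.le _),
            abs_two, abs_of_nonneg (sq_nonneg r)]
          ring
      _ ≤ |p - 2| * r * (1 + r ^ 2) ^ q + 2 * ((1 + r ^ 2) ^ q * r) := by gcongr
      _ = (|p - 2| + 2) * ((1 + r ^ 2) ^ q * r) := by ring
      _ ≤ _ := by gcongr
  have := (convex_Icc (0 : ℝ) (s + t)).norm_image_sub_le_of_norm_hasDerivWithin_le
    (fun r _ => (hd r).hasDerivWithinAt) hb (x := t) (y := s) ⟨ht, by linarith⟩ ⟨hs, by linarith⟩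
  simpa [Real.norm_eq_abs] using this

/-! ### The excess of a `C²` integrand -/

section Excess

variable {E : Type*} [NormedAddCommGroup E] [NormedSpace ℝ E]

/-- `F(z + ξ) - F(z) - DF(z) ξ`. -/
def excess (F : E → ℝ) (z ξ : E) : ℝ := F (z + ξ) - F z - fderiv ℝ F z ξ

/-- `|DF(z)| ≤ C (1 + |z|)^{p-1}`. -/
def HasGradGrowth (p : ℝ) (F : E → ℝ) (C : ℝ) : Prop :=
  ∀ z, ‖fderiv ℝ F z‖ ≤ C * (1 + ‖z‖) ^ (p - 1)

lemma HasGradGrowth.nonneg {p C : ℝ} {F : E → ℝ} (h : HasGradGrowth p F C) : 0 ≤ C := by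
  simpa using (norm_nonneg _).trans (h 0)

lemma HasGradGrowth.lipschitz {p C : ℝ} (hp : 1 < p) {F : E → ℝ} (h : HasGradGrowth p F C)
    (hF : Differentiable ℝ F) (x y : E) :
    |F x - F y| ≤ C * (1 + ‖x‖ + ‖y‖) ^ (p - 1) * ‖x - y‖ := by
  have hC := h.nonneg
  have := (convex_segment y x).norm_image_sub_le_of_norm_fderiv_le (𝕜 := ℝ) (f := F)
    (C := C * (1 + ‖x‖ + ‖y‖) ^ (p - 1)) (fun z _ => hF z) (fun z hz => ?_)
    (left_mem_segment ℝ y x) (right_mem_segment ℝ y x)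
  · exact this
  · refine (h z).trans ?_
    have hz' : ‖z‖ ≤ ‖x‖ + ‖y‖ := by
      obtain ⟨a, b, ha, hb, hab, rfl⟩ := hz
      refine (norm_add_le _ _).trans ?_
      rw [norm_smul, norm_smul, Real.norm_of_nonneg ha, Real.norm_of_nonneg hb]
      nlinarith [norm_nonneg x, norm_nonneg y]
    exact mul_le_mul_of_nonneg_left
      (Real.rpow_le_rpow (by positivity) (by linarith) (by linarith)) hC

lemma excess_hasFDerivAt {F : E → ℝ} (hF : Differentiable ℝ F) (z ξ : E) :
    HasFDerivAt (excess F z) (fderiv ℝ F (z + ξ) - fderiv ℝ F z) ξ := by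
  unfold excess
  have h1 : HasFDerivAt (fun ξ => F (z + ξ)) (fderiv ℝ F (z + ξ)) ξ := by
    exact (hasFDerivAt_comp_add_left z).2 (hF (z + ξ)).hasFDerivAt
  exact (h1.sub_const _).sub (fderiv ℝ F z).hasFDerivAt

lemma excess_zero (F : E → ℝ) (z : E) : excess F z 0 = 0 := by simp [excess]

lemma continuous_excess {F : E → ℝ} (hF : ContDiff ℝ 2 F) :
    Continuous fun q : E × E => excess F q.1 q.2 := by
  have h1 := hF.continuous
  have h2 : Continuous (fderiv ℝ F) := hF.continuous_fderiv (by norm_num)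
  unfold excess
  refine Continuous.sub (by fun_prop) ?_
  exact (h2.comp continuous_fst).clm_apply continuous_snd

lemma exists_second_deriv_bound [FiniteDimensional ℝ E] {F : E → ℝ} (hF : ContDiff ℝ 2 F)
    (M : ℝ) : ∃ L : ℝ, 0 ≤ L ∧ ∀ z ∈ closedBall (0 : E) M, ‖fderiv ℝ (fderiv ℝ F) z‖ ≤ L := by
  have hc : Continuous (fderiv ℝ (fderiv ℝ F)) :=
    (hF.fderiv_right (m := 1) (by norm_num)).continuous_fderiv (by norm_num)
  have : ProperSpace E := FiniteDimensional.proper ℝ E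
  obtain ⟨L, hL⟩ := (isCompact_closedBall (0 : E) M).exists_bound_of_continuousOn
    (f := fderiv ℝ (fderiv ℝ F)) hc.continuousOn
  exact ⟨max L 0, le_max_right _ _, fun z hz => (hL z hz).trans (le_max_left _ _)⟩

/-- For |ξ| ≤ 1 the mean value inequality is used twice: the difference of the excesses and its
derivative in ξ both vanish at ξ = 0, and uniform continuity of F'' controls the second derivative,
giving εc|ξ|². For |ξ| ≥ 1 the growth of F' gives K|z - z'||ξ|^p. Both are dominated by |V(ξ)|². -/
lemma excess_sub_base [FiniteDimensional ℝ E] {p C : ℝ} (hp : 1 < p) {F : E → ℝ}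
    (hF : ContDiff ℝ 2 F) (hG : HasGradGrowth p F C) (M : ℝ) {ε : ℝ} (hε : 0 < ε) :
    ∃ δ : ℝ, 0 < δ ∧ ∀ z z' : E, ‖z‖ ≤ M → ‖z'‖ ≤ M → ‖z - z'‖ ≤ δ → ∀ ξ,
      |excess F z ξ - excess F z' ξ| ≤ ε * vfun p ‖ξ‖ := by
  obtain ⟨c, hc, hlow1, hlow2⟩ := exists_vfun_lower p
  have hC := hG.nonneg
  have hdF : Differentiable ℝ F := hF.differentiable (by norm_num)
  have hF1 : ContDiff ℝ 1 (fderiv ℝ F) := hF.fderiv_right (m := 1) (by norm_num)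
  have hdF' : Differentiable ℝ (fderiv ℝ F) := hF1.differentiable (by norm_num)
  have : ProperSpace E := FiniteDimensional.proper ℝ E
  have huc := (isCompact_closedBall (0 : E) (M + 1)).uniformContinuousOn_of_continuous
    (hF1.continuous_fderiv (by norm_num)).continuousOn
  rw [Metric.uniformContinuousOn_iff_le] at huc
  obtain ⟨δ₁, hδ₁, huc⟩ := huc (ε * c) (by positivity)
  obtain ⟨L, hL, hL'⟩ := exists_second_deriv_bound hF M
  set K := C * (1 + 2 * |M| + 2) ^ (p - 1) + C * (1 + 2 * |M|) ^ (p - 1) + L with hK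
  have hK0 : 0 ≤ K := by positivity
  refine ⟨min δ₁ (ε * c / (K + 1)), by positivity, fun z z' hz hz' hzz ξ => ?_⟩
  have hz1 := hzz.trans (min_le_left _ _)
  have hz2 := hzz.trans (min_le_right _ _)
  rcases le_total ‖ξ‖ 1 with h1 | h1
  · have hA : ∀ ζ ∈ closedBall (0 : E) ‖ξ‖,
        ‖fderiv ℝ F (z + ζ) - fderiv ℝ F z - (fderiv ℝ F (z' + ζ) - fderiv ℝ F z')‖
          ≤ ε * c * ‖ξ‖ := by
      intro ζ hζ
      have hd : ∀ y : E, HasFDerivAt (fun y => fderiv ℝ F (z + y) - fderiv ℝ F (z' + y))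
          (fderiv ℝ (fderiv ℝ F) (z + y) - fderiv ℝ (fderiv ℝ F) (z' + y)) y := by
        intro y
        exact ((hasFDerivAt_comp_add_left z).2 (hdF' (z + y)).hasFDerivAt).sub
          ((hasFDerivAt_comp_add_left z').2 (hdF' (z' + y)).hasFDerivAt)
      have := (convex_closedBall (0 : E) ‖ξ‖).norm_image_sub_le_of_norm_hasFDerivWithin_le
        (fun y _ => (hd y).hasFDerivWithinAt) (C := ε * c) (fun y hy => ?_)
        (mem_closedBall_self (norm_nonneg ξ)) hζ
      · simp only [add_zero, sub_zero] at this
        rw [show fderiv ℝ F (z + ζ) - fderiv ℝ F z - (fderiv ℝ F (z' + ζ) - fderiv ℝ F z') =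
          fderiv ℝ F (z + ζ) - fderiv ℝ F (z' + ζ) - (fderiv ℝ F z - fderiv ℝ F z') by abel]
        refine this.trans ?_
        have := mem_closedBall_zero_iff.1 hζ
        gcongr
      · rw [← dist_eq_norm]
        have := mem_closedBall_zero_iff.1 hy
        refine huc _ ?_ _ ?_ ?_
        · rw [mem_closedBall_zero_iff]; exact (norm_add_le _ _).trans (by linarith)
        · rw [mem_closedBall_zero_iff]; exact (norm_add_le _ _).trans (by linarith)
        · rw [dist_eq_norm]; simpa using hz1
    have := (convex_closedBall (0 : E) ‖ξ‖).norm_image_sub_le_of_norm_hasFDerivWithin_le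
      (fun y _ => ((excess_hasFDerivAt hdF z y).sub (excess_hasFDerivAt hdF z' y)).hasFDerivWithinAt)
      hA (mem_closedBall_self (norm_nonneg ξ)) (mem_closedBall_zero_iff.2 le_rfl)
    simp only [Pi.sub_apply, excess_zero, sub_zero, Real.norm_eq_abs] at this
    refine this.trans ?_
    have := mul_le_mul_of_nonneg_left (hlow1 ‖ξ‖ (norm_nonneg _) h1) hε.le
    linarith
  · have hξ0 : 0 < ‖ξ‖ := by linarith
    have hM := (le_abs_self M)
    have hM0 := abs_nonneg M
    have hp1 : ‖ξ‖ ^ p = ‖ξ‖ ^ (p - 1) * ‖ξ‖ := by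
      rw [← Real.rpow_add_one hξ0.ne']; congr 1; ring
    have h1p : 1 ≤ ‖ξ‖ ^ (p - 1) := Real.one_le_rpow h1 (by linarith)
    have b1 : |F (z + ξ) - F (z' + ξ)| ≤ C * (1 + 2 * |M| + 2) ^ (p - 1) * ‖z - z'‖ * ‖ξ‖ ^ p := by
      have := hG.lipschitz hp hdF (z + ξ) (z' + ξ)
      rw [add_sub_add_right_eq_sub] at this
      have h2 : 1 + ‖z + ξ‖ + ‖z' + ξ‖ ≤ (1 + 2 * |M| + 2) * ‖ξ‖ := by
        have := norm_add_le z ξ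
        have := norm_add_le z' ξ
        nlinarith
      have h3 : (1 + ‖z + ξ‖ + ‖z' + ξ‖) ^ (p - 1) ≤ (1 + 2 * |M| + 2) ^ (p - 1) * ‖ξ‖ ^ (p - 1) := by
        rw [← Real.mul_rpow (by positivity) (by positivity)]
        exact Real.rpow_le_rpow (by positivity) h2 (by linarith)
      calc _ ≤ _ := this
        _ ≤ C * ((1 + 2 * |M| + 2) ^ (p - 1) * ‖ξ‖ ^ (p - 1)) * ‖z - z'‖ := by gcongr
        _ ≤ C * ((1 + 2 * |M| + 2) ^ (p - 1) * (‖ξ‖ ^ (p - 1) * ‖ξ‖)) * ‖z - z'‖ := by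
            gcongr
            exact le_mul_of_one_le_right (by positivity) h1
        _ = _ := by rw [hp1]; ring
    have b2 : |F z - F z'| ≤ C * (1 + 2 * |M|) ^ (p - 1) * ‖z - z'‖ * ‖ξ‖ ^ p := by
      have h3 : (1 + ‖z‖ + ‖z'‖) ^ (p - 1) ≤ (1 + 2 * |M|) ^ (p - 1) :=
        Real.rpow_le_rpow (by positivity) (by linarith) (by linarith)
      calc _ ≤ _ := hG.lipschitz hp hdF z z'
        _ ≤ C * (1 + 2 * |M|) ^ (p - 1) * ‖z - z'‖ := by gcongr
        _ ≤ _ := le_mul_of_one_le_right (by positivity) (Real.one_le_rpow h1 (by linarith))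
    have b3 : |fderiv ℝ F z ξ - fderiv ℝ F z' ξ| ≤ L * ‖z - z'‖ * ‖ξ‖ ^ p := by
      have := (convex_closedBall (0 : E) M).norm_image_sub_le_of_norm_fderiv_le (𝕜 := ℝ)
        (fun y _ => hdF' y) hL' (mem_closedBall_zero_iff.2 hz') (mem_closedBall_zero_iff.2 hz)
      calc _ = ‖(fderiv ℝ F z - fderiv ℝ F z') ξ‖ := by simp
        _ ≤ ‖fderiv ℝ F z - fderiv ℝ F z'‖ * ‖ξ‖ := ContinuousLinearMap.le_opNorm _ _
        _ ≤ L * ‖z - z'‖ * ‖ξ‖ := by gcongr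
        _ ≤ _ := by rw [hp1]; gcongr; exact le_mul_of_one_le_left hξ0.le h1p
    have : |excess F z ξ - excess F z' ξ| ≤ K * ‖z - z'‖ * ‖ξ‖ ^ p := by
      unfold excess
      rw [show F (z + ξ) - F z - fderiv ℝ F z ξ - (F (z' + ξ) - F z' - fderiv ℝ F z' ξ) =
        (F (z + ξ) - F (z' + ξ)) - (F z - F z') - (fderiv ℝ F z ξ - fderiv ℝ F z' ξ) by ring]
      refine (abs_sub _ _).trans ((add_le_add_left (abs_sub _ _) _).trans ?_)
      rw [hK]; linarith
    refine this.trans ?_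
    have h5 : K * ‖z - z'‖ ≤ ε * c := by
      calc K * ‖z - z'‖ ≤ (K + 1) * (ε * c / (K + 1)) := by gcongr; linarith
        _ = ε * c := by field_simp
    have := mul_le_mul_of_nonneg_left (hlow2 ‖ξ‖ h1) hε.le
    have := mul_le_mul_of_nonneg_right h5 (Real.rpow_nonneg hξ0.le p)
    linarith

/-- The derivative of the excess in ξ is O(|ξ|) for |ξ| ≤ 1, and the growth of F' covers |ξ| ≥ 1. A
relative error d in ξ thus costs O(d)|V(ξ)|², with a constant uniform over bounded base points. -/
lemma excess_sub_arg [FiniteDimensional ℝ E] {p C : ℝ} (hp : 1 < p) {F : E → ℝ}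
    (hF : ContDiff ℝ 2 F) (hG : HasGradGrowth p F C) (M : ℝ) :
    ∃ K : ℝ, 0 ≤ K ∧ ∀ z : E, ‖z‖ ≤ M → ∀ (d : ℝ) (ξ ξ' : E), 0 ≤ d → d ≤ 1 →
      ‖ξ' - ξ‖ ≤ d * ‖ξ‖ → |excess F z ξ' - excess F z ξ| ≤ K * d * vfun p ‖ξ‖ := by
  obtain ⟨c, hc, hlow1, hlow2⟩ := exists_vfun_lower p
  have hC := hG.nonneg
  have hdF : Differentiable ℝ F := hF.differentiable (by norm_num)
  have hF1 : ContDiff ℝ 1 (fderiv ℝ F) := hF.fderiv_right (m := 1) (by norm_num)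
  have hdF' : Differentiable ℝ (fderiv ℝ F) := hF1.differentiable (by norm_num)
  obtain ⟨L, hL, hL'⟩ := exists_second_deriv_bound hF (M + 2)
  set K := 2 * L + C * (4 + 2 * |M|) ^ (p - 1) + C * (1 + |M|) ^ (p - 1) with hK
  have hK0 : 0 ≤ K := by positivity
  refine ⟨K / c, by positivity, fun z hz d ξ ξ' hd hd1 hξ => ?_⟩
  have hξ' : ‖ξ'‖ ≤ 2 * ‖ξ‖ := by
    have := norm_le_norm_add_norm_sub' ξ' ξ
    nlinarith [norm_nonneg ξ]
  rcases le_total ‖ξ‖ 1 with h1 | h1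
  -- The ball of radius 2|ξ| is convex and contains both ξ and ξ'. Since |ξ| ≤ 1, its translate by z
  -- stays in the ball of radius M + 2 where F'' is bounded.
  · have hA : ∀ ζ ∈ closedBall (0 : E) (2 * ‖ξ‖),
        ‖fderiv ℝ F (z + ζ) - fderiv ℝ F z‖ ≤ 2 * L * ‖ξ‖ := by
      intro ζ hζ
      have hζ' := mem_closedBall_zero_iff.1 hζ
      have := (convex_closedBall (0 : E) (M + 2)).norm_image_sub_le_of_norm_fderiv_le (𝕜 := ℝ)
        (fun y _ => hdF' y) hL' (x := z) (y := z + ζ) (mem_closedBall_zero_iff.2 (by linarith))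
        (mem_closedBall_zero_iff.2 ((norm_add_le _ _).trans (by linarith)))
      rw [add_sub_cancel_left] at this
      exact this.trans (by nlinarith)
    have := (convex_closedBall (0 : E) (2 * ‖ξ‖)).norm_image_sub_le_of_norm_hasFDerivWithin_le
      (fun y _ => (excess_hasFDerivAt hdF z y).hasFDerivWithinAt)
      hA (x := ξ) (y := ξ') (mem_closedBall_zero_iff.2 (by linarith [norm_nonneg ξ]))
      (mem_closedBall_zero_iff.2 hξ')
    refine this.trans ?_
    calc 2 * L * ‖ξ‖ * ‖ξ' - ξ‖ ≤ 2 * L * ‖ξ‖ * (d * ‖ξ‖) := by gcongr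
      _ ≤ K / c * d * (c * ‖ξ‖ ^ 2) := by
          rw [show K / c * d * (c * ‖ξ‖ ^ 2) = K * (d * ‖ξ‖ ^ 2) by field_simp]
          have : 2 * L ≤ K := by
            have : 0 ≤ C * (4 + 2 * |M|) ^ (p - 1) + C * (1 + |M|) ^ (p - 1) := by positivity
            linarith
          calc _ = 2 * L * (d * ‖ξ‖ ^ 2) := by ring
            _ ≤ _ := by gcongr
      _ ≤ _ := by gcongr; exact hlow1 _ (norm_nonneg _) h1
  · have hξ0 : 0 < ‖ξ‖ := by linarith
    have hM := (le_abs_self M)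
    have hM0 := abs_nonneg M
    have hp1 : ‖ξ‖ ^ p = ‖ξ‖ ^ (p - 1) * ‖ξ‖ := by
      rw [← Real.rpow_add_one hξ0.ne']; congr 1; ring
    have h1p : 1 ≤ ‖ξ‖ ^ (p - 1) := Real.one_le_rpow h1 (by linarith)
    have b1 : |F (z + ξ') - F (z + ξ)| ≤ C * (4 + 2 * |M|) ^ (p - 1) * d * ‖ξ‖ ^ p := by
      have := hG.lipschitz hp hdF (z + ξ') (z + ξ)
      rw [add_sub_add_left_eq_sub] at this
      have h2 : 1 + ‖z + ξ'‖ + ‖z + ξ‖ ≤ (4 + 2 * |M|) * ‖ξ‖ := by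
        have := norm_add_le z ξ
        have := norm_add_le z ξ'
        nlinarith
      have h3 : (1 + ‖z + ξ'‖ + ‖z + ξ‖) ^ (p - 1) ≤ (4 + 2 * |M|) ^ (p - 1) * ‖ξ‖ ^ (p - 1) := by
        rw [← Real.mul_rpow (by positivity) (by positivity)]
        exact Real.rpow_le_rpow (by positivity) h2 (by linarith)
      calc _ ≤ _ := this
        _ ≤ C * ((4 + 2 * |M|) ^ (p - 1) * ‖ξ‖ ^ (p - 1)) * (d * ‖ξ‖) := by gcongr
        _ = _ := by rw [hp1]; ring
    have b3 : |fderiv ℝ F z ξ' - fderiv ℝ F z ξ| ≤ C * (1 + |M|) ^ (p - 1) * d * ‖ξ‖ ^ p := by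
      have h3 : ‖fderiv ℝ F z‖ ≤ C * (1 + |M|) ^ (p - 1) := by
        refine (hG z).trans ?_
        gcongr
        linarith
      calc _ = ‖(fderiv ℝ F z) (ξ' - ξ)‖ := by simp
        _ ≤ ‖fderiv ℝ F z‖ * ‖ξ' - ξ‖ := ContinuousLinearMap.le_opNorm _ _
        _ ≤ C * (1 + |M|) ^ (p - 1) * (d * ‖ξ‖) := by gcongr
        _ = C * (1 + |M|) ^ (p - 1) * d * ‖ξ‖ := by ring
        _ ≤ _ := by rw [hp1]; gcongr; exact le_mul_of_one_le_left hξ0.le h1p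
    have : |excess F z ξ' - excess F z ξ| ≤ K * d * ‖ξ‖ ^ p := by
      unfold excess
      rw [show F (z + ξ') - F z - fderiv ℝ F z ξ' - (F (z + ξ) - F z - fderiv ℝ F z ξ) =
        (F (z + ξ') - F (z + ξ)) - (fderiv ℝ F z ξ' - fderiv ℝ F z ξ) by ring]
      refine (abs_sub _ _).trans ?_
      have : 0 ≤ 2 * L * d * ‖ξ‖ ^ p := by positivity
      rw [hK]; linarith
    refine this.trans ?_
    calc _ = K / c * d * (c * ‖ξ‖ ^ p) := by field_simp
      _ ≤ _ := by gcongr; exact hlow2 _ h1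

end Excess

/-! ### Linear maps as matrices -/

lemma toMat_apply {N n : ℕ} (L : Vec n →L[ℝ] Vec N) (i : Fin N) (j : Fin n) :
    toMat L (i, j) = L (EuclideanSpace.single j 1) i := rfl

/-- `toMat` as a linear map. -/
def toMatₗ (N n : ℕ) : (Vec n →L[ℝ] Vec N) →ₗ[ℝ] Mat N n where
  toFun := toMat
  map_add' L L' := by ext ij; simp [toMat]
  map_smul' c L := by ext ij; simp [toMat]

lemma toMatₗ_bijective (N n : ℕ) : Function.Bijective (toMatₗ N n) := by
  constructor
  · intro L L' h
    have : (L : Vec n →ₗ[ℝ] Vec N) = L' := by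
      refine (EuclideanSpace.basisFun (Fin n) ℝ).toBasis.ext fun j => ?_
      ext i
      have hij : toMat L (i, j) = toMat L' (i, j) := congrArg (fun z : Mat N n => z (i, j)) h
      simpa [toMat_apply] using hij
    exact ContinuousLinearMap.coe_injective this
  · intro z
    let b := (EuclideanSpace.basisFun (Fin n) ℝ).toBasis
    refine ⟨LinearMap.toContinuousLinearMap
      (b.constr ℝ fun j => WithLp.toLp 2 fun i => z (i, j)), ?_⟩
    ext ⟨i, j⟩
    have := b.constr_basis ℝ (fun j => (WithLp.toLp 2 fun i => z (i, j) : Vec N)) j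
    simp only [b, OrthonormalBasis.coe_toBasis, EuclideanSpace.basisFun_apply] at this
    exact congrArg (fun v : Vec N => v i) this

/-- The identification of linear maps with matrices. -/
def matEquiv (N n : ℕ) : (Vec n →L[ℝ] Vec N) ≃L[ℝ] Mat N n :=
  (LinearEquiv.ofBijective (toMatₗ N n) (toMatₗ_bijective N n)).toContinuousLinearEquiv

lemma grad_eq_matEquiv {N n : ℕ} (φ : Vec n → Vec N) (x : Vec n) :
    grad φ x = matEquiv N n (fderiv ℝ φ x) := rfl

lemma matEquiv_symm_grad {N n : ℕ} (φ : Vec n → Vec N) (x : Vec n) :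
    (matEquiv N n).symm (grad φ x) = fderiv ℝ φ x := by
  rw [grad_eq_matEquiv, ContinuousLinearEquiv.symm_apply_apply]

lemma continuous_grad {N n : ℕ} {φ : Vec n → Vec N} (h : ContDiff ℝ 1 φ) : Continuous (grad φ) :=
  (matEquiv N n).continuous.comp (h.continuous_fderiv (by norm_num))

/-- The matrix product `ξ A`. -/
def mulRight {N n : ℕ} (ξ : Mat N n) (A : Vec n →L[ℝ] Vec n) : Mat N n :=
  matEquiv N n (((matEquiv N n).symm ξ).comp A)

lemma exists_mulRight_bound (N n : ℕ) : ∃ C : ℝ, 0 < C ∧ ∀ (ξ : Mat N n) (A : Vec n →L[ℝ] Vec n),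
    ‖mulRight ξ A - ξ‖ ≤ C * ‖A - ContinuousLinearMap.id ℝ _‖ * ‖ξ‖ := by
  refine ⟨‖(matEquiv N n : (Vec n →L[ℝ] Vec N) →L[ℝ] Mat N n)‖ *
    ‖((matEquiv N n).symm : Mat N n →L[ℝ] (Vec n →L[ℝ] Vec N))‖ + 1, by positivity, fun ξ A => ?_⟩
  have h : mulRight ξ A - ξ =
      matEquiv N n (((matEquiv N n).symm ξ).comp (A - ContinuousLinearMap.id ℝ _)) := by
    rw [mulRight, ContinuousLinearMap.comp_sub, map_sub, ContinuousLinearMap.comp_id,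
      ContinuousLinearEquiv.apply_symm_apply]
  rw [h]
  calc _ ≤ ‖(matEquiv N n : (Vec n →L[ℝ] Vec N) →L[ℝ] Mat N n)‖ *
        (‖((matEquiv N n).symm : Mat N n →L[ℝ] (Vec n →L[ℝ] Vec N))‖ * ‖ξ‖ *
          ‖A - ContinuousLinearMap.id ℝ _‖) := by
        refine (ContinuousLinearMap.le_opNorm
          (matEquiv N n : (Vec n →L[ℝ] Vec N) →L[ℝ] Mat N n) _).trans ?_
        gcongr
        refine (ContinuousLinearMap.opNorm_comp_le _ _).trans ?_
        gcongr
        exact ContinuousLinearMap.le_opNorm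
          ((matEquiv N n).symm : Mat N n →L[ℝ] (Vec n →L[ℝ] Vec N)) ξ
    _ ≤ _ := by
        have : 0 ≤ ‖A - ContinuousLinearMap.id ℝ _‖ * ‖ξ‖ := by positivity
        nlinarith

/-! ### Integrals of continuous functions of bounded fields -/

section Bounded

variable {α E : Type*} [MeasurableSpace α] {μ : Measure α} [IsFiniteMeasure μ]
  [NormedAddCommGroup E] [ProperSpace E]

lemma integrable_continuous_comp {f : α → E} (hf : AEStronglyMeasurable f μ) {M : ℝ}
    (hM : ∀ᵐ x ∂μ, ‖f x‖ ≤ M) {H : E → ℝ} (hH : Continuous H) :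
    Integrable (fun x => H (f x)) μ := by
  obtain ⟨C, hC⟩ := (isCompact_closedBall (0 : E) M).exists_bound_of_continuousOn hH.continuousOn
  refine Integrable.of_bound (hH.comp_aestronglyMeasurable hf) C ?_
  filter_upwards [hM] with x hx
  exact hC _ (mem_closedBall_zero_iff.2 hx)

lemma tendsto_integral_continuous_comp {ι : Type*} {l : Filter ι} [l.IsCountablyGenerated]
    {f : ι → α → E} {g : α → E} (hf : ∀ᶠ k in l, AEStronglyMeasurable (f k) μ) {M : ℝ}
    (hM : ∀ᶠ k in l, ∀ᵐ x ∂μ, ‖f k x‖ ≤ M) (hg : ∀ᵐ x ∂μ, Tendsto (fun k => f k x) l (𝓝 (g x)))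
    {H : E → ℝ} (hH : Continuous H) :
    Tendsto (fun k => ∫ x, H (f k x) ∂μ) l (𝓝 (∫ x, H (g x) ∂μ)) := by
  obtain ⟨C, hC⟩ := (isCompact_closedBall (0 : E) M).exists_bound_of_continuousOn hH.continuousOn
  refine tendsto_integral_filter_of_dominated_convergence (fun _ => C) ?_ ?_
    (integrable_const C) ?_
  · filter_upwards [hf] with k hk using hH.comp_aestronglyMeasurable hk
  · filter_upwards [hM] with k hk
    filter_upwards [hk] with x hx
    exact hC _ (mem_closedBall_zero_iff.2 hx)
  · filter_upwards [hg] with x hx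
    exact (hH.tendsto _).comp hx

lemma hasDerivAt_integral_bounded {H H' : ℝ → E → ℝ} (hd : ∀ t ξ, HasDerivAt (H · ξ) (H' t ξ) t)
    (hH : ∀ t, Continuous (H t)) (hH' : Continuous fun q : ℝ × E => H' q.1 q.2)
    {D : α → E} (hD : AEStronglyMeasurable D μ) {M : ℝ} (hM : ∀ᵐ x ∂μ, ‖D x‖ ≤ M) (t₀ : ℝ) :
    HasDerivAt (fun t => ∫ x, H t (D x) ∂μ) (∫ x, H' t₀ (D x) ∂μ) t₀ := by
  obtain ⟨C, hC⟩ := ((isCompact_Icc (a := t₀ - 1) (b := t₀ + 1)).prod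
    (isCompact_closedBall (0 : E) M)).exists_bound_of_continuousOn hH'.continuousOn
  have hs : Icc (t₀ - 1) (t₀ + 1) ∈ 𝓝 t₀ := Icc_mem_nhds (by linarith) (by linarith)
  refine (hasDerivAt_integral_of_dominated_loc_of_deriv_le (bound := fun _ => C)
    (F' := fun t x => H' t (D x)) hs
    (Eventually.of_forall fun t => (hH t).comp_aestronglyMeasurable hD)
    (integrable_continuous_comp hD hM (hH t₀)) ?_ ?_ (integrable_const C) ?_).2
  · exact (hH'.comp (by fun_prop : Continuous fun ξ : E => (t₀, ξ))).comp_aestronglyMeasurable hD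
  · filter_upwards [hM] with x hx t ht
    exact hC (t, D x) ⟨ht, mem_closedBall_zero_iff.2 hx⟩
  · exact Eventually.of_forall fun x t _ => hd t (D x)

/-- The function t ↦ ∫ (F(z + tD) - F(z)) is nonnegative, vanishes at t = 0 and is twice
differentiable, as D is bounded. -/
lemma first_and_second_variation [NormedSpace ℝ E] {F : E → ℝ} (hF : ContDiff ℝ 2 F) (z : E)
    {D : α → E} (hD : AEStronglyMeasurable D μ) {M : ℝ} (hM : ∀ᵐ x ∂μ, ‖D x‖ ≤ M)
    (h : ∀ t : ℝ, 0 ≤ ∫ x, (F (z + t • D x) - F z) ∂μ) :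
    ∫ x, fderiv ℝ F z (D x) ∂μ = 0 ∧ 0 ≤ ∫ x, fderiv ℝ (fderiv ℝ F) z (D x) (D x) ∂μ := by
  have hdF : Differentiable ℝ F := hF.differentiable (by norm_num)
  have hF1 : ContDiff ℝ 1 (fderiv ℝ F) := hF.fderiv_right (m := 1) (by norm_num)
  have hdF' : Differentiable ℝ (fderiv ℝ F) := hF1.differentiable (by norm_num)
  have hc1 : Continuous (fderiv ℝ F) := hF1.continuous
  have hc2 : Continuous (fderiv ℝ (fderiv ℝ F)) := hF1.continuous_fderiv (by norm_num)
  have hline : ∀ (t : ℝ) (ξ : E), HasDerivAt (fun t : ℝ => z + t • ξ) ξ t := fun t ξ => by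
    simpa using ((hasDerivAt_id t).smul_const ξ).const_add z
  have d1 : ∀ t₀, HasDerivAt (fun t : ℝ => ∫ x, (F (z + t • D x) - F z) ∂μ)
      (∫ x, fderiv ℝ F (z + t₀ • D x) (D x) ∂μ) t₀ := by
    refine hasDerivAt_integral_bounded (H := fun t ξ => F (z + t • ξ) - F z)
      (H' := fun t ξ => fderiv ℝ F (z + t • ξ) ξ) (fun t ξ => ?_) (fun t => ?_) ?_ hD hM
    · exact ((hdF _).hasFDerivAt.comp_hasDerivAt t (hline t ξ)).sub_const _
    · have := hF.continuous
      fun_prop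
    · exact (hc1.comp (by fun_prop)).clm_apply continuous_snd
  have d2 : ∀ t₀, HasDerivAt (fun t : ℝ => ∫ x, fderiv ℝ F (z + t • D x) (D x) ∂μ)
      (∫ x, fderiv ℝ (fderiv ℝ F) (z + t₀ • D x) (D x) (D x) ∂μ) t₀ := by
    refine hasDerivAt_integral_bounded (H := fun t ξ => fderiv ℝ F (z + t • ξ) ξ)
      (H' := fun t ξ => fderiv ℝ (fderiv ℝ F) (z + t • ξ) ξ ξ) (fun t ξ => ?_) (fun t => ?_) ?_ hD hM
    · have e := (hdF' _).hasFDerivAt.comp_hasDerivAt t (hline t ξ)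
      simpa using e.clm_apply (hasDerivAt_const t ξ)
    · exact (hc1.comp (by fun_prop)).clm_apply continuous_id
    · exact ((hc2.comp (by fun_prop)).clm_apply continuous_snd).clm_apply continuous_snd
  set m : ℝ → ℝ := fun t => ∫ x, (F (z + t • D x) - F z) ∂μ with hm
  have hm0 : m 0 = 0 := by simp [hm]
  have hmin : IsLocalMin m 0 := Eventually.of_forall fun t => by rw [hm0]; exact h t
  have e1 : ∫ x, fderiv ℝ F z (D x) ∂μ = 0 := by
    have := hmin.hasDerivAt_eq_zero (d1 0)
    simpa using this
  refine ⟨e1, ?_⟩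
  have hderiv : deriv m = fun t : ℝ => ∫ x, fderiv ℝ F (z + t • D x) (D x) ∂μ :=
    funext fun t => (d1 t).deriv
  have hdd : deriv (deriv m) 0 = ∫ x, fderiv ℝ (fderiv ℝ F) z (D x) (D x) ∂μ := by
    rw [hderiv, (d2 0).deriv]; simp
  -- A negative second derivative would make the minimum at 0 also a local maximum. The function
  -- would then vanish near 0, together with its second derivative.
  by_contra hneg
  push Not at hneg
  rw [← hdd] at hneg
  have hmax := isLocalMax_of_deriv_deriv_neg hneg (by rw [hderiv]; simpa using e1)
    (d1 0).continuousAt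
  have hzero : m =ᶠ[𝓝 0] fun _ => 0 := by
    filter_upwards [hmax] with t ht
    rw [hm0] at ht
    exact le_antisymm ht (h t)
  have : deriv (deriv m) 0 = 0 := by
    have e : deriv m =ᶠ[𝓝 0] fun _ => 0 := by
      simpa using hzero.deriv
    rw [e.deriv_eq]; simp
  linarith

end Bounded

/-! ### Weak gradients of differentiable functions -/

lemma integral_fderiv_eq_zero {n : ℕ} {f : Vec n → ℝ} {f' : Vec n → Vec n →L[ℝ] ℝ}
    (hf : ∀ x, HasFDerivAt f (f' x) x) (hfi : Integrable f) (v : Vec n)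
    (hfi' : Integrable fun x => f' x v) : ∫ x, f' x v = 0 := by
  -- Integration by parts against the constant function 1.
  have := integral_bilinear_hasFDerivAt_right_eq_neg_left_of_integrable (μ := volume)
    (B := ContinuousLinearMap.mul ℝ ℝ) (f := fun _ : Vec n => (1 : ℝ)) (f' := fun _ => 0)
    (g := f) (g' := f') (v := v) (by simp) (by simpa using hfi') (by simpa using hfi)
    (fun x _ => hasFDerivAt_const _ _) (fun x _ => hf x)
  simpa using this

lemma continuous_of_tsupport_subset {n : ℕ} {U : Set (Vec n)} (hU : IsOpen U) {f : Vec n → ℝ}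
    {K : Set (Vec n)} (hK : IsClosed K) (hKU : K ⊆ U) (h0 : ∀ x ∉ K, f x = 0)
    (hf : ContinuousOn f U) : Continuous f := by
  rw [continuous_iff_continuousAt]
  intro x
  by_cases hx : x ∈ K
  · exact hf.continuousAt (hU.mem_nhds (hKU hx))
  · have : f =ᶠ[𝓝 x] fun _ => 0 := by
      filter_upwards [hK.isOpen_compl.mem_nhds hx] with y hy using h0 y hy
    exact continuousAt_const.congr this.symm

/-- The product φᵢη extended by zero is differentiable on the whole space, so its directional
derivative integrates to zero. No regularity at ∂U is involved. -/
lemma weak_grad_of_differentiable {N n : ℕ} {U : Set (Vec n)} (hU : IsOpen U) {φ : Vec n → Vec N}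
    {Dφ : Vec n → Mat N n} (hd : ∀ x ∈ U, DifferentiableAt ℝ φ x) (hg : ∀ x ∈ U, grad φ x = Dφ x)
    (hc : ContinuousOn Dφ U) {η : Vec n → ℝ} (hη : IsTestFunction U η) (i : Fin N) (j : Fin n) :
    ∫ x in U, φ x i * fderiv ℝ η x (EuclideanSpace.single j 1) = -∫ x in U, Dφ x (i, j) * η x := by
  have hηd : Differentiable ℝ η := hη.contDiff.differentiable (by simp)
  have hφc : ContinuousOn φ U := fun x hx => (hd x hx).continuousAt.continuousWithinAt
  have hη0 : ∀ x ∉ tsupport η, η x = 0 := fun x hx => image_eq_zero_of_notMem_tsupport hx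
  have hη0' : ∀ x ∉ tsupport η, fderiv ℝ η x = 0 := fun x hx =>
    image_eq_zero_of_notMem_tsupport fun h => hx (tsupport_fderiv_subset ℝ h)
  have hcoord : ∀ x ∈ U, HasFDerivAt (fun y => φ y i)
      ((EuclideanSpace.proj i : Vec N →L[ℝ] ℝ).comp (fderiv ℝ φ x)) x := fun x hx =>
    (EuclideanSpace.proj i : Vec N →L[ℝ] ℝ).hasFDerivAt.comp x (hd x hx).hasFDerivAt
  have hφi : ContinuousOn (fun y => φ y i) U :=
    (EuclideanSpace.proj i : Vec N →L[ℝ] ℝ).continuous.comp_continuousOn hφc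
  have hDi : ContinuousOn (fun y => Dφ y (i, j)) U :=
    (EuclideanSpace.proj (i, j) : Mat N n →L[ℝ] ℝ).continuous.comp_continuousOn hc
  set e : Vec n := EuclideanSpace.single j 1 with he
  set a : Vec n → ℝ := fun x => φ x i * fderiv ℝ η x e with ha
  set b : Vec n → ℝ := fun x => Dφ x (i, j) * η x with hb
  have hηc' : Continuous fun x => fderiv ℝ η x e :=
    (hη.contDiff.continuous_fderiv (by simp)).clm_apply continuous_const
  have hKc : IsClosed (tsupport η) := isClosed_tsupport η
  have hcs : ∀ f : Vec n → ℝ, (∀ x ∉ tsupport η, f x = 0) → HasCompactSupport f := fun f hf =>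
    HasCompactSupport.intro hη.hasCompactSupport hf
  have ha0 : ∀ x ∉ tsupport η, a x = 0 := fun x hx => by simp [ha, hη0' x hx]
  have hb0 : ∀ x ∉ tsupport η, b x = 0 := fun x hx => by simp [hb, hη0 x hx]
  have hac : Continuous a := continuous_of_tsupport_subset hU hKc hη.tsupport_subset ha0
    (hφi.mul hηc'.continuousOn)
  have hbc : Continuous b := continuous_of_tsupport_subset hU hKc hη.tsupport_subset hb0
    (hDi.mul hηd.continuous.continuousOn)
  have hai := hac.integrable_of_hasCompactSupport (μ := volume) (hcs a ha0)
  have hbi := hbc.integrable_of_hasCompactSupport (μ := volume) (hcs b hb0)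
  have hf0 : ∀ x ∉ tsupport η, φ x i * η x = 0 := fun x hx => by simp [hη0 x hx]
  have hfc : Continuous fun x => φ x i * η x := continuous_of_tsupport_subset hU hKc
    hη.tsupport_subset hf0 (hφi.mul hηd.continuous.continuousOn)
  have hderiv : ∀ x, ∃ L : Vec n →L[ℝ] ℝ, HasFDerivAt (fun x => φ x i * η x) L x ∧
      L e = a x + b x := by
    intro x
    by_cases hx : x ∈ tsupport η
    · have hxU := hη.tsupport_subset hx
      refine ⟨_, (hcoord x hxU).mul (hηd x).hasFDerivAt, ?_⟩
      have : fderiv ℝ φ x e i = Dφ x (i, j) := by rw [← hg x hxU]; rfl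
      simp [ha, hb, this]
      ring
    · refine ⟨0, ?_, by simp [ha0 x hx, hb0 x hx]⟩
      have : (fun x => φ x i * η x) =ᶠ[𝓝 x] fun _ => 0 := by
        filter_upwards [hKc.isOpen_compl.mem_nhds hx] with y hy using hf0 y hy
      exact (hasFDerivAt_const (0 : ℝ) x).congr_of_eventuallyEq this
  choose L hL hLe using hderiv
  have hzero := integral_fderiv_eq_zero hL (hfc.integrable_of_hasCompactSupport (hcs _ hf0)) e
    (by simp only [hLe]; exact hai.add hbi)
  simp only [hLe] at hzero
  rw [integral_add hai hbi] at hzero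
  have hout : ∀ f : Vec n → ℝ, (∀ x ∉ tsupport η, f x = 0) → ∫ x in U, f x = ∫ x, f x :=
    fun f hf => setIntegral_eq_integral_of_forall_compl_eq_zero fun x hx =>
      hf x fun h => hx (hη.tsupport_subset h)
  rw [hout a ha0, hout b hb0]
  linarith

lemma IsTestFunction.isSobolevZeroInfty {N n : ℕ} {U : Set (Vec n)} (hU : IsOpen U)
    {φ : Vec n → Vec N} (hφ : IsTestFunction U φ) : IsSobolevZeroInfty U φ (grad φ) := by
  have h1 : ContDiff ℝ 1 φ := hφ.contDiff.of_le (by exact_mod_cast le_top)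
  have hgc := continuous_grad h1
  have hgs : HasCompactSupport (grad φ) := (hφ.hasCompactSupport.fderiv ℝ).comp_left
    (g := matEquiv N n) (map_zero _)
  refine ⟨⟨?_, ?_, ?_⟩, fun ε hε => ⟨φ, hφ, by simpa [sobolevDist] using hε⟩⟩
  · exact (h1.continuous.memLp_of_hasCompactSupport hφ.hasCompactSupport).restrict U
  · exact (hgc.memLp_of_hasCompactSupport hgs).restrict U
  · intro η hη i j
    exact weak_grad_of_differentiable hU (fun x _ => h1.differentiable (by norm_num) x)
      (fun _ _ => rfl) hgc.continuousOn hη i j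

/-! ### Growth of the gradient of a strongly quasiconvex integrand -/

lemma isOpen_unitCube (n : ℕ) : IsOpen (unitCube n) := by
  simp only [unitCube, ofPred_forall]
  refine isOpen_iInter_of_finite fun i => ?_
  exact isOpen_Ioo.preimage (EuclideanSpace.proj i : Vec n →L[ℝ] ℝ).continuous

lemma measure_unitCube_lt_top (n : ℕ) : volume (unitCube n) < ⊤ := by
  refine Bornology.IsBounded.measure_lt_top ?_
  rw [isBounded_iff_forall_norm_le]
  refine ⟨√n, fun x hx => ?_⟩
  rw [EuclideanSpace.norm_eq]
  refine Real.sqrt_le_sqrt ?_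
  calc ∑ i, ‖x i‖ ^ 2 ≤ ∑ _i : Fin n, (1 : ℝ) := by
        refine Finset.sum_le_sum fun i _ => ?_
        have := hx i
        rw [Real.norm_of_nonneg this.1.le]
        exact pow_le_one₀ this.1.le this.2.le
    _ = n := by simp

instance (n : ℕ) : IsFiniteMeasure (volume.restrict (unitCube n)) :=
  ⟨by simpa using measure_unitCube_lt_top n⟩

/-- The centre of the unit cube. -/
def cubeCenter (n : ℕ) : Vec n := WithLp.toLp 2 fun _ => 1 / 2

lemma ball_cubeCenter_subset (n : ℕ) : ball (cubeCenter n) (1 / 2) ⊆ unitCube n := by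
  intro x hx i
  have h1 : ‖(x - cubeCenter n) i‖ ≤ ‖x - cubeCenter n‖ := PiLp.norm_apply_le _ i
  rw [mem_ball, dist_eq_norm] at hx
  have h2 : |x i - 1 / 2| < 1 / 2 := lt_of_le_of_lt h1 hx
  rw [abs_lt] at h2
  exact ⟨by linarith [h2.1], by linarith [h2.2]⟩

lemma IsTestFunction.contDiff_one {n : ℕ} {E : Type*} [NormedAddCommGroup E] [NormedSpace ℝ E]
    {U : Set (Vec n)} {φ : Vec n → E} (h : IsTestFunction U φ) : ContDiff ℝ 1 φ :=
  h.contDiff.of_le (by exact_mod_cast le_top)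

lemma hasCompactSupport_grad {N n : ℕ} {φ : Vec n → Vec N} (h : HasCompactSupport φ) :
    HasCompactSupport (grad φ) :=
  (h.fderiv ℝ).comp_left (g := matEquiv N n) (map_zero _)

lemma exists_grad_bound {N n : ℕ} {φ : Vec n → Vec N} (h1 : ContDiff ℝ 1 φ)
    (h2 : HasCompactSupport φ) : ∃ M : ℝ, ∀ x, ‖grad φ x‖ ≤ M :=
  (hasCompactSupport_grad h2).exists_bound_of_continuous (continuous_grad h1)

lemma grad_const_smul {N n : ℕ} (t : ℝ) (φ : Vec n → Vec N) (x : Vec n) :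
    grad (t • φ) x = t • grad φ x := by
  rw [grad_eq_matEquiv, grad_eq_matEquiv, fderiv_const_smul_field, Pi.smul_apply, map_smul]

lemma IsTestFunction.const_smul {n : ℕ} {E : Type*} [NormedAddCommGroup E] [NormedSpace ℝ E]
    {U : Set (Vec n)} {φ : Vec n → E} (h : IsTestFunction U φ) (t : ℝ) :
    IsTestFunction U (t • φ) :=
  ⟨h.contDiff.const_smul t, h.hasCompactSupport.mono fun x hx => by
      simp only [Function.mem_support, Pi.smul_apply] at hx ⊢
      exact fun h0 => hx (by simp [h0]),
    (closure_mono fun x hx => by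
      simp only [Function.mem_support, Pi.smul_apply] at hx ⊢
      exact fun h0 => hx (by simp [h0])).trans h.tsupport_subset⟩

lemma IsStronglyQuasiconvex.variations {N n : ℕ} {p c₂ : ℝ} (hc₂ : 0 < c₂) {F : Mat N n → ℝ}
    (hF : ContDiff ℝ 2 F) (H2 : IsStronglyQuasiconvex p c₂ F) (z : Mat N n) {φ : Vec n → Vec N}
    (hφ : IsTestFunction (unitCube n) φ) :
    ∫ x in unitCube n, fderiv ℝ F z (grad φ x) = 0 ∧
      0 ≤ ∫ x in unitCube n, fderiv ℝ (fderiv ℝ F) z (grad φ x) (grad φ x) := by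
  obtain ⟨M, hM⟩ := exists_grad_bound hφ.contDiff_one hφ.hasCompactSupport
  refine first_and_second_variation hF z
    (continuous_grad hφ.contDiff_one).aestronglyMeasurable (Eventually.of_forall hM) fun t => ?_
  have := H2 z _ _ ((hφ.const_smul t).isSobolevZeroInfty (isOpen_unitCube n))
  simp only [grad_const_smul] at this
  refine le_trans (mul_nonneg hc₂.le (integral_nonneg fun x => by positivity)) this

-- Quasiconvexity implies rank-one convexity, needed here only in the directions of single matrix
-- entries. The second variation is tested with η cos(k xⱼ)eᵢ and η sin(k xⱼ)eᵢ; for large k the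
-- term of order k² has the sign of F'' in the direction (i, j).
set_option maxHeartbeats 400000 in
lemma second_deriv_single_nonneg {N n : ℕ} {p c₂ : ℝ} (hc₂ : 0 < c₂) {F : Mat N n → ℝ}
    (hF : ContDiff ℝ 2 F) (H2 : IsStronglyQuasiconvex p c₂ F) (z : Mat N n)
    (i : Fin N) (j : Fin n) :
    0 ≤ fderiv ℝ (fderiv ℝ F) z (EuclideanSpace.single (i, j) 1)
      (EuclideanSpace.single (i, j) 1) := by
  classical
  let e : Vec N := EuclideanSpace.single i 1
  let π : Vec n →L[ℝ] ℝ := EuclideanSpace.proj j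
  let T : (Vec n →L[ℝ] ℝ) →L[ℝ] Mat N n :=
    (matEquiv N n : (Vec n →L[ℝ] Vec N) →L[ℝ] Mat N n).comp
      (ContinuousLinearMap.smulRightL ℝ (Vec n) (Vec N) |>.flip e)
  have hT : ∀ L : Vec n →L[ℝ] ℝ, T L = toMat (L.smulRight e) := fun L => rfl
  have hTπ : T π = EuclideanSpace.single (i, j) 1 := by
    ext ⟨a, b⟩
    rw [hT, toMat_apply]
    change (EuclideanSpace.single b (1 : ℝ) : Vec n) j * (EuclideanSpace.single i (1 : ℝ) : Vec N) a
      = (EuclideanSpace.single (i, j) (1 : ℝ) : Mat N n) (a, b)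
    simp only [PiLp.single_apply, Prod.mk.injEq]
    by_cases h2 : j = b
    · by_cases h1 : a = i <;> simp [h1, h2]
    · simp [h2, Ne.symm h2]
  let B : (Vec n →L[ℝ] ℝ) → (Vec n →L[ℝ] ℝ) → ℝ := fun L L' =>
    fderiv ℝ (fderiv ℝ F) z (T L) (T L')
  let η : ContDiffBump (cubeCenter n) := ⟨1 / 8, 1 / 4, by norm_num, by norm_num⟩
  have hηs : ContDiff ℝ ∞ (η : Vec n → ℝ) := η.contDiff
  have hηd : Differentiable ℝ (η : Vec n → ℝ) := hηs.differentiable (by simp)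
  have hball : closedBall (cubeCenter n) (1 / 4) ⊆ unitCube n :=
    (closedBall_subset_ball (by norm_num)).trans (ball_cubeCenter_subset n)
  have htest : ∀ f : Vec n → ℝ, ContDiff ℝ ∞ f →
      IsTestFunction (unitCube n) (fun x => (η x * f x) • e) := by
    intro f hf
    have hsub : Function.support (fun x => (η x * f x) • e) ⊆ closedBall (cubeCenter n) (1 / 4) := by
      intro x hx
      by_contra hx'
      have : η x = 0 := η.zero_of_le_dist (by
        rw [mem_closedBall, not_le] at hx'; exact hx'.le)
      exact hx (by simp [this])
    have hsub' := closure_minimal hsub isClosed_closedBall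
    exact ⟨(hηs.mul hf).smul contDiff_const,
      HasCompactSupport.of_support_subset_isCompact (isCompact_closedBall _ _) hsub,
      hsub'.trans hball⟩
  have hgrad : ∀ (f : Vec n → ℝ) (L : Vec n → Vec n →L[ℝ] ℝ), (∀ x, HasFDerivAt f (L x) x) →
      ∀ x, grad (fun x => (η x * f x) • e) x = T (η x • L x + f x • fderiv ℝ η x) := by
    intro f L hL x
    have h1 := ((hηd x).hasFDerivAt.mul (hL x)).smul_const e
    rw [hT, grad]
    exact congrArg toMat h1.fderiv
  set I₁ := ∫ x in unitCube n, B (fderiv ℝ η x) (fderiv ℝ η x) with hI₁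
  set I₂ := ∫ x in unitCube n, η x ^ 2 with hI₂
  have hη'c : Continuous (fderiv ℝ (η : Vec n → ℝ)) := hηs.continuous_fderiv (by simp)
  have hηcs : HasCompactSupport (η : Vec n → ℝ) := η.hasCompactSupport
  have hInt₂ : Integrable (fun x => η x ^ 2) (volume.restrict (unitCube n)) :=
    ((by fun_prop : Continuous fun x => η x ^ 2).integrable_of_hasCompactSupport
      (hηcs.comp_left (g := fun s : ℝ => s ^ 2) (by simp))).restrict
  have hBc : Continuous fun x => B (fderiv ℝ η x) (fderiv ℝ η x) := by
    have hTc : Continuous fun x => T (fderiv ℝ η x) := T.continuous.comp hη'c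
    exact ((fderiv ℝ (fderiv ℝ F) z).continuous.comp hTc).clm_apply hTc
  have hInt₁ : Integrable (fun x => B (fderiv ℝ η x) (fderiv ℝ η x))
      (volume.restrict (unitCube n)) :=
    (hBc.integrable_of_hasCompactSupport
      ((hηcs.fderiv ℝ).comp_left (g := fun L => B L L) (by simp [B]))).restrict
  -- Adding the cosine and the sine variation cancels the mixed terms and removes the oscillation,
  -- because sin² + cos² = 1.
  have key : ∀ k : ℝ, 0 ≤ I₁ + k ^ 2 * B π π * I₂ := by
    intro k
    have hcosd : ∀ x : Vec n, HasFDerivAt (fun x : Vec n => Real.cos (k * π x))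
        (-Real.sin (k * π x) • k • π) x := fun x =>
      ((π.hasFDerivAt (x := x)).const_mul k).cos
    have hsind : ∀ x : Vec n, HasFDerivAt (fun x : Vec n => Real.sin (k * π x))
        (Real.cos (k * π x) • k • π) x := fun x =>
      ((π.hasFDerivAt (x := x)).const_mul k).sin
    have t1 := htest (fun x => Real.cos (k * π x)) (by fun_prop)
    have t2 := htest (fun x => Real.sin (k * π x)) (by fun_prop)
    have v1 := (H2.variations hc₂ hF z t1).2
    have v2 := (H2.variations hc₂ hF z t2).2
    have hi : ∀ {φ : Vec n → Vec N}, IsTestFunction (unitCube n) φ →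
        Integrable (fun x => fderiv ℝ (fderiv ℝ F) z (grad φ x) (grad φ x))
          (volume.restrict (unitCube n)) := by
      intro φ hφ
      obtain ⟨M, hM⟩ := exists_grad_bound hφ.contDiff_one hφ.hasCompactSupport
      exact integrable_continuous_comp (H := fun ξ => fderiv ℝ (fderiv ℝ F) z ξ ξ)
        (continuous_grad hφ.contDiff_one).aestronglyMeasurable (Eventually.of_forall hM)
        ((fderiv ℝ (fderiv ℝ F) z).continuous.clm_apply continuous_id)
    have hsum := add_nonneg v1 v2
    rw [← integral_add (hi t1) (hi t2)] at hsum
    have hpt : ∀ x, fderiv ℝ (fderiv ℝ F) z (grad (fun x => (η x * Real.cos (k * π x)) • e) x)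
          (grad (fun x => (η x * Real.cos (k * π x)) • e) x) +
        fderiv ℝ (fderiv ℝ F) z (grad (fun x => (η x * Real.sin (k * π x)) • e) x)
          (grad (fun x => (η x * Real.sin (k * π x)) • e) x) =
        B (fderiv ℝ η x) (fderiv ℝ η x) + k ^ 2 * B π π * η x ^ 2 := by
      intro x
      rw [hgrad _ _ hcosd, hgrad _ _ hsind]
      simp only [B, map_add, map_smul, add_apply, smul_apply, smul_eq_mul]
      have hcs := Real.sin_sq_add_cos_sq (k * π x)
      linear_combination (fderiv ℝ (fderiv ℝ F) z (T (fderiv ℝ η x)) (T (fderiv ℝ η x)) +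
        k ^ 2 * η x ^ 2 * fderiv ℝ (fderiv ℝ F) z (T π) (T π)) * hcs
    simp only [hpt] at hsum
    rwa [integral_add hInt₁ (hInt₂.const_mul _), integral_const_mul] at hsum
  have hI₂pos : 0 < I₂ := by
    rw [hI₂, setIntegral_pos_iff_support_of_nonneg_ae
      (Eventually.of_forall fun x => by positivity) hInt₂]
    have : ball (cubeCenter n) (1 / 8) ⊆
        (Function.support fun x => η x ^ 2) ∩ unitCube n := by
      intro x hx
      refine ⟨?_, ball_cubeCenter_subset n (ball_subset_ball (by norm_num) hx)⟩
      have : η x = 1 := η.one_of_mem_closedBall (ball_subset_closedBall hx)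
      simp [this]
    exact lt_of_lt_of_le (measure_ball_pos _ _ (by norm_num)) (measure_mono this)
  rw [← hTπ]
  change 0 ≤ B π π
  by_contra hneg
  push Not at hneg
  -- This k makes the k² term equal to -(|I₁| + 1), which outweighs I₁.
  have h1 := key (√((|I₁| + 1) / (-(B π π) * I₂)))
  have hden : 0 < -(B π π) * I₂ := by nlinarith
  rw [Real.sq_sqrt (by positivity)] at h1
  have h2 : (|I₁| + 1) / (-(B π π) * I₂) * B π π * I₂ = -(|I₁| + 1) := by
    rw [mul_assoc, div_mul_eq_mul_div, div_eq_iff hden.ne']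
    ring
  have := le_abs_self I₁
  linarith

lemma le_of_second_deriv_nonneg {E : Type*} [NormedAddCommGroup E] [NormedSpace ℝ E] {F : E → ℝ}
    (hF : ContDiff ℝ 2 F) {v : E} (h : ∀ z, 0 ≤ fderiv ℝ (fderiv ℝ F) z v v) (z : E) {t : ℝ}
    (ht : 0 < t) : t * fderiv ℝ F z v ≤ F (z + t • v) - F z := by
  have hdF : Differentiable ℝ F := hF.differentiable (by norm_num)
  have hF1 : ContDiff ℝ 1 (fderiv ℝ F) := hF.fderiv_right (m := 1) (by norm_num)
  have hdF' : Differentiable ℝ (fderiv ℝ F) := hF1.differentiable (by norm_num)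
  have hline : ∀ t : ℝ, HasDerivAt (fun t : ℝ => z + t • v) v t := fun t => by
    simpa using ((hasDerivAt_id t).smul_const v).const_add z
  have d1 : ∀ t : ℝ, HasDerivAt (fun t : ℝ => F (z + t • v)) (fderiv ℝ F (z + t • v) v) t :=
    fun t => (hdF _).hasFDerivAt.comp_hasDerivAt t (hline t)
  have d2 : ∀ t : ℝ, HasDerivAt (fun t : ℝ => fderiv ℝ F (z + t • v) v)
      (fderiv ℝ (fderiv ℝ F) (z + t • v) v v) t := fun t => by
    have e := (hdF' _).hasFDerivAt.comp_hasDerivAt t (hline t)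
    simpa using e.clm_apply (hasDerivAt_const t v)
  have hderiv : deriv (fun t : ℝ => F (z + t • v)) = fun t => fderiv ℝ F (z + t • v) v :=
    funext fun t => (d1 t).deriv
  have hconv : ConvexOn ℝ univ (fun t : ℝ => F (z + t • v)) := by
    refine convexOn_univ_of_deriv2_nonneg (fun t => (d1 t).differentiableAt) ?_ fun t => ?_
    · rw [hderiv]; exact fun t => (d2 t).differentiableAt
    · rw [Function.iterate_succ, Function.iterate_one, Function.comp_apply, hderiv, (d2 t).deriv]
      exact h _
  have := hconv.le_slope_of_hasDerivAt (mem_univ 0) (mem_univ t) ht (d1 0)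
  rw [slope_def_field, le_div_iff₀ (by linarith)] at this
  simp only [zero_smul, add_zero, sub_zero] at this
  linarith

/-- Convexity along a matrix entry puts the tangent below the graph. A step of length 1 + |z| in the
directions ±e bounds the partial derivative by the size of F divided by 1 + |z|. Summing over the
entries bounds the full derivative. -/
lemma exists_hasGradGrowth {N n : ℕ} {p c₂ : ℝ} (hp : 1 < p) (hc₂ : 0 < c₂) {F : Mat N n → ℝ}
    (hF : ContDiff ℝ 2 F) (H1 : HasPGrowth p F) (H2 : IsStronglyQuasiconvex p c₂ F) :
    ∃ C, HasGradGrowth p F C := by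
  classical
  obtain ⟨c₁, hc₁, H1⟩ := H1
  -- With T = (1 + |z|)^p ≥ 1, the growth of F gives c₁(1 + 2^p T) at the far point and c₁(1 + T) at
  -- z.
  set K := c₁ * (3 + 2 ^ p) with hK
  have hentry : ∀ (z : Mat N n) (v : Mat N n), ‖v‖ = 1 →
      (∀ z, 0 ≤ fderiv ℝ (fderiv ℝ F) z v v) → fderiv ℝ F z v ≤ K * (1 + ‖z‖) ^ (p - 1) := by
    intro z v hv h
    have ht : 0 < 1 + ‖z‖ := by positivity
    have h1 := le_of_second_deriv_nonneg hF h z ht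
    have h2 := le_abs_self (F (z + (1 + ‖z‖) • v))
    have h3 := neg_abs_le (F z)
    have h4 := H1 (z + (1 + ‖z‖) • v)
    have h5 := H1 z
    have h6 : ‖z + (1 + ‖z‖) • v‖ ^ p ≤ 2 ^ p * (1 + ‖z‖) ^ p := by
      rw [← Real.mul_rpow (by norm_num) ht.le]
      refine Real.rpow_le_rpow (norm_nonneg _) ?_ (by linarith)
      refine (norm_add_le _ _).trans ?_
      rw [norm_smul, hv, Real.norm_of_nonneg ht.le]
      linarith
    have h7 : ‖z‖ ^ p ≤ (1 + ‖z‖) ^ p :=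
      Real.rpow_le_rpow (norm_nonneg _) (by linarith) (by linarith)
    have h8 : 1 ≤ (1 + ‖z‖) ^ p := Real.one_le_rpow (by linarith [norm_nonneg z]) (by linarith)
    have h9 : (1 + ‖z‖) ^ p = (1 + ‖z‖) * (1 + ‖z‖) ^ (p - 1) := by
      rw [mul_comm, ← Real.rpow_add_one ht.ne']; congr 1; ring
    have h10 : (1 + ‖z‖) * fderiv ℝ F z v ≤ K * (1 + ‖z‖) ^ p := by
      rw [hK]; nlinarith
    rw [h9] at h10
    have : (1 + ‖z‖) * fderiv ℝ F z v ≤ (1 + ‖z‖) * (K * (1 + ‖z‖) ^ (p - 1)) := by linarith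
    exact le_of_mul_le_mul_left this ht
  refine ⟨∑ _ij : Fin N × Fin n, K, fun z => ?_⟩
  have hKpos : 0 ≤ K := by positivity
  have habs : ∀ ij : Fin N × Fin n,
      |fderiv ℝ F z (EuclideanSpace.single ij 1)| ≤ K * (1 + ‖z‖) ^ (p - 1) := by
    rintro ⟨i, j⟩
    have hnn := fun z => second_deriv_single_nonneg hc₂ hF H2 z i j
    refine abs_le.2 ⟨?_, hentry z _ (by simp) hnn⟩
    have := hentry z (-EuclideanSpace.single (i, j) 1) (by simp) (fun z => by simpa using hnn z)
    rw [map_neg] at this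
    linarith
  refine ContinuousLinearMap.opNorm_le_bound _ (by positivity) fun ξ => ?_
  have hξ : ξ = ∑ ij, ξ ij • (EuclideanSpace.single ij 1 : Mat N n) := by
    have := (EuclideanSpace.basisFun (Fin N × Fin n) ℝ).sum_repr ξ
    simpa using this.symm
  conv_lhs => rw [hξ]
  rw [map_sum, Finset.sum_mul, Finset.sum_mul]
  refine (norm_sum_le _ _).trans (Finset.sum_le_sum fun ij _ => ?_)
  rw [map_smul, norm_smul, mul_comm]
  exact mul_le_mul (habs ij) (PiLp.norm_apply_le ξ ij) (norm_nonneg _) (by positivity)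

/-! ### Quasiconvexity for compactly supported `C¹` functions -/

lemma grad_eq_zero_of_notMem_tsupport {N n : ℕ} {φ : Vec n → Vec N} {x : Vec n}
    (hx : x ∉ tsupport φ) : grad φ x = 0 := by
  have : fderiv ℝ φ x = 0 :=
    image_eq_zero_of_notMem_tsupport fun h => hx (tsupport_fderiv_subset ℝ h)
  rw [grad_eq_matEquiv, this, map_zero]

lemma continuous_norm_V_sq {N n : ℕ} (p : ℝ) : Continuous fun ξ : Mat N n => ‖V p ξ‖ ^ 2 := by
  simp only [norm_V_sq]
  exact (continuous_vfun p).comp continuous_norm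

lemma V_zero {N n : ℕ} (p : ℝ) : V p (0 : Mat N n) = 0 := by simp [V, Vaux]

lemma continuous_excess_right {N n : ℕ} {F : Mat N n → ℝ} (hF : ContDiff ℝ 2 F) (z : Mat N n) :
    Continuous (excess F z) :=
  (continuous_excess hF).comp (by fun_prop : Continuous fun ξ : Mat N n => (z, ξ))

/-- `c ∫_S |V(D)|² ≤ ∫_S (F(z + D) - F(z) - DF(z) D)`. -/
def ExcessBound {N n : ℕ} (p c : ℝ) (F : Mat N n → ℝ) (z : Mat N n) (S : Set (Vec n))
    (D : Vec n → Mat N n) : Prop :=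
  c * ∫ x in S, ‖V p (D x)‖ ^ 2 ≤ ∫ x in S, excess F z (D x)

/-- Knowing the inequality for every multiple tD makes t = 0 a minimum, so ∫ F'(z)D = 0 and the
linear term may be inserted. On a half ball this is the natural boundary condition hidden in (H2').
-/
lemma excessBound_of_forall_smul {N n : ℕ} {p c : ℝ} (hc : 0 < c) {F : Mat N n → ℝ}
    (hF : ContDiff ℝ 2 F) (z : Mat N n) {S : Set (Vec n)} (hS : volume S < ⊤)
    {D : Vec n → Mat N n} (hD : Continuous D) {M : ℝ} (hM : ∀ x, ‖D x‖ ≤ M)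
    (h : ∀ t : ℝ, c * ∫ x in S, ‖V p (t • D x)‖ ^ 2 ≤ ∫ x in S, (F (z + t • D x) - F z)) :
    ExcessBound p c F z S D := by
  have : IsFiniteMeasure (volume.restrict S) := ⟨by simpa using hS⟩
  have hv := (first_and_second_variation (μ := volume.restrict S) hF z hD.aestronglyMeasurable
    (Eventually.of_forall hM) fun t => le_trans
      (mul_nonneg hc.le (integral_nonneg fun x => by positivity)) (h t)).1
  have hFc := hF.continuous
  have h1 := h 1
  simp only [one_smul] at h1
  unfold ExcessBound excess
  rw [integral_sub, hv, sub_zero]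
  · exact h1
  · exact integrable_continuous_comp (H := fun ξ => F (z + ξ) - F z) hD.aestronglyMeasurable
      (Eventually.of_forall hM) (by fun_prop)
  · exact integrable_continuous_comp (H := fun ξ => fderiv ℝ F z ξ) hD.aestronglyMeasurable
      (Eventually.of_forall hM) (fderiv ℝ F z).continuous

lemma ExcessBound.of_tendsto {N n : ℕ} {p c : ℝ} {F : Mat N n → ℝ}
    (hF : ContDiff ℝ 2 F) {z : Mat N n} {S : Set (Vec n)} (hS : MeasurableSet S)
    (hS' : volume S < ⊤) {ι : Type*} {l : Filter ι} [l.NeBot] [l.IsCountablyGenerated]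
    {D : ι → Vec n → Mat N n} {D₀ : Vec n → Mat N n}
    (hD : ∀ᶠ k in l, AEStronglyMeasurable (D k) (volume.restrict S))
    {M : ℝ} (hM : ∀ᶠ k in l, ∀ x ∈ S, ‖D k x‖ ≤ M)
    (hD₀ : ∀ x ∈ S, Tendsto (fun k => D k x) l (𝓝 (D₀ x)))
    (h : ∀ᶠ k in l, ExcessBound p c F z S (D k)) : ExcessBound p c F z S D₀ := by
  have : IsFiniteMeasure (volume.restrict S) := ⟨by simpa using hS'⟩
  have hM' : ∀ᶠ k in l, ∀ᵐ x ∂(volume.restrict S), ‖D k x‖ ≤ M := by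
    filter_upwards [hM] with k hk using (ae_restrict_iff' hS).2 (Eventually.of_forall hk)
  have hD₀' : ∀ᵐ x ∂(volume.restrict S), Tendsto (fun k => D k x) l (𝓝 (D₀ x)) :=
    (ae_restrict_iff' hS).2 (Eventually.of_forall hD₀)
  exact le_of_tendsto_of_tendsto
    ((tendsto_integral_continuous_comp hD hM' hD₀' (continuous_norm_V_sq p)).const_mul c)
    (tendsto_integral_continuous_comp hD hM' hD₀' (continuous_excess_right hF z)) h

/-- Both integrands vanish where D does, so enlarging the domain by such points costs nothing. -/
lemma ExcessBound.congr_set {N n : ℕ} {p c : ℝ} {F : Mat N n → ℝ} {z : Mat N n}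
    {S T : Set (Vec n)} {D : Vec n → Mat N n} (hST : S ⊆ T) (hT : MeasurableSet T)
    (h0 : ∀ x ∈ T \ S, D x = 0) : ExcessBound p c F z S D ↔ ExcessBound p c F z T D := by
  unfold ExcessBound
  rw [setIntegral_eq_of_subset_of_forall_sdiff_eq_zero hT hST fun x hx => by
      rw [h0 x hx, V_zero, norm_zero, zero_pow two_ne_zero],
    setIntegral_eq_of_subset_of_forall_sdiff_eq_zero hT hST fun x hx => by
      rw [h0 x hx, excess_zero]]

lemma exists_mollification {N n : ℕ} {U : Set (Vec n)} (hU : IsOpen U) {φ : Vec n → Vec N}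
    (hφ : ContDiff ℝ 1 φ) (hc : HasCompactSupport φ) (hs : tsupport φ ⊆ U) :
    ∃ φk : ℕ → Vec n → Vec N, (∀ k, IsTestFunction U (φk k)) ∧
      (∃ M : ℝ, ∀ k x, ‖grad (φk k) x‖ ≤ M) ∧
      ∀ x, Tendsto (fun k => grad (φk k) x) atTop (𝓝 (grad φ x)) := by
  have hcomp : IsCompact (tsupport φ) := hc
  obtain ⟨δ, hδ, hδU⟩ := hcomp.exists_cthickening_subset_open hU hs
  let ρ : ℕ → ContDiffBump (0 : Vec n) := fun k =>
    ⟨δ / (k + 1) / 2, δ / (k + 1), by positivity, half_lt_self (by positivity)⟩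
  have hρ : Tendsto (fun k => (ρ k).rOut) atTop (𝓝 0) := by
    have := tendsto_one_div_add_atTop_nhds_zero_nat.const_mul δ
    simpa [ρ, div_eq_mul_inv] using this
  have hρδ : ∀ k, (ρ k).rOut ≤ δ := fun k => div_le_self hδ.le (by linarith [Nat.cast_nonneg (α := ℝ) k])
  let φk : ℕ → Vec n → Vec N := fun k =>
    convolution ((ρ k).normed volume) φ (ContinuousLinearMap.lsmul ℝ ℝ) volume
  have hφ' : Continuous (fderiv ℝ φ) := hφ.continuous_fderiv (by norm_num)
  have hderiv : ∀ k x, fderiv ℝ (φk k) x =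
      convolution ((ρ k).normed volume) (fderiv ℝ φ) (ContinuousLinearMap.lsmul ℝ ℝ) volume x := by
    intro k x
    have := hc.hasFDerivAt_convolution_right (μ := volume) (ContinuousLinearMap.lsmul ℝ ℝ)
      (f := (ρ k).normed volume) (ρ k).continuous_normed.locallyIntegrable hφ x
    exact this.fderiv
  obtain ⟨M, hM⟩ := (hc.fderiv ℝ).exists_bound_of_continuous hφ'
  -- The mollified derivative differs from `fderiv ℝ φ` by at most 2M, and the latter is at most M;
  -- hence 3M.
  refine ⟨φk, fun k => ?_, ⟨‖(matEquiv N n : (Vec n →L[ℝ] Vec N) →L[ℝ] Mat N n)‖ * (3 * M),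
    fun k x => ?_⟩, fun x => ?_⟩
  · have hsub : Function.support (φk k) ⊆ cthickening δ (tsupport φ) := by
      refine (support_convolution_subset (μ := volume) (ContinuousLinearMap.lsmul ℝ ℝ)).trans ?_
      rw [(ρ k).support_normed_eq]
      rintro _ ⟨a, ha, b, hb, rfl⟩
      refine mem_cthickening_of_dist_le _ b _ _ (subset_tsupport _ hb) ?_
      rw [dist_eq_norm, add_sub_cancel_right]
      exact (mem_ball_zero_iff.1 ha).le.trans (hρδ k)
    refine ⟨?_, ?_, ?_⟩
    · exact (ρ k).hasCompactSupport_normed.contDiff_convolution_left _ (ρ k).contDiff_normed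
        hφ.continuous.locallyIntegrable
    · exact HasCompactSupport.of_support_subset_isCompact hcomp.cthickening hsub
    · exact (closure_minimal hsub isClosed_cthickening).trans hδU
  · rw [grad_eq_matEquiv]
    refine (ContinuousLinearMap.le_opNorm
      (matEquiv N n : (Vec n →L[ℝ] Vec N) →L[ℝ] Mat N n) _).trans ?_
    gcongr
    rw [hderiv]
    have := (ρ k).dist_normed_convolution_le (μ := volume) (x₀ := x) (ε := 2 * M)
      hφ'.aestronglyMeasurable fun y _ => by
        rw [dist_eq_norm]
        exact (norm_sub_le _ _).trans (by linarith [hM x, hM y])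
    rw [dist_eq_norm] at this
    have h2 := norm_le_norm_add_norm_sub' (convolution ((ρ k).normed volume) (fderiv ℝ φ)
      (ContinuousLinearMap.lsmul ℝ ℝ) volume x) (fderiv ℝ φ x)
    linarith [hM x]
  · simp only [grad_eq_matEquiv]
    refine ((matEquiv N n).continuous.tendsto _).comp ?_
    simp only [hderiv]
    exact ContDiffBump.convolution_tendsto_right_of_continuous hρ hφ' x

lemma excessBound_of_smooth {N n : ℕ} {p c : ℝ} {F : Mat N n → ℝ} (hF : ContDiff ℝ 2 F)
    {z : Mat N n} {S U : Set (Vec n)} (hS : MeasurableSet S) (hS' : volume S < ⊤) (hU : IsOpen U)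
    (h : ∀ φ : Vec n → Vec N, IsTestFunction U φ → ExcessBound p c F z S (grad φ))
    {φ : Vec n → Vec N} (hφ : ContDiff ℝ 1 φ) (hc : HasCompactSupport φ) (hs : tsupport φ ⊆ U) :
    ExcessBound p c F z S (grad φ) := by
  obtain ⟨φk, h1, ⟨M, hM⟩, h2⟩ := exists_mollification hU hφ hc hs
  exact ExcessBound.of_tendsto hF hS hS' (l := atTop) (D := fun k => grad (φk k))
    (Eventually.of_forall fun k => (continuous_grad (h1 k).contDiff_one).aestronglyMeasurable)
    (Eventually.of_forall fun k x _ => hM k x) (fun x _ => h2 x)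
    (Eventually.of_forall fun k => h _ (h1 k))

lemma setIntegral_comp_homothety {n : ℕ} (a b : Vec n) {σ : ℝ} (hσ : 0 < σ) {S T : Set (Vec n)}
    (hS : MeasurableSet S) (hT : MeasurableSet T) (h : ∀ y, a + σ • (y - b) ∈ T ↔ y ∈ S)
    (f : Vec n → ℝ) :
    ∫ y in S, f (a + σ • (y - b)) = (σ ^ n)⁻¹ * ∫ x in T, f x := by
  rw [← integral_indicator hS, ← integral_indicator hT]
  have h1 : (S.indicator fun y => f (a + σ • (y - b))) =
      fun y => T.indicator f (a + σ • (y - b)) := by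
    ext y
    by_cases hy : y ∈ S
    · rw [indicator_of_mem hy, indicator_of_mem ((h y).2 hy)]
    · rw [indicator_of_notMem hy, indicator_of_notMem (mt (h y).1 hy)]
  rw [h1, integral_sub_right_eq_self (fun y => T.indicator f (a + σ • y)) b,
    Measure.integral_comp_smul volume (fun y => T.indicator f (a + y)) σ,
    integral_add_left_eq_self (T.indicator f) a]
  rw [abs_of_pos (by positivity), finrank_euclideanSpace_fin, smul_eq_mul]

/-- A homothety multiplies both integrals by the same power of σ, so the constant survives. -/
lemma ExcessBound.of_homothety {N n : ℕ} {p c : ℝ} {F : Mat N n → ℝ} {z : Mat N n} (a b : Vec n)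
    {σ : ℝ} (hσ : 0 < σ) {S T : Set (Vec n)} (hS : MeasurableSet S) (hT : MeasurableSet T)
    (h : ∀ y, a + σ • (y - b) ∈ T ↔ y ∈ S) {D : Vec n → Mat N n}
    (hD : ExcessBound p c F z S fun y => D (a + σ • (y - b))) : ExcessBound p c F z T D := by
  unfold ExcessBound at hD ⊢
  rw [setIntegral_comp_homothety a b hσ hS hT h fun x => ‖V p (D x)‖ ^ 2,
    setIntegral_comp_homothety a b hσ hS hT h fun x => excess F z (D x)] at hD
  have hpos : 0 < (σ ^ n)⁻¹ := by positivity
  rw [mul_left_comm] at hD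
  exact le_of_mul_le_mul_left hD hpos

lemma homothety_props {N n : ℕ} (a b : Vec n) {σ : ℝ} (hσ : 0 < σ) {φ : Vec n → Vec N}
    (hφ : ContDiff ℝ 1 φ) (hc : HasCompactSupport φ) {s : ℝ} (hs : tsupport φ ⊆ ball a (σ * s)) :
    ContDiff ℝ 1 (fun y => σ⁻¹ • φ (a + σ • (y - b))) ∧
    HasCompactSupport (fun y => σ⁻¹ • φ (a + σ • (y - b))) ∧
    tsupport (fun y => σ⁻¹ • φ (a + σ • (y - b))) ⊆ ball b s ∧
    ∀ y, grad (fun y => σ⁻¹ • φ (a + σ • (y - b))) y = grad φ (a + σ • (y - b)) := by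
  have hcomp : IsCompact (tsupport φ) := hc
  have hcont : Continuous fun x : Vec n => b + σ⁻¹ • (x - a) := by fun_prop
  have himg : IsCompact ((fun x : Vec n => b + σ⁻¹ • (x - a)) '' tsupport φ) := hcomp.image hcont
  have hsub : Function.support (fun y => σ⁻¹ • φ (a + σ • (y - b))) ⊆
      (fun x : Vec n => b + σ⁻¹ • (x - a)) '' tsupport φ := by
    intro y hy
    refine ⟨a + σ • (y - b), subset_tsupport _ fun h0 => hy (by simp [h0]), ?_⟩
    simp [smul_smul, inv_mul_cancel₀ hσ.ne']
  refine ⟨?_, HasCompactSupport.of_support_subset_isCompact himg hsub, ?_, fun y => ?_⟩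
  · exact (hφ.comp (by fun_prop)).const_smul _
  · refine (closure_minimal hsub himg.isClosed).trans ?_
    rintro _ ⟨x, hx, rfl⟩
    have hx' := hs hx
    rw [mem_ball, dist_eq_norm] at hx' ⊢
    simp only [add_sub_cancel_left, norm_smul, norm_inv, Real.norm_of_nonneg hσ.le]
    rw [inv_mul_lt_iff₀ hσ]
    exact hx'
  · have h1 : HasFDerivAt (fun y : Vec n => a + σ • (y - b))
        (σ • ContinuousLinearMap.id ℝ (Vec n)) y :=
      (((hasFDerivAt_id y).sub_const b).const_smul σ).const_add a
    have h2 := ((hφ.differentiable (by norm_num) _).hasFDerivAt.comp y h1).const_smul σ⁻¹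
    rw [grad_eq_matEquiv, grad_eq_matEquiv]
    congr 1
    refine h2.fderiv.trans ?_
    ext v
    simp [smul_smul, inv_mul_cancel₀ hσ.ne']

/-- The rescaling σ⁻¹φ(a + σ(y - b)) leaves gradients unchanged, which carries the bound from the
cube to any ball; mollification lowers the required smoothness to C¹. -/
lemma IsStronglyQuasiconvex.excessBound {N n : ℕ} {p c₂ : ℝ} (hc₂ : 0 < c₂) {F : Mat N n → ℝ}
    (hF : ContDiff ℝ 2 F) (H2 : IsStronglyQuasiconvex p c₂ F) (z : Mat N n) (x₁ : Vec n) {s : ℝ}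
    (hs : 0 < s) {φ : Vec n → Vec N} (hφ : ContDiff ℝ 1 φ) (hc : HasCompactSupport φ)
    (hsupp : tsupport φ ⊆ ball x₁ s) : ExcessBound p c₂ F z (ball x₁ s) (grad φ) := by
  have hcube : ∀ φ : Vec n → Vec N, IsTestFunction (unitCube n) φ →
      ExcessBound p c₂ F z (unitCube n) (grad φ) := by
    intro φ hφ
    obtain ⟨M, hM⟩ := exists_grad_bound hφ.contDiff_one hφ.hasCompactSupport
    refine excessBound_of_forall_smul hc₂ hF z (measure_unitCube_lt_top n)
      (continuous_grad hφ.contDiff_one) hM fun t => ?_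
    have := H2 z _ _ ((hφ.const_smul t).isSobolevZeroInfty (isOpen_unitCube n))
    simpa only [grad_const_smul] using this
  -- The factor 2s matches the ball of radius s with the ball of radius 1/2 inscribed in the cube.
  obtain ⟨h1, h2, h3, h4⟩ := homothety_props x₁ (cubeCenter n) (σ := 2 * s) (s := 1 / 2)
    (by positivity) hφ hc (by convert hsupp using 2; ring)
  have hQ := excessBound_of_smooth hF (isOpen_unitCube n).measurableSet
    (measure_unitCube_lt_top n) (isOpen_unitCube n) hcube h1 h2
    (h3.trans (ball_cubeCenter_subset n))
  rw [← ExcessBound.congr_set (ball_cubeCenter_subset n) (isOpen_unitCube n).measurableSet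
    (fun x hx => grad_eq_zero_of_notMem_tsupport fun h => hx.2 (h3 h)), funext h4] at hQ
  refine ExcessBound.of_homothety x₁ (cubeCenter n) (by positivity) measurableSet_ball
    measurableSet_ball (fun y => ?_) hQ
  rw [mem_ball, mem_ball, dist_eq_norm, dist_eq_norm, add_sub_cancel_left, norm_smul,
    Real.norm_of_nonneg (by positivity)]
  constructor <;> intro h <;> nlinarith

lemma measurableSet_halfBall {n : ℕ} (x₀ ν : Vec n) (s : ℝ) :
    MeasurableSet {y ∈ ball x₀ s | inner ℝ (y - x₀) ν < 0} := by
  have h : IsOpen {y : Vec n | inner ℝ (y - x₀) ν < 0} := isOpen_lt (by fun_prop) continuous_const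
  exact measurableSet_ball.inter h.measurableSet

/-- A test function supported in the open ball vanishes on the sphere but is unrestricted on the
flat face, so it is admissible in (H2'). -/
lemma IsStronglyQuasiconvexAtFreeBoundary.excessBound {N n : ℕ} {p c₂ : ℝ} (hc₂ : 0 < c₂)
    {F : Mat N n → ℝ} (hF : ContDiff ℝ 2 F) {Ω ΓD : Set (Vec n)} {Du : Vec n → Mat N n}
    (H2' : IsStronglyQuasiconvexAtFreeBoundary p c₂ F Ω ΓD Du) {x₁ ν : Vec n}
    (hx₁ : x₁ ∈ freeBoundary Ω ΓD) (hν : IsOuterUnitNormal Ω x₁ ν) {s : ℝ}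
    (hs : 0 < s) {φ : Vec n → Vec N} (hφ : ContDiff ℝ 1 φ) (hc : HasCompactSupport φ)
    (hsupp : tsupport φ ⊆ ball x₁ s) :
    ExcessBound p c₂ F (Du x₁) {y ∈ ball x₁ s | inner ℝ (y - x₁) ν < 0} (grad φ) := by
  have hfin : volume (halfBall x₁ ν) < ⊤ :=
    lt_of_le_of_lt (measure_mono fun y hy => hy.1) (measure_ball_lt_top (x := x₁) (r := 1))
  have hhalf : ∀ φ : Vec n → Vec N, IsTestFunction (ball x₁ 1) φ →
      ExcessBound p c₂ F (Du x₁) (halfBall x₁ ν) (grad φ) := by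
    intro φ hφ
    obtain ⟨M, hM⟩ := exists_grad_bound hφ.contDiff_one hφ.hasCompactSupport
    refine excessBound_of_forall_smul hc₂ hF _ hfin (continuous_grad hφ.contDiff_one) hM fun t => ?_
    have := H2' x₁ hx₁ ν hν (t • φ) (hφ.const_smul t).contDiff.contDiffOn fun x hx => ?_
    · simpa only [grad_const_smul] using this
    · have : φ x = 0 := image_eq_zero_of_notMem_tsupport fun h => by
        have h1 := mem_ball.1 (hφ.tsupport_subset h)
        have h2 := mem_sphere.1 hx.1
        linarith
      simp [this]
  obtain ⟨h1, h2, h3, h4⟩ := homothety_props x₁ x₁ (σ := s) (s := 1) hs hφ hc (by simpa using hsupp)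
  have hQ := excessBound_of_smooth hF (measurableSet_halfBall x₁ ν 1) hfin isOpen_ball hhalf h1 h2 h3
  rw [funext h4] at hQ
  refine ExcessBound.of_homothety x₁ x₁ hs (measurableSet_halfBall x₁ ν 1)
    (measurableSet_halfBall x₁ ν s) (fun y => ?_) hQ
  change (_ ∈ ball _ _ ∧ _) ↔ (_ ∈ ball _ _ ∧ _)
  rw [mem_ball, mem_ball, dist_eq_norm, dist_eq_norm, add_sub_cancel_left, norm_smul,
    Real.norm_of_nonneg hs.le, real_inner_smul_left]
  refine and_congr ⟨fun h => by nlinarith, fun h => by nlinarith⟩ ⟨fun h => ?_, fun h => ?_⟩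
  · by_contra h'
    push Not at h'
    exact absurd h (not_lt.2 (mul_nonneg hs.le h'))
  · exact mul_neg_of_pos_of_neg hs h

/-! ### Flattening the boundary -/

lemma inner_gradient_eq {E : Type*} [NormedAddCommGroup E] [InnerProductSpace ℝ E]
    [CompleteSpace E] (g : E → ℝ) (x v : E) : inner ℝ (gradient g x) v = fderiv ℝ g x v := by
  rw [gradient, InnerProductSpace.toDual_symm_apply]

lemma IsC1Graph.fderiv_apply_self {n : ℕ} {Ω : Set (Vec n)} {x₀ : Vec n} {r : ℝ} {e : Vec n}
    {g : Vec n → ℝ} (h : IsC1Graph Ω x₀ r e g) (x : Vec n) : fderiv ℝ g x e = 0 := by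
  have h1 : HasDerivAt (fun t : ℝ => x + t • e) e 0 := by
    simpa using ((hasDerivAt_id (0 : ℝ)).smul_const e).const_add x
  have h2 : HasFDerivAt g (fderiv ℝ g x) (x + (0 : ℝ) • e) := by
    rw [zero_smul, add_zero]
    exact (h.contDiff.differentiable (by norm_num) x).hasFDerivAt
  have h3 := h2.comp_hasDerivAt 0 h1
  have h4 : g ∘ (fun t : ℝ => x + t • e) = fun _ => g x := funext fun t => h.invariant x t
  rw [h4] at h3
  exact h3.unique (hasDerivAt_const _ _)

lemma IsC1Graph.inner_eq {n : ℕ} {Ω : Set (Vec n)} (hΩ : IsOpen Ω) {x₀ : Vec n} {r : ℝ} {e : Vec n}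
    {g : Vec n → ℝ} (h : IsC1Graph Ω x₀ r e g) (hx₀ : x₀ ∈ frontier Ω) : inner ℝ e x₀ = g x₀ := by
  have hmem : x₀ ∈ ball x₀ r := mem_ball_self h.radius_pos
  rw [hΩ.frontier_eq] at hx₀
  refine le_antisymm ?_ (not_lt.1 fun hlt => hx₀.2 ((h.mem_iff x₀ hmem).2 hlt))
  by_contra hlt
  push Not at hlt
  have hop : ∀ᶠ x in 𝓝 x₀, g x < inner ℝ e x :=
    (h.contDiff.continuous.continuousAt).eventually_lt (by fun_prop) hlt
  obtain ⟨x, hx, hxΩ⟩ :=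
    (mem_closure_iff_nhds.1 hx₀.1 _ (hop.and (ball_mem_nhds x₀ h.radius_pos)))
  exact absurd ((h.mem_iff x hx.2).1 hxΩ) (not_lt.2 hx.1.le)

/-- The shear `x ↦ x + h(x) e`. -/
def shear {n : ℕ} (h : Vec n → ℝ) (e x : Vec n) : Vec n := x + h x • e

lemma shear_neg_shear {n : ℕ} {h : Vec n → ℝ} {e : Vec n} (hinv : ∀ x (t : ℝ), h (x + t • e) = h x)
    (x : Vec n) : shear (-h) e (shear h e x) = x := by
  simp [shear, hinv]

lemma shear_shear_neg {n : ℕ} {h : Vec n → ℝ} {e : Vec n} (hinv : ∀ x (t : ℝ), h (x + t • e) = h x)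
    (x : Vec n) : shear h e (shear (-h) e x) = x := by
  simp only [shear, Pi.neg_apply, hinv]
  simp

lemma hasFDerivAt_shear {n : ℕ} {h : Vec n → ℝ} (hh : ContDiff ℝ 1 h) (e x : Vec n) :
    HasFDerivAt (shear h e) (ContinuousLinearMap.id ℝ _ + (fderiv ℝ h x).smulRight e) x :=
  (hasFDerivAt_id x).add ((hh.differentiable (by norm_num) x).hasFDerivAt.smul_const e)

/-- The derivative of the shear is a transvection: h does not vary along e, so the determinant is 1.
-/
lemma setIntegral_shear_image {n : ℕ} {h : Vec n → ℝ} (hh : ContDiff ℝ 1 h) {e : Vec n}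
    (hinv : ∀ x (t : ℝ), h (x + t • e) = h x) (he : ∀ x, fderiv ℝ h x e = 0) {S : Set (Vec n)}
    (hS : MeasurableSet S) (f : Vec n → ℝ) :
    ∫ y in shear h e '' S, f y = ∫ x in S, f (shear h e x) := by
  rw [integral_image_eq_integral_abs_det_fderiv_smul volume hS
    (fun x _ => (hasFDerivAt_shear hh e x).hasFDerivWithinAt)
    ((Function.LeftInverse.injective (shear_neg_shear hinv)).injOn)]
  refine integral_congr_ae (Eventually.of_forall fun x => ?_)
  have : (ContinuousLinearMap.id ℝ (Vec n) + (fderiv ℝ h x).smulRight e).det = 1 := by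
    have h1 := LinearMap.transvection.det (fderiv ℝ h x : Vec n →ₗ[ℝ] ℝ) e
    rw [show (fderiv ℝ h x : Vec n →ₗ[ℝ] ℝ) e = 0 from he x, add_zero] at h1
    exact h1
  simp only [this, abs_one, one_smul]

/-- The shear by the tangent affine function minus g carries the graph to its tangent plane at x₁,
where the half-space bound `hcore` applies to φ composed with the inverse shear. Gradients change by
a relative error Cδ. The loss c(|p-2| + 2)Cδ comes from |V|² on the left and KCδ from the excess on
the right. -/
lemma excessBound_of_graph {N n : ℕ} {p c K C δ : ℝ} (hp : 1 < p) (hc : 0 < c) {F : Mat N n → ℝ}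
    (hF : ContDiff ℝ 2 F) {z : Mat N n} {Ω : Set (Vec n)} (hΩ : IsOpen Ω) {x₁ e : Vec n} {ρ s : ℝ}
    {g : Vec n → ℝ} (hG : IsC1Graph Ω x₁ ρ e g) (hx₁ : x₁ ∈ frontier Ω) (hδ1 : δ ≤ 1)
    (hδ : ∀ x ∈ ball x₁ ρ, ‖fderiv ℝ g x - fderiv ℝ g x₁‖ ≤ δ) (hs : 0 < s) (hsρ : 2 * s ≤ ρ)
    (hcore : ∀ φ : Vec n → Vec N, ContDiff ℝ 1 φ → HasCompactSupport φ →
      tsupport φ ⊆ ball x₁ (2 * s) → ExcessBound p c F z {y ∈ ball x₁ (2 * s) |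
        inner ℝ (y - x₁) (‖e - gradient g x₁‖⁻¹ • (e - gradient g x₁)) < 0} (grad φ))
    (hC0 : 0 < C) (hC : ∀ (ξ : Mat N n) (A : Vec n →L[ℝ] Vec n),
      ‖mulRight ξ A - ξ‖ ≤ C * ‖A - ContinuousLinearMap.id ℝ _‖ * ‖ξ‖) (hd : C * δ < 1)
    (hK : ∀ (d : ℝ) (ξ ξ' : Mat N n), 0 ≤ d → d ≤ 1 → ‖ξ' - ξ‖ ≤ d * ‖ξ‖ →
      |excess F z ξ' - excess F z ξ| ≤ K * d * vfun p ‖ξ‖)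
    {φ : Vec n → Vec N} (hφ : ContDiff ℝ 1 φ) (hφc : HasCompactSupport φ)
    (hφs : tsupport φ ⊆ ball x₁ s) :
    ExcessBound p (c - (c * (|p - 2| + 2) + K) * (C * δ)) F z (Ω ∩ ball x₁ s) (grad φ) := by
  have hδ0 : 0 ≤ δ := (norm_nonneg _).trans (hδ x₁ (mem_ball_self hG.radius_pos))
  have hg := hG.contDiff
  have hgd : Differentiable ℝ g := hg.differentiable (by norm_num)
  have hge := hG.fderiv_apply_self
  set h : Vec n → ℝ := fun x => g x₁ + fderiv ℝ g x₁ (x - x₁) - g x with hh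
  have hhc : ContDiff ℝ 1 h := by
    have : ContDiff ℝ 1 fun x => fderiv ℝ g x₁ (x - x₁) :=
      (fderiv ℝ g x₁).contDiff.comp (by fun_prop)
    exact (contDiff_const.add this).sub hg
  have hhd : ∀ x, fderiv ℝ h x = fderiv ℝ g x₁ - fderiv ℝ g x := by
    intro x
    have h1 : HasFDerivAt (fun x => fderiv ℝ g x₁ (x - x₁)) (fderiv ℝ g x₁) x :=
      (fderiv ℝ g x₁).hasFDerivAt.comp x ((hasFDerivAt_id x).sub_const x₁)
    exact ((h1.const_add (g x₁)).sub (hgd x).hasFDerivAt).fderiv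
  have hinv : ∀ x (t : ℝ), h (x + t • e) = h x := by
    intro x t
    simp only [hh, hG.invariant, add_sub_right_comm, map_add, map_smul, hge, smul_zero, add_zero]
  have hhe : ∀ x, fderiv ℝ h x e = 0 := fun x => by simp [hhd, hge]
  have hhc' : ContDiff ℝ 1 (-h) := hhc.neg
  have hinv' : ∀ x (t : ℝ), (-h) (x + t • e) = (-h) x := fun x t => by simp [hinv]
  -- Since δ ≤ 1 the shear moves points by at most their distance to x₁, which explains the radius
  -- 2s in `hcore`.
  have hhsmall : ∀ x ∈ ball x₁ s, |h x| ≤ ‖x - x₁‖ := by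
    intro x hx
    have hx' : x ∈ ball x₁ ρ := ball_subset_ball (by linarith) hx
    have := (convex_ball x₁ ρ).norm_image_sub_le_of_norm_fderiv_le' (𝕜 := ℝ) (f := g)
      (fun y _ => hgd y) hδ (mem_ball_self hG.radius_pos) hx'
    calc |h x| = ‖g x - g x₁ - fderiv ℝ g x₁ (x - x₁)‖ := by
          rw [Real.norm_eq_abs, ← abs_neg]; congr 1; simp only [hh]; ring
      _ ≤ δ * ‖x - x₁‖ := this
      _ ≤ _ := mul_le_of_le_one_left (norm_nonneg _) hδ1
  have hball : ∀ x ∈ ball x₁ s, shear h e x ∈ ball x₁ (2 * s) := by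
    intro x hx
    have h1 := hhsmall x hx
    rw [mem_ball, dist_eq_norm] at hx ⊢
    calc ‖shear h e x - x₁‖ = ‖(x - x₁) + h x • e‖ := by rw [shear]; congr 1; abel
      _ ≤ ‖x - x₁‖ + |h x| := by
          refine (norm_add_le _ _).trans ?_
          rw [norm_smul, hG.norm_eq_one, mul_one, Real.norm_eq_abs]
      _ < 2 * s := by linarith
  set w := e - gradient g x₁ with hw
  have hew : ∀ v : Vec n, inner ℝ v w = inner ℝ e v - fderiv ℝ g x₁ v := by
    intro v
    rw [hw, inner_sub_right, real_inner_comm, real_inner_comm (gradient g x₁) v,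
      inner_gradient_eq]
  have hee : inner ℝ e e = (1 : ℝ) := by rw [real_inner_self_eq_norm_sq, hG.norm_eq_one]; norm_num
  have hwpos : 0 < ‖w‖ := by
    rw [norm_pos_iff]
    intro h0
    have := hew e
    rw [h0, inner_zero_right, hge, hee] at this
    norm_num at this
  -- The height over the tangent plane after the shear equals the height over the graph before it.
  have hside : ∀ x, inner ℝ (shear h e x - x₁) (‖w‖⁻¹ • w) < 0 ↔ inner ℝ e x < g x := by
    intro x
    have h1 : inner ℝ (shear h e x - x₁) w = inner ℝ e x - g x := by
      rw [hew, show shear h e x - x₁ = (x - x₁) + h x • e by rw [shear]; abel, inner_add_right,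
        inner_sub_right, real_inner_smul_right, hee, hG.inner_eq hΩ hx₁, map_add, map_smul, hge]
      simp only [hh, smul_eq_mul]
      ring
    rw [real_inner_smul_right, h1]
    constructor
    · intro h2
      by_contra h3
      push Not at h3
      exact absurd h2 (not_lt.2 (mul_nonneg (by positivity) (by linarith)))
    · intro h2
      exact mul_neg_of_pos_of_neg (by positivity) (by linarith)
  set ψ : Vec n → Vec N := fun y => φ (shear (-h) e y) with hψ
  have hshc : ∀ {k : Vec n → ℝ}, ContDiff ℝ 1 k → ContDiff ℝ 1 (shear k e) := fun hk =>
    contDiff_id.add (hk.smul contDiff_const)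
  have hψ1 : ContDiff ℝ 1 ψ := hφ.comp (hshc hhc')
  have hKc : IsCompact (shear h e '' tsupport φ) :=
    (show IsCompact (tsupport φ) from hφc).image (hshc hhc).continuous
  have hψsub : Function.support ψ ⊆ shear h e '' tsupport φ := fun y hy =>
    ⟨shear (-h) e y, subset_tsupport _ hy, shear_shear_neg hinv y⟩
  have hψts : tsupport ψ ⊆ shear h e '' tsupport φ := closure_minimal hψsub hKc.isClosed
  have hψc : HasCompactSupport ψ := HasCompactSupport.of_support_subset_isCompact hKc hψsub
  have hψs : tsupport ψ ⊆ ball x₁ (2 * s) := by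
    refine hψts.trans ?_
    rintro _ ⟨x, hx, rfl⟩
    exact hball x (hφs hx)
  set S : Set (Vec n) := {y ∈ ball x₁ (2 * s) | inner ℝ (y - x₁) (‖w‖⁻¹ • w) < 0} with hS
  have hSm : MeasurableSet S := measurableSet_halfBall _ _ _
  have hΩm : MeasurableSet (Ω ∩ ball x₁ s) := (hΩ.inter isOpen_ball).measurableSet
  have hsub : shear h e '' (Ω ∩ ball x₁ s) ⊆ S := by
    rintro _ ⟨x, hx, rfl⟩
    refine ⟨hball x hx.2, (hside x).2 ?_⟩
    exact (hG.mem_iff x (ball_subset_ball (by linarith) hx.2)).1 hx.1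
  have hbound := hcore ψ hψ1 hψc hψs
  -- The sheared region need not fill the half ball, but ψ has zero gradient on the part it misses.
  rw [← ExcessBound.congr_set hsub hSm fun y hy => ?_] at hbound
  swap
  · refine grad_eq_zero_of_notMem_tsupport fun hyt => hy.2 ?_
    obtain ⟨x, hx, rfl⟩ := hψts hyt
    have hxb := hφs hx
    exact ⟨x, ⟨(hG.mem_iff x (ball_subset_ball (by linarith) hxb)).2 ((hside x).1 hy.1.2), hxb⟩, rfl⟩
  unfold ExcessBound at hbound ⊢
  rw [setIntegral_shear_image hhc hinv hhe hΩm fun y => ‖V p (grad ψ y)‖ ^ 2,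
    setIntegral_shear_image hhc hinv hhe hΩm fun y => excess F z (grad ψ y)] at hbound
  have hclose : ∀ x ∈ Ω ∩ ball x₁ s,
      ‖grad ψ (shear h e x) - grad φ x‖ ≤ C * δ * ‖grad φ x‖ := by
    intro x hx
    have h1 : grad ψ (shear h e x) = mulRight (grad φ x)
        (ContinuousLinearMap.id ℝ _ + (fderiv ℝ (-h) (shear h e x)).smulRight e) := by
      have h2 := hasFDerivAt_shear hhc' e (shear h e x)
      have h3 : HasFDerivAt φ (fderiv ℝ φ x) (shear (-h) e (shear h e x)) := by
        rw [shear_neg_shear hinv]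
        exact (hφ.differentiable (by norm_num) x).hasFDerivAt
      have h4 := (h3.comp (shear h e x) h2).fderiv
      rw [mulRight, matEquiv_symm_grad, grad_eq_matEquiv]
      exact congrArg _ h4
    rw [h1]
    refine (hC _ _).trans ?_
    gcongr
    rw [add_sub_cancel_left, ContinuousLinearMap.norm_smulRight_apply, hG.norm_eq_one, mul_one,
      fderiv_neg, norm_neg, hhd, norm_sub_rev]
    exact hδ _ (ball_subset_ball hsρ (hball x hx.2))
  have : IsFiniteMeasure (volume.restrict (Ω ∩ ball x₁ s)) :=
    isFiniteMeasure_restrict.2 (ne_top_of_le_ne_top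
      (measure_ball_lt_top (x := x₁) (r := s)).ne (measure_mono inter_subset_right))
  obtain ⟨M, hM⟩ := exists_grad_bound hφ hφc
  obtain ⟨M', hM'⟩ := exists_grad_bound hψ1 hψc
  have m1 : AEStronglyMeasurable (grad φ) (volume.restrict (Ω ∩ ball x₁ s)) :=
    (continuous_grad hφ).aestronglyMeasurable
  have m2 : AEStronglyMeasurable (fun x => grad ψ (shear h e x))
      (volume.restrict (Ω ∩ ball x₁ s)) :=
    ((continuous_grad hψ1).comp (hshc hhc).continuous).aestronglyMeasurable
  have i1 := integrable_continuous_comp m1 (Eventually.of_forall hM) (continuous_norm_V_sq p)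
  have i2 := integrable_continuous_comp m2 (Eventually.of_forall fun x => hM' _)
    (continuous_norm_V_sq p)
  have i3 := integrable_continuous_comp m1 (Eventually.of_forall hM) (continuous_excess_right hF z)
  have i4 := integrable_continuous_comp m2 (Eventually.of_forall fun x => hM' _)
    (continuous_excess_right hF z)
  have hCδ : 0 ≤ C * δ := by positivity
  have e1 : (1 - (|p - 2| + 2) * (C * δ)) * ∫ x in Ω ∩ ball x₁ s, ‖V p (grad φ x)‖ ^ 2 ≤
      ∫ x in Ω ∩ ball x₁ s, ‖V p (grad ψ (shear h e x))‖ ^ 2 := by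
    rw [← integral_const_mul]
    refine setIntegral_mono_on (i1.const_mul _) i2 hΩm fun x hx => ?_
    rw [norm_V_sq, norm_V_sq]
    refine vfun_lower_of_close hp hCδ hd (norm_nonneg _) ?_
    have h1 := hclose x hx
    have h2 := norm_sub_norm_le (grad φ x) (grad ψ (shear h e x))
    rw [norm_sub_rev] at h2
    linarith
  have e2 : ∫ x in Ω ∩ ball x₁ s, excess F z (grad ψ (shear h e x)) ≤
      (∫ x in Ω ∩ ball x₁ s, excess F z (grad φ x)) +
        K * (C * δ) * ∫ x in Ω ∩ ball x₁ s, ‖V p (grad φ x)‖ ^ 2 := by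
    rw [← integral_const_mul, ← integral_add i3 (i1.const_mul _)]
    refine setIntegral_mono_on i4 (i3.add (i1.const_mul _)) hΩm fun x hx => ?_
    have h1 := (abs_le.1 (hK (C * δ) (grad φ x) (grad ψ (shear h e x)) hCδ hd.le (hclose x hx))).2
    rw [norm_V_sq]
    linarith
  have e3 := mul_le_mul_of_nonneg_left e1 hc.le
  nlinarith [e3, e2, hbound]

/-! ### Functions that are `C¹` up to the boundary -/

lemma IsC1Closure.contDiffAt {N n : ℕ} {U : Set (Vec n)} (hU : IsOpen U) {φ : Vec n → Vec N}
    {Dφ : Vec n → Mat N n} (h : IsC1Closure U φ Dφ) {x : Vec n} (hx : x ∈ U) :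
    ContDiffAt ℝ 1 φ x := by
  have : ContDiffOn ℝ 1 φ U := by
    rw [show (1 : WithTop ℕ∞) = 0 + 1 by norm_num, contDiffOn_succ_iff_fderiv_of_isOpen hU]
    refine ⟨fun y hy => (h.differentiableAt y hy).differentiableWithinAt, by simp, ?_⟩
    rw [contDiffOn_zero]
    refine ContinuousOn.congr ((matEquiv N n).symm.continuous.comp_continuousOn
      (h.continuousOn_grad.mono subset_closure)) fun y hy => ?_
    rw [Function.comp_apply, ← h.grad_eq y hy, matEquiv_symm_grad]
  exact this.contDiffAt (hU.mem_nhds hx)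

/-- Translating η by te pushes its domain across the graph, so a cutoff outside Ω produces a C¹
function on the whole space whose gradient in Ω ∩ B is exactly the translated Dη. Letting t tend to
0 recovers Dη without any extension theorem. -/
lemma excessBound_of_shift {N n : ℕ} {p c : ℝ} {F : Mat N n → ℝ} (hF : ContDiff ℝ 2 F)
    {z : Mat N n} {Ω : Set (Vec n)} (hΩ : IsOpen Ω) {x₁ e : Vec n} {ρ s a M : ℝ}
    {g : Vec n → ℝ} (hG : IsC1Graph Ω x₁ ρ e g) (has : a < s) (hsρ : s < ρ)
    (hcore : ∀ φ : Vec n → Vec N, ContDiff ℝ 1 φ → HasCompactSupport φ →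
      tsupport φ ⊆ ball x₁ s → ExcessBound p c F z (Ω ∩ ball x₁ s) (grad φ))
    {η : Vec n → Vec N} {Dη : Vec n → Mat N n} (hη : IsC1Closure Ω η Dη)
    (hη0 : ∀ x ∉ closedBall x₁ a, η x = 0) (hM : ∀ x ∈ Ω, ‖Dη x‖ ≤ M) :
    ExcessBound p c F z (Ω ∩ ball x₁ s) Dη := by
  have hΩm : MeasurableSet (Ω ∩ ball x₁ s) := (hΩ.inter isOpen_ball).measurableSet
  have hgc := hG.contDiff.continuous
  let χ : ℝ → ℝ := fun r => Real.smoothTransition (2 - 3 * r)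
  have hχ : ContDiff ℝ 1 χ := Real.smoothTransition.contDiff.comp (by fun_prop)
  have hχ1 : ∀ r, r < 1 / 3 → χ r = 1 := fun r hr =>
    Real.smoothTransition.one_of_one_le (by linarith)
  have hχ0 : ∀ r, 2 / 3 < r → χ r = 0 := fun r hr =>
    Real.smoothTransition.zero_of_nonpos (by linarith)
  -- As g is invariant along e, the translated graph lies at height exactly t over the old one. The
  -- cutoff is 1 on Ω near x₁ and vanishes from height 2t/3 on, before the translated η ceases to be
  -- defined.
  let ζ : ℝ → Vec n → Vec N := fun t x => χ ((inner ℝ e x - g x) / t) • η (x - t • e)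
  have hζc : ∀ t : ℝ, 0 < t → ContDiff ℝ 1 (ζ t) := by
    intro t ht
    rw [contDiff_iff_contDiffAt]
    intro x
    by_cases hx1 : x - t • e ∈ closedBall x₁ a
    · by_cases hx2 : x - t • e ∈ Ω
      · have h1 : ContDiffAt ℝ 1 (fun x => η (x - t • e)) x :=
          (hη.contDiffAt hΩ hx2).comp x (by fun_prop)
        have h2 : ContDiff ℝ 1 fun x : Vec n => χ ((inner ℝ e x - g x) / t) :=
          hχ.comp (((contDiff_const.inner ℝ contDiff_id).sub hG.contDiff).div_const t)
        exact h2.contDiffAt.smul h1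
      · have h1 : (1 : ℝ) ≤ (inner ℝ e x - g x) / t := by
          have h3 := mt (hG.mem_iff _ (closedBall_subset_ball (has.trans hsρ) hx1)).2 hx2
          have h4 := hG.invariant x (-t)
          rw [neg_smul, ← sub_eq_add_neg] at h4
          rw [h4, inner_sub_right, real_inner_smul_right, real_inner_self_eq_norm_sq,
            hG.norm_eq_one] at h3
          rw [le_div_iff₀ ht]
          linarith
        have h2 : ∀ᶠ y in 𝓝 x, 2 / 3 < (inner ℝ e y - g y) / t :=
          continuousAt_const.eventually_lt (by fun_prop) (by linarith)
        have h3 : ζ t =ᶠ[𝓝 x] fun _ => 0 := by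
          filter_upwards [h2] with y hy
          simp only [ζ, hχ0 _ hy, zero_smul]
        exact contDiffAt_const.congr_of_eventuallyEq h3
    · have h1 : ∀ᶠ y in 𝓝 x, y - t • e ∉ closedBall x₁ a :=
        (by fun_prop : ContinuousAt (fun y : Vec n => y - t • e) x).eventually
          (isClosed_closedBall.isOpen_compl.mem_nhds hx1)
      have h3 : ζ t =ᶠ[𝓝 x] fun _ => 0 := by
        filter_upwards [h1] with y hy
        simp only [ζ, hη0 _ hy, smul_zero]
      exact contDiffAt_const.congr_of_eventuallyEq h3
  have hζsub : ∀ t : ℝ, 0 < t → Function.support (ζ t) ⊆ closedBall x₁ (a + t) := by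
    intro t ht x hx
    have h1 : x - t • e ∈ closedBall x₁ a := by
      by_contra h
      exact hx (by simp only [ζ, hη0 _ h, smul_zero])
    rw [mem_closedBall, dist_eq_norm] at h1 ⊢
    calc ‖x - x₁‖ = ‖(x - t • e - x₁) + t • e‖ := by congr 1; abel
      _ ≤ a + t := by
          refine (norm_add_le _ _).trans ?_
          rw [norm_smul, hG.norm_eq_one, mul_one, Real.norm_of_nonneg ht.le]
          linarith
  have hshift : ∀ t : ℝ, 0 < t → t < ρ - s → ∀ x ∈ Ω ∩ ball x₁ s, x - t • e ∈ Ω := by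
    intro t ht hts x hx
    have hxρ := (hG.mem_iff x (ball_subset_ball hsρ.le hx.2)).1 hx.1
    refine (hG.mem_iff _ ?_).2 ?_
    · have h1 := mem_ball.1 hx.2
      rw [dist_eq_norm] at h1
      rw [mem_ball, dist_eq_norm, show x - t • e - x₁ = (x - x₁) - t • e by abel]
      refine lt_of_le_of_lt (norm_sub_le _ _) ?_
      rw [norm_smul, hG.norm_eq_one, mul_one, Real.norm_of_nonneg ht.le]
      linarith
    · have h4 := hG.invariant x (-t)
      rw [neg_smul, ← sub_eq_add_neg] at h4
      rw [h4, inner_sub_right, real_inner_smul_right, real_inner_self_eq_norm_sq, hG.norm_eq_one]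
      linarith
  have hgrad : ∀ t : ℝ, 0 < t → t < ρ - s → ∀ x ∈ Ω ∩ ball x₁ s,
      grad (ζ t) x = Dη (x - t • e) := by
    intro t ht hts x hx
    have hxt := hshift t ht hts x hx
    have hxρ := (hG.mem_iff x (ball_subset_ball hsρ.le hx.2)).1 hx.1
    have h1 : ∀ᶠ y in 𝓝 x, inner ℝ e y < g y :=
      (by fun_prop : ContinuousAt (fun y : Vec n => inner ℝ e y) x).eventually_lt
        hgc.continuousAt hxρ
    have h2 : ζ t =ᶠ[𝓝 x] fun y => η (y - t • e) := by
      filter_upwards [h1] with y hy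
      have : (inner ℝ e y - g y) / t < 1 / 3 :=
        lt_of_lt_of_le (div_neg_of_neg_of_pos (by linarith) ht) (by norm_num)
      simp only [ζ, hχ1 _ this, one_smul]
    rw [← hη.grad_eq _ hxt, grad_eq_matEquiv, grad_eq_matEquiv, h2.fderiv_eq,
      fderiv_comp_sub]
  have hev : ∀ᶠ t : ℝ in 𝓝[>] 0, 0 < t ∧ t < ρ - s ∧ t < s - a := by
    filter_upwards [self_mem_nhdsWithin, Ioo_mem_nhdsGT (sub_pos.2 hsρ),
      Ioo_mem_nhdsGT (sub_pos.2 has)] with t h1 h2 h3 using ⟨h1, h2.2, h3.2⟩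
  refine ExcessBound.of_tendsto hF hΩm (lt_of_le_of_lt (measure_mono inter_subset_right)
      (measure_ball_lt_top (x := x₁) (r := s))) (l := 𝓝[>] (0 : ℝ)) (D := fun t => grad (ζ t))
      (M := M) ?_ ?_ ?_ ?_
  · filter_upwards [hev] with t ht using (continuous_grad (hζc t ht.1)).aestronglyMeasurable
  · filter_upwards [hev] with t ht x hx
    rw [hgrad t ht.1 ht.2.1 x hx]
    exact hM _ (hshift t ht.1 ht.2.1 x hx)
  · intro x hx
    have h1 : ContinuousAt Dη x :=
      (hη.continuousOn_grad.mono subset_closure).continuousAt (hΩ.mem_nhds hx.1)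
    have h2 : Tendsto (fun t : ℝ => x - t • e) (𝓝[>] 0) (𝓝 x) := by
      have : Tendsto (fun t : ℝ => x - t • e) (𝓝 0) (𝓝 (x - (0 : ℝ) • e)) :=
        (by fun_prop : Continuous fun t : ℝ => x - t • e).tendsto 0
      rw [zero_smul, sub_zero] at this
      exact this.mono_left nhdsWithin_le_nhds
    refine (h1.tendsto.comp h2).congr' ?_
    filter_upwards [hev] with t ht
    exact (hgrad t ht.1 ht.2.1 x hx).symm
  · filter_upwards [hev] with t ht
    have hts := closure_minimal (hζsub t ht.1) isClosed_closedBall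
    exact hcore _ (hζc t ht.1)
      (HasCompactSupport.of_support_subset_isCompact (isCompact_closedBall _ _) (hζsub t ht.1))
      (hts.trans (closedBall_subset_ball (by linarith [ht.2.2])))

/-! ### Local connectedness of the domain at its boundary -/

/-- Flattened by the shear, one side of the boundary is a half ball, which is convex; its image
under the inverse shear is connected. -/
lemma IsC1Graph.exists_isPreconnected {n : ℕ} {Ω : Set (Vec n)} {x₀ : Vec n} {r : ℝ} {e : Vec n}
    {g : Vec n → ℝ} (h : IsC1Graph Ω x₀ r e g) {O : Set (Vec n)} (hO : O ∈ 𝓝 x₀) :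
    ∃ W P : Set (Vec n), IsOpen W ∧ x₀ ∈ W ∧ IsPreconnected P ∧ W ∩ Ω ⊆ P ∧ P ⊆ O ∩ Ω := by
  have hgc := h.contDiff.continuous
  have c1 : Continuous (shear g e) := continuous_id.add (hgc.smul continuous_const)
  have c2 : Continuous (shear (-g) e) := continuous_id.add (hgc.neg.smul continuous_const)
  have inv1 := shear_shear_neg h.invariant
  have inv2 := shear_neg_shear h.invariant
  have hee : inner ℝ e e = (1 : ℝ) := by rw [real_inner_self_eq_norm_sq, h.norm_eq_one]; norm_num
  have hconv : Convex ℝ {y : Vec n | inner ℝ e y < 0} :=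
    convex_halfSpace_lt (𝕜 := ℝ) (f := fun y : Vec n => inner ℝ e y)
      ⟨fun x y => inner_add_right e x y, fun c x => real_inner_smul_right e x c⟩ 0
  have hpre : shear g e ⁻¹' (O ∩ ball x₀ r) ∈ 𝓝 (shear (-g) e x₀) := by
    refine c1.continuousAt.preimage_mem_nhds ?_
    rw [inv1]
    exact inter_mem hO (ball_mem_nhds _ h.radius_pos)
  obtain ⟨σ, hσ, hσsub⟩ := Metric.mem_nhds_iff.1 hpre
  refine ⟨shear (-g) e ⁻¹' ball (shear (-g) e x₀) σ,
    shear g e '' (ball (shear (-g) e x₀) σ ∩ {y | inner ℝ e y < 0}), isOpen_ball.preimage c2,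
    mem_preimage.2 (mem_ball_self hσ), ?_, ?_, ?_⟩
  · refine IsPreconnected.image (Convex.isPreconnected ?_) _ c1.continuousOn
    exact (convex_ball _ _).inter hconv
  · rintro x ⟨hx, hxΩ⟩
    refine ⟨shear (-g) e x, ⟨hx, ?_⟩, inv1 x⟩
    have hxr : x ∈ ball x₀ r := by
      have := (hσsub hx).2
      rwa [inv1] at this
    have := (h.mem_iff x hxr).1 hxΩ
    change inner ℝ e (x + (-g x) • e) < 0
    rw [inner_add_right, real_inner_smul_right, hee]
    linarith
  · rintro _ ⟨y, ⟨hy, hy'⟩, rfl⟩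
    have hyO := hσsub hy
    refine ⟨hyO.1, (h.mem_iff _ hyO.2).2 ?_⟩
    have hy'' : inner ℝ e y < 0 := hy'
    rw [shear, inner_add_right, real_inner_smul_right, hee, h.invariant]
    linarith

/-- Near x the set Ω lies in a connected piece that meets U and avoids the frontier of U, hence lies
inside U. -/
lemma exists_nhds_inter_closure_subset {n : ℕ} {Ω U : Set (Vec n)} (hU : IsOpen U) (hUΩ : U ⊆ Ω)
    {x r e g} (h : IsC1Graph Ω x r e g) (hxU : x ∈ closure U)
    (hx : x ∉ closure (frontier U ∩ Ω)) : ∃ W, IsOpen W ∧ x ∈ W ∧ W ∩ closure Ω ⊆ closure U := by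
  obtain ⟨W, P, hW, hxW, hP, hWP, hPO⟩ := h.exists_isPreconnected
    (isClosed_closure.isOpen_compl.mem_nhds hx)
  have hPU : P ⊆ U := by
    refine hP.subset_of_closure_inter_subset hU ?_ ?_
    · obtain ⟨y, hyW, hyU⟩ := mem_closure_iff.1 hxU W hW hxW
      exact ⟨y, hWP ⟨hyW, hUΩ hyU⟩, hyU⟩
    · rintro y ⟨hyc, hyP⟩
      by_contra hyU
      have hyf : y ∈ frontier U := by rw [hU.frontier_eq]; exact ⟨hyc, hyU⟩
      exact (hPO hyP).1 (subset_closure ⟨hyf, (hPO hyP).2⟩)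
  exact ⟨W, hW, hxW, hW.inter_closure.trans (closure_mono (hWP.trans hPU))⟩

@[simp] lemma toMat_zero {N n : ℕ} : toMat (0 : Vec n →L[ℝ] Vec N) = 0 := map_zero (matEquiv N n)

/-! ### Truncation near the zero set -/

/-- A smooth function `ℝᴺ → ℝᴺ` that vanishes near `0` and is the identity near infinity. -/
def truncBase (N : ℕ) (v : Vec N) : Vec N :=
  (1 - (⟨1, 2, one_pos, one_lt_two⟩ : ContDiffBump (0 : Vec N)) v) • v

lemma contDiff_truncBase (N : ℕ) : ContDiff ℝ 1 (truncBase N) :=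
  (contDiff_const.sub (ContDiffBump.contDiff _)).smul contDiff_id

lemma truncBase_eq_zero {N : ℕ} {v : Vec N} (hv : ‖v‖ < 1) : truncBase N v = 0 := by
  rw [truncBase, ContDiffBump.one_of_mem_closedBall _ (mem_closedBall_zero_iff.2 hv.le), sub_self,
    zero_smul]

lemma fderiv_truncBase_eq_zero {N : ℕ} {v : Vec N} (hv : ‖v‖ < 1) :
    fderiv ℝ (truncBase N) v = 0 := by
  have : truncBase N =ᶠ[𝓝 v] fun _ => 0 := by
    filter_upwards [(isOpen_ball (x := (0 : Vec N)) (ε := 1)).mem_nhds (mem_ball_zero_iff.2 hv)]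
      with w hw using truncBase_eq_zero (mem_ball_zero_iff.1 hw)
  rw [this.fderiv_eq]
  simp

lemma fderiv_truncBase_eq_id {N : ℕ} {v : Vec N} (hv : 2 < ‖v‖) :
    fderiv ℝ (truncBase N) v = ContinuousLinearMap.id ℝ _ := by
  have : truncBase N =ᶠ[𝓝 v] id := by
    filter_upwards [continuous_norm.continuousAt.eventually (lt_mem_nhds hv)] with w hw
    rw [truncBase, ContDiffBump.zero_of_le_dist _ (by rw [dist_zero_right]; exact hw.le), sub_zero,
      one_smul, id]
  rw [this.fderiv_eq, fderiv_id]

lemma exists_fderiv_truncBase_bound (N : ℕ) :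
    ∃ K : ℝ, ∀ v, ‖fderiv ℝ (truncBase N) v‖ ≤ K := by
  obtain ⟨K, hK⟩ := (isCompact_closedBall (0 : Vec N) 2).exists_bound_of_continuousOn
    (f := fderiv ℝ (truncBase N))
    ((contDiff_truncBase N).continuous_fderiv (by norm_num)).continuousOn
  refine ⟨max K 1, fun v => ?_⟩
  rcases le_or_gt ‖v‖ 2 with h | h
  · exact (hK v (mem_closedBall_zero_iff.2 h)).trans (le_max_left _ _)
  · rw [fderiv_truncBase_eq_id h]
    exact ContinuousLinearMap.norm_id_le.trans (le_max_right _ _)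

section Trunc

variable {N n : ℕ} {U : Set (Vec n)} {ψ : Vec n → Vec N} {Dψ : Vec n → Mat N n} {δ : ℝ}

/-- The truncation of `ψ` at level `δ`, extended by zero outside `closure U`. -/
def trunc (δ : ℝ) (U : Set (Vec n)) (ψ : Vec n → Vec N) : Vec n → Vec N :=
  (closure U).indicator fun x => δ • truncBase N (δ⁻¹ • ψ x)

/-- The gradient of `trunc δ U ψ` when `ψ` has gradient `Dψ`. -/
def truncGrad (δ : ℝ) (U : Set (Vec n)) (ψ : Vec n → Vec N) (Dψ : Vec n → Mat N n) :
    Vec n → Mat N n :=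
  (closure U).indicator fun x => matEquiv N n
    ((fderiv ℝ (truncBase N) (δ⁻¹ • ψ x)).comp ((matEquiv N n).symm (Dψ x)))

lemma trunc_apply_of_eq_zero {x : Vec n} (hx : x ∈ closure U → ψ x = 0) :
    trunc δ U ψ x = 0 := by
  by_cases h : x ∈ closure U
  · rw [trunc, indicator_of_mem h, hx h, smul_zero, truncBase_eq_zero (by simp), smul_zero]
  · rw [trunc, indicator_of_notMem h]

lemma trunc_eventually_eq_zero (hψ : ContinuousOn ψ (closure U)) {x : Vec n}
    (hx : x ∈ closure U → ψ x = 0) :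
    ∀ᶠ y in 𝓝 x, trunc δ U ψ y = 0 ∧ truncGrad δ U ψ Dψ y = 0 := by
  by_cases h : x ∈ closure U
  · have h1 : ∀ᶠ y in 𝓝[closure U] x, ‖δ⁻¹ • ψ y‖ < 1 := by
      refine ((hψ x h).const_smul δ⁻¹).norm.eventually_lt continuousWithinAt_const ?_
      simp [hx h]
    rw [eventually_nhdsWithin_iff] at h1
    filter_upwards [h1] with y hy
    by_cases hyU : y ∈ closure U
    · rw [trunc, truncGrad, indicator_of_mem hyU, indicator_of_mem hyU,
        truncBase_eq_zero (hy hyU), fderiv_truncBase_eq_zero (hy hyU)]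
      simp
    · rw [trunc, truncGrad, indicator_of_notMem hyU, indicator_of_notMem hyU]
      simp
  · filter_upwards [isClosed_closure.isOpen_compl.mem_nhds h] with y hy
    rw [trunc, truncGrad, indicator_of_notMem hy, indicator_of_notMem hy]
    simp

lemma continuousOn_trunc (hψ : ContinuousOn ψ (closure U)) :
    ContinuousOn (trunc δ U ψ) (closure U) := by
  refine ContinuousOn.congr (f := fun x => δ • truncBase N (δ⁻¹ • ψ x)) ?_
    fun x hx => indicator_of_mem hx _
  exact ((contDiff_truncBase N).continuous.comp_continuousOn (hψ.const_smul δ⁻¹)).const_smul δ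

lemma continuousOn_truncGrad (hψ : ContinuousOn ψ (closure U)) (hDψ : ContinuousOn Dψ (closure U)) :
    ContinuousOn (truncGrad δ U ψ Dψ) (closure U) := by
  refine ContinuousOn.congr (f := fun x => matEquiv N n
    ((fderiv ℝ (truncBase N) (δ⁻¹ • ψ x)).comp ((matEquiv N n).symm (Dψ x)))) ?_
    fun x hx => indicator_of_mem hx _
  refine (matEquiv N n).continuous.comp_continuousOn (ContinuousOn.clm_comp ?_ ?_)
  · exact ((contDiff_truncBase N).continuous_fderiv (by norm_num)).comp_continuousOn
      (hψ.const_smul δ⁻¹)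
  · exact (matEquiv N n).symm.continuous.comp_continuousOn hDψ

lemma trunc_eventuallyEq (hU : IsOpen U) {x : Vec n} (hx : x ∈ U) :
    trunc δ U ψ =ᶠ[𝓝 x] fun y => δ • truncBase N (δ⁻¹ • ψ y) := by
  filter_upwards [hU.mem_nhds hx] with y hy
  exact indicator_of_mem (subset_closure hy) _

lemma grad_trunc (hδ : 0 < δ) (hU : IsOpen U) (h : IsC1Closure U ψ Dψ) {x : Vec n} (hx : x ∈ U) :
    DifferentiableAt ℝ (trunc δ U ψ) x ∧ grad (trunc δ U ψ) x = truncGrad δ U ψ Dψ x := by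
  have h1 : HasFDerivAt ψ ((matEquiv N n).symm (Dψ x)) x := by
    rw [← h.grad_eq x hx, matEquiv_symm_grad]
    exact (h.differentiableAt x hx).hasFDerivAt
  have h2 : HasFDerivAt (truncBase N) (fderiv ℝ (truncBase N) (δ⁻¹ • ψ x)) (δ⁻¹ • ψ x) :=
    ((contDiff_truncBase N).differentiable (by norm_num) _).hasFDerivAt
  have h3 := (h2.comp x (h1.const_smul δ⁻¹)).const_smul δ
  have h4 := h3.congr_of_eventuallyEq (trunc_eventuallyEq (δ := δ) hU hx)
  refine ⟨h4.differentiableAt, ?_⟩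
  rw [truncGrad, indicator_of_mem (subset_closure hx), grad_eq_matEquiv, h4.fderiv]
  congr 1
  ext v
  simp [smul_smul, mul_inv_cancel₀ hδ.ne']

lemma contDiffAt_trunc (hU : IsOpen U) (h : IsC1Closure U ψ Dψ) {x : Vec n}
    (hx : x ∈ U) : ContDiffAt ℝ 1 (trunc δ U ψ) x := by
  refine ContDiffAt.congr_of_eventuallyEq ?_ (trunc_eventuallyEq hU hx)
  exact ((contDiff_truncBase N).contDiffAt.comp x ((h.contDiffAt hU hx).const_smul δ⁻¹)).const_smul δ

/-- The factors δ and δ⁻¹ cancel in the chain rule, so the bound is uniform in δ and serves the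
passage δ → 0. -/
lemma exists_truncGrad_bound (hU : Bornology.IsBounded U) (hDψ : ContinuousOn Dψ (closure U)) :
    ∃ M : ℝ, ∀ (δ : ℝ) (x : Vec n), ‖truncGrad δ U ψ Dψ x‖ ≤ M := by
  obtain ⟨K, hK⟩ := exists_fderiv_truncBase_bound N
  obtain ⟨M, hM⟩ := hU.isCompact_closure.exists_bound_of_continuousOn
    (f := fun x => (matEquiv N n).symm (Dψ x))
    ((matEquiv N n).symm.continuous.comp_continuousOn hDψ)
  have hK0 : 0 ≤ K := (norm_nonneg _).trans (hK 0)
  refine ⟨‖(matEquiv N n : (Vec n →L[ℝ] Vec N) →L[ℝ] Mat N n)‖ * (K * |M|), fun δ x => ?_⟩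
  by_cases hx : x ∈ closure U
  · rw [truncGrad, indicator_of_mem hx]
    refine (ContinuousLinearMap.le_opNorm
      (matEquiv N n : (Vec n →L[ℝ] Vec N) →L[ℝ] Mat N n) _).trans ?_
    gcongr
    refine (ContinuousLinearMap.opNorm_comp_le _ _).trans ?_
    gcongr
    · exact hK _
    · exact (hM x hx).trans (le_abs_self M)
  · rw [truncGrad, indicator_of_notMem hx, norm_zero]
    positivity

lemma eq_zero_of_mem_closure {A : Set (Vec n)} (hψ : ContinuousOn ψ (closure U))
    (hA : A ⊆ closure U) (h0 : ∀ x ∈ A, ψ x = 0) {x : Vec n} (hx : x ∈ closure A) : ψ x = 0 := by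
  have hxU : x ∈ closure U := closure_minimal hA isClosed_closure hx
  have h1 : ψ x ∈ closure (ψ '' A) := ((hψ x hxU).mono hA).mem_closure_image hx
  have h2 : ψ '' A ⊆ {0} := by
    rintro _ ⟨y, hy, rfl⟩
    exact h0 y hy
  exact closure_minimal h2 isClosed_singleton h1

/-- Where ψ ≠ 0 the artificial boundary ∂U ∩ Ω, on which ψ vanishes, stays away. Regularity on the
closure of U is then regularity on the closure of Ω, even at points of ∂Ω. -/
lemma closure_mem_nhdsWithin {Ω : Set (Vec n)} (hΩ : IsBoundedC1Domain Ω) (hU : IsOpen U)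
    (hUΩ : U ⊆ Ω) (hψ : ContinuousOn ψ (closure U)) (h0 : ∀ x ∈ frontier U ∩ Ω, ψ x = 0)
    {x : Vec n} (hxΩ : x ∈ closure Ω) (hxU : x ∈ closure U) (hψx : ψ x ≠ 0) :
    closure U ∈ 𝓝[closure Ω] x := by
  by_cases hx : x ∈ Ω
  · have : x ∈ U := by
      by_contra hxU'
      exact hψx (h0 x ⟨by rw [hU.frontier_eq]; exact ⟨hxU, hxU'⟩, hx⟩)
    exact mem_nhdsWithin_of_mem_nhds (mem_of_superset (hU.mem_nhds this) subset_closure)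
  · obtain ⟨r, e, g, hG⟩ := hΩ.isC1 x (by rw [hΩ.isOpen.frontier_eq]; exact ⟨hxΩ, hx⟩)
    have hxn : x ∉ closure (frontier U ∩ Ω) := fun hxc =>
      hψx (eq_zero_of_mem_closure hψ (fun y hy => frontier_subset_closure hy.1) h0 hxc)
    obtain ⟨W, hW, hxW, hWsub⟩ := exists_nhds_inter_closure_subset hU hUΩ hG hxU hxn
    rw [mem_nhdsWithin]
    exact ⟨W, hW, hxW, hWsub⟩

/-- The zero extension of a truncated variation on `U` is `C¹` up to the boundary of `Ω`. -/
lemma isC1Closure_trunc {Ω : Set (Vec n)} (hΩ : IsBoundedC1Domain Ω) (hδ : 0 < δ) (hU : IsOpen U)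
    (hUΩ : U ⊆ Ω) (h : IsC1Closure U ψ Dψ) (h0 : ∀ x ∈ frontier U ∩ Ω, ψ x = 0) :
    IsC1Closure Ω (trunc δ U ψ) (truncGrad δ U ψ Dψ) := by
  -- Two kinds of points cover the closure of Ω: those of the closure of U with ψ ≠ 0, where the
  -- formula for the truncation is valid nearby, and the others, near which it vanishes identically.
  have hnhds : ∀ x ∈ closure Ω, x ∈ closure U → ψ x ≠ 0 → closure U ∈ 𝓝[closure Ω] x :=
    fun x hxΩ hxU hψx => closure_mem_nhdsWithin hΩ hU hUΩ h.continuousOn h0 hxΩ hxU hψx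
  have hzero : ∀ x, ¬ (x ∈ closure U ∧ ψ x ≠ 0) →
      ∀ᶠ y in 𝓝 x, trunc δ U ψ y = 0 ∧ truncGrad δ U ψ Dψ y = 0 := fun x hx =>
    trunc_eventually_eq_zero h.continuousOn fun hxU => by
      by_contra hne
      exact hx ⟨hxU, hne⟩
  have hΩU : ∀ x ∈ Ω, x ∈ closure U ∧ ψ x ≠ 0 → x ∈ U := by
    intro x hxΩ hx
    by_contra hxU
    exact hx.2 (h0 x ⟨by rw [hU.frontier_eq]; exact ⟨hx.1, hxU⟩, hxΩ⟩)
  refine ⟨fun x hx => ?_, fun x hx => ?_, fun x hx => ?_, fun x hx => ?_⟩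
  · by_cases hc : x ∈ closure U ∧ ψ x ≠ 0
    · exact (continuousOn_trunc h.continuousOn x hc.1).mono_of_mem_nhdsWithin (hnhds x hx hc.1 hc.2)
    · have : trunc δ U ψ =ᶠ[𝓝 x] fun _ => 0 := (hzero x hc).mono fun y hy => hy.1
      exact (continuousAt_const.congr this.symm).continuousWithinAt
  · by_cases hc : x ∈ closure U ∧ ψ x ≠ 0
    · exact (grad_trunc hδ hU h (hΩU x hx hc)).1
    · have : trunc δ U ψ =ᶠ[𝓝 x] fun _ => 0 := (hzero x hc).mono fun y hy => hy.1
      exact (differentiableAt_const _).congr_of_eventuallyEq this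
  · by_cases hc : x ∈ closure U ∧ ψ x ≠ 0
    · exact (grad_trunc hδ hU h (hΩU x hx hc)).2
    · have : trunc δ U ψ =ᶠ[𝓝 x] fun _ => 0 := (hzero x hc).mono fun y hy => hy.1
      rw [(hzero x hc).self_of_nhds.2, grad_eq_matEquiv, this.fderiv_eq]
      simp
  · by_cases hc : x ∈ closure U ∧ ψ x ≠ 0
    · exact (continuousOn_truncGrad h.continuousOn h.continuousOn_grad x
        hc.1).mono_of_mem_nhdsWithin (hnhds x hx hc.1 hc.2)
    · have : truncGrad δ U ψ Dψ =ᶠ[𝓝 x] fun _ => 0 := (hzero x hc).mono fun y hy => hy.2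
      exact (continuousAt_const.congr this.symm).continuousWithinAt

end Trunc

/-! ### The Euler–Lagrange equation on `C¹` variations -/

lemma IsC1Closure.isSobolev {N n : ℕ} {Ω : Set (Vec n)} (hΩ : IsOpen Ω)
    (hb : Bornology.IsBounded Ω) {φ : Vec n → Vec N} {Dφ : Vec n → Mat N n}
    (h : IsC1Closure Ω φ Dφ) (q : ENNReal) : IsSobolev Ω q φ Dφ := by
  have : IsFiniteMeasure (volume.restrict Ω) := isFiniteMeasure_restrict.2 hb.measure_lt_top.ne
  obtain ⟨M, hM⟩ := hb.isCompact_closure.exists_bound_of_continuousOn h.continuousOn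
  obtain ⟨M', hM'⟩ := hb.isCompact_closure.exists_bound_of_continuousOn h.continuousOn_grad
  refine ⟨?_, ?_, fun η hη i j => weak_grad_of_differentiable hΩ h.differentiableAt h.grad_eq
    (h.continuousOn_grad.mono subset_closure) hη i j⟩
  · refine MemLp.of_bound ((h.continuousOn.mono subset_closure).aestronglyMeasurable
      hΩ.measurableSet) M ((ae_restrict_iff' hΩ.measurableSet).2 (Eventually.of_forall fun x hx =>
        hM x (subset_closure hx)))
  · refine MemLp.of_bound ((h.continuousOn_grad.mono subset_closure).aestronglyMeasurable
      hΩ.measurableSet) M' ((ae_restrict_iff' hΩ.measurableSet).2 (Eventually.of_forall fun x hx =>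
        hM' x (subset_closure hx)))

lemma IsExtremal.integral_eq_zero {N n : ℕ} {p : ℝ} {F : Mat N n → ℝ} {Ω ΓD : Set (Vec n)}
    {u : Vec n → Vec N} {Du : Vec n → Mat N n} (hext : IsExtremal p F Ω ΓD u Du) (hΩ : IsOpen Ω)
    (hb : Bornology.IsBounded Ω) {φ : Vec n → Vec N} {Dφ : Vec n → Mat N n}
    (h : IsC1Closure Ω φ Dφ) (h0 : ∀ x ∈ ΓD, φ x = 0) :
    ∫ x in Ω, fderiv ℝ F (Du x) (Dφ x) = 0 := by
  have := hext.euler_lagrange φ Dφ ⟨h.isSobolev hΩ hb _, fun ε hε => ⟨φ, Dφ, h, ?_, ?_⟩⟩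
  · simpa only [inner_gradient_eq] using this
  · rintro x (hx | hx)
    · exact h0 x hx.1
    -- On all of Ω there is no artificial boundary: an open set is disjoint from its frontier.
    · rw [hΩ.frontier_eq] at hx
      exact absurd hx.2 hx.1.2
  · simpa [sobolevDist] using hε

/-! ### A uniform radius for the boundary graphs -/

lemma IsBoundedC1Domain.exists_uniform_graph {n : ℕ} {Ω : Set (Vec n)} (hΩ : IsBoundedC1Domain Ω)
    {δ : ℝ} (hδ : 0 < δ) : ∃ ρ : ℝ, 0 < ρ ∧ ∀ x₁ ∈ frontier Ω, ∃ (e : Vec n) (g : Vec n → ℝ),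
      IsC1Graph Ω x₁ ρ e g ∧ ∀ x ∈ ball x₁ ρ, ‖fderiv ℝ g x - fderiv ℝ g x₁‖ ≤ δ := by
  have hcomp : IsCompact (frontier Ω) :=
    hΩ.isBounded.isCompact_closure.of_isClosed_subset isClosed_frontier frontier_subset_closure
  refine hcomp.induction_on (p := fun S => ∃ ρ : ℝ, 0 < ρ ∧ ∀ x₁ ∈ S, ∃ (e : Vec n)
    (g : Vec n → ℝ), IsC1Graph Ω x₁ ρ e g ∧
      ∀ x ∈ ball x₁ ρ, ‖fderiv ℝ g x - fderiv ℝ g x₁‖ ≤ δ) ?_ ?_ ?_ ?_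
  · exact ⟨1, one_pos, fun x hx => absurd hx (notMem_empty x)⟩
  · rintro S T hST ⟨ρ, hρ, h⟩
    exact ⟨ρ, hρ, fun x hx => h x (hST hx)⟩
  · rintro S T ⟨ρ, hρ, h⟩ ⟨ρ', hρ', h'⟩
    have mono : ∀ {x₁ : Vec n} {r : ℝ}, min ρ ρ' ≤ r → (∃ (e : Vec n) (g : Vec n → ℝ),
        IsC1Graph Ω x₁ r e g ∧ ∀ x ∈ ball x₁ r, ‖fderiv ℝ g x - fderiv ℝ g x₁‖ ≤ δ) →
        ∃ (e : Vec n) (g : Vec n → ℝ), IsC1Graph Ω x₁ (min ρ ρ') e g ∧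
          ∀ x ∈ ball x₁ (min ρ ρ'), ‖fderiv ℝ g x - fderiv ℝ g x₁‖ ≤ δ := by
      rintro x₁ r hr ⟨e, g, hG, hd⟩
      exact ⟨e, g, ⟨lt_min hρ hρ', hG.norm_eq_one, hG.contDiff, hG.invariant, fun x hx =>
        hG.mem_iff x (ball_subset_ball hr hx)⟩, fun x hx => hd x (ball_subset_ball hr hx)⟩
    refine ⟨min ρ ρ', lt_min hρ hρ', ?_⟩
    rintro x (hx | hx)
    · exact mono (min_le_left _ _) (h x hx)
    · exact mono (min_le_right _ _) (h' x hx)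
  · intro x hx
    obtain ⟨r, e, g, hG⟩ := hΩ.isC1 x hx
    have hc : Continuous (fderiv ℝ g) := hG.contDiff.continuous_fderiv (by norm_num)
    obtain ⟨r', hr', hd⟩ := Metric.continuousAt_iff.1 (hc.continuousAt (x := x)) (δ / 2) (by positivity)
    have hr := hG.radius_pos
    -- Half the radius lets the same e and g serve every boundary point within ρ of x; the
    -- oscillation δ/2 about x becomes δ about that point.
    set ρ := min r r' / 2 with hρ
    have hρ0 : 0 < ρ := by positivity
    have hsub : ∀ x₁ ∈ ball x ρ, ball x₁ ρ ⊆ ball x (min r r') := by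
      intro x₁ hx₁
      refine ball_subset_ball' ?_
      have := mem_ball.1 hx₁
      linarith
    have hd' : ∀ y ∈ ball x (min r r'), ‖fderiv ℝ g y - fderiv ℝ g x‖ ≤ δ / 2 := fun y hy => by
      rw [← dist_eq_norm]
      exact (hd (lt_of_lt_of_le (mem_ball.1 hy) (min_le_right _ _))).le
    refine ⟨ball x ρ, mem_nhdsWithin_of_mem_nhds (ball_mem_nhds x hρ0), ρ, hρ0, fun x₁ hx₁ =>
      ⟨e, g, ⟨hρ0, hG.norm_eq_one, hG.contDiff, hG.invariant, fun y hy => hG.mem_iff y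
        (ball_subset_ball (min_le_left _ _) (hsub x₁ hx₁ hy))⟩, fun y hy => ?_⟩⟩
    have h1 := hd' y (hsub x₁ hx₁ hy)
    have h2 := hd' x₁ (hsub x₁ hx₁ (mem_ball_self hρ0))
    calc _ = ‖(fderiv ℝ g y - fderiv ℝ g x) - (fderiv ℝ g x₁ - fderiv ℝ g x)‖ := by
          congr 1; abel
      _ ≤ δ := (norm_sub_le _ _).trans (by linarith)

/-! ### Removing the truncation -/

/-- At a density point of the zero set the derivative must be 0, and almost every point of the set
is one. -/
lemma IsC1Closure.ae_grad_eq_zero {N n : ℕ} {U : Set (Vec n)} (hU : IsOpen U) {ψ : Vec n → Vec N}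
    {Dψ : Vec n → Mat N n} (h : IsC1Closure U ψ Dψ) :
    ∀ᵐ x ∂(volume.restrict U), ψ x = 0 → Dψ x = 0 := by
  -- The argument needs a unit vector v, which exists only for n > 0.
  rcases Nat.eq_zero_or_pos n with rfl | hn
  · refine Eventually.of_forall fun x _ => ?_
    ext ⟨_, j⟩
    exact j.elim0
  let v : Vec n := EuclideanSpace.single ⟨0, hn⟩ 1
  have hv : ‖v‖ = 1 := by simp [v]
  have hcl : IsClosed (closure U ∩ ψ ⁻¹' {0}) :=
    h.continuousOn.preimage_isClosed_of_isClosed isClosed_closure isClosed_singleton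
  let S : Set (Vec n) := U ∩ (closure U ∩ ψ ⁻¹' {0})
  have hS : MeasurableSet S := hU.measurableSet.inter hcl.measurableSet
  have hS0 : ∀ x ∈ S, ψ x = 0 := fun x hx => hx.2.2
  have key : ∀ i : Fin N, ∀ᵐ x ∂(volume.restrict S),
      (EuclideanSpace.proj i : Vec N →L[ℝ] ℝ).comp (fderiv ℝ ψ x) = 0 := by
    intro i
    -- Multiplying a component by v gives a map of ℝⁿ to itself, the setting of the a.e. derivative
    -- estimate. It is approximated by 0 on S with error constant 0.
    have happ : ApproximatesLinearOn (fun x => ψ x i • v) (0 : Vec n →L[ℝ] Vec n) S 0 := by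
      intro x hx y hy
      simp [hS0 x hx, hS0 y hy]
    have := happ.norm_fderiv_sub_le volume hS
      (fun x => ((EuclideanSpace.proj i : Vec N →L[ℝ] ℝ).comp (fderiv ℝ ψ x)).smulRight v)
      fun x hx => by
        have h1 : HasFDerivAt (fun y => ψ y i)
            ((EuclideanSpace.proj i : Vec N →L[ℝ] ℝ).comp (fderiv ℝ ψ x)) x :=
          (EuclideanSpace.proj i : Vec N →L[ℝ] ℝ).hasFDerivAt.comp x
            (h.differentiableAt x hx.1).hasFDerivAt
        exact (h1.smul_const v).hasFDerivWithinAt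
    filter_upwards [this] with x hx
    rw [sub_zero, nonpos_iff_eq_zero, nnnorm_eq_zero, ← norm_eq_zero,
      ContinuousLinearMap.norm_smulRight_apply, hv, mul_one, norm_eq_zero] at hx
    exact hx
  have key' := (ae_restrict_iff' hS).1 (ae_all_iff.2 key)
  rw [ae_restrict_iff' hU.measurableSet]
  filter_upwards [key'] with x hx hxU hψx
  have h0 := hx ⟨hxU, subset_closure hxU, hψx⟩
  rw [← h.grad_eq x hxU]
  ext ⟨i, j⟩
  exact congrArg (fun L : Vec n →L[ℝ] ℝ => L (EuclideanSpace.single j 1)) (h0 i)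

lemma tendsto_truncGrad {N n : ℕ} {U : Set (Vec n)} (hU : IsOpen U) {ψ : Vec n → Vec N}
    {Dψ : Vec n → Mat N n} (h : IsC1Closure U ψ Dψ) :
    ∀ᵐ x ∂(volume.restrict U),
      Tendsto (fun δ => truncGrad δ U ψ Dψ x) (𝓝[>] 0) (𝓝 (Dψ x)) := by
  filter_upwards [h.ae_grad_eq_zero hU, ae_restrict_mem hU.measurableSet] with x hx hxU
  by_cases hψ : ψ x = 0
  · refine tendsto_const_nhds.congr fun δ => ?_
    rw [truncGrad, indicator_of_mem (subset_closure hxU), hx hψ]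
    simp
  · have hpos : 0 < ‖ψ x‖ := norm_pos_iff.2 hψ
    refine tendsto_const_nhds.congr' ?_
    filter_upwards [Ioo_mem_nhdsGT (half_pos hpos)] with δ hδ
    have h1 : 2 < ‖δ⁻¹ • ψ x‖ := by
      rw [norm_smul, norm_inv, Real.norm_of_nonneg hδ.1.le, lt_inv_mul_iff₀ hδ.1]
      linarith [hδ.2]
    rw [truncGrad, indicator_of_mem (subset_closure hxU), fderiv_truncBase_eq_id h1,
      ContinuousLinearMap.id_comp, ContinuousLinearEquiv.apply_symm_apply]

/-! ### Passing to the limit in `W^{1,p}` -/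

/-- A Young inequality with parameter θ, obtained by comparing d with θ(1 + 2a). -/
lemma rpow_mul_le_split {p : ℝ} (hp : 1 < p) {a d θ : ℝ} (ha : 0 ≤ a) (hd : 0 ≤ d) (hθ : 0 < θ)
    (hθ1 : θ ≤ 1) : (1 + 2 * a + d) ^ (p - 1) * d ≤
      2 ^ (p - 1) * (θ * (1 + 2 * a) ^ p + θ ^ (1 - p) * d ^ p) := by
  have hb : 0 < 1 + 2 * a := by positivity
  rcases le_or_gt d (θ * (1 + 2 * a)) with h | h
  · calc (1 + 2 * a + d) ^ (p - 1) * d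
        ≤ (2 * (1 + 2 * a)) ^ (p - 1) * (θ * (1 + 2 * a)) := by
          have : 1 + 2 * a + d ≤ 2 * (1 + 2 * a) := by nlinarith
          gcongr
      _ = 2 ^ (p - 1) * (θ * (1 + 2 * a) ^ p) := by
          rw [Real.mul_rpow (by norm_num) hb.le,
            show (1 + 2 * a) ^ p = (1 + 2 * a) ^ (p - 1) * (1 + 2 * a) by
              rw [← Real.rpow_add_one hb.ne']; congr 1; ring]
          ring
      _ ≤ _ := by
          have : 0 ≤ θ ^ (1 - p) * d ^ p := by positivity
          gcongr
          linarith
  · have hd0 : 0 < d := lt_of_le_of_lt (by positivity) h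
    have h1 : 1 + 2 * a ≤ d / θ := by rw [le_div_iff₀ hθ]; linarith
    have h2 : d ≤ d / θ := by rw [le_div_iff₀ hθ]; nlinarith
    calc (1 + 2 * a + d) ^ (p - 1) * d ≤ (2 * (d / θ)) ^ (p - 1) * d := by
          gcongr
          linarith
      _ = 2 ^ (p - 1) * (θ ^ (1 - p) * d ^ p) := by
          rw [Real.mul_rpow (by norm_num) (by positivity), Real.div_rpow hd hθ.le,
            show d ^ p = d ^ (p - 1) * d by rw [← Real.rpow_add_one hd0.ne']; congr 1; ring,
            show (1 - p) = -(p - 1) by ring, Real.rpow_neg hθ.le]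
          ring
      _ ≤ _ := by
          have : 0 ≤ θ * (1 + 2 * a) ^ p := by positivity
          gcongr
          linarith

section Limit

variable {α E : Type*} [MeasurableSpace α] {μ : Measure α} [IsFiniteMeasure μ]
  [NormedAddCommGroup E] {p : ℝ}

lemma integrable_growth (hp : 1 < p) {D : α → E} (hD : MemLp D (ENNReal.ofReal p) μ) :
    Integrable (fun x => (1 + 2 * ‖D x‖) ^ p) μ := by
  have h0 : MemLp (fun _ : α => (1 : ℝ)) (ENNReal.ofReal p) μ := memLp_const 1
  have h0' : MemLp (fun x => 2 * ‖D x‖) (ENNReal.ofReal p) μ := hD.norm.const_mul 2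
  have h1 : MemLp (fun x => 1 + 2 * ‖D x‖) (ENNReal.ofReal p) μ := h0.add h0'
  have h2 := h1.integrable_norm_rpow (by simp; linarith) ENNReal.ofReal_ne_top
  rw [ENNReal.toReal_ofReal (by linarith)] at h2
  refine h2.congr (Eventually.of_forall fun x => ?_)
  simp only
  rw [Real.norm_of_nonneg (by positivity)]

lemma integrable_of_lipschitz_growth (hp : 1 < p) {C : ℝ} {H : α → E → ℝ}
    (hH0 : ∀ x, H x 0 = 0)
    (hH : ∀ᵐ x ∂μ, ∀ ξ η, |H x ξ - H x η| ≤ C * (1 + ‖ξ‖ + ‖η‖) ^ (p - 1) * ‖ξ - η‖)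
    (hC : 0 ≤ C) {D : α → E} (hD : MemLp D (ENNReal.ofReal p) μ)
    (hm : AEStronglyMeasurable (fun x => H x (D x)) μ) : Integrable (fun x => H x (D x)) μ := by
  refine ((integrable_growth hp hD).const_mul C).mono' hm ?_
  filter_upwards [hH] with x hx
  have h1 := hx (D x) 0
  rw [hH0, sub_zero, sub_zero, norm_zero, add_zero] at h1
  have hpos : 0 < 1 + 2 * ‖D x‖ := by positivity
  calc _ ≤ _ := h1
    _ ≤ C * (1 + 2 * ‖D x‖) ^ (p - 1) * (1 + 2 * ‖D x‖) := by
        have h2 := norm_nonneg (D x)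
        have h3 : (1 + ‖D x‖) ^ (p - 1) ≤ (1 + 2 * ‖D x‖) ^ (p - 1) :=
          Real.rpow_le_rpow (by positivity) (by linarith) (by linarith)
        have h4 : ‖D x‖ ≤ 1 + 2 * ‖D x‖ := by linarith
        gcongr
    _ = C * (1 + 2 * ‖D x‖) ^ p := by
        rw [mul_assoc, ← Real.rpow_add_one hpos.ne']
        congr 2
        ring

/-- An approximation within θ in L^p costs at most a fixed multiple of θ: in the split, θ^(1-p)
multiplies a quantity below θ^p. -/
lemma integral_nonneg_of_approx (hp : 1 < p) {C : ℝ} {H : α → E → ℝ} (hC : 0 ≤ C)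
    (hH : ∀ᵐ x ∂μ, ∀ ξ η, |H x ξ - H x η| ≤ C * (1 + ‖ξ‖ + ‖η‖) ^ (p - 1) * ‖ξ - η‖)
    {D : α → E} (hD : MemLp D (ENNReal.ofReal p) μ) (hInt : Integrable (fun x => H x (D x)) μ)
    (happ : ∀ ε : ENNReal, 0 < ε → ∃ D' : α → E, MemLp D' (ENNReal.ofReal p) μ ∧
      eLpNorm (D - D') (ENNReal.ofReal p) μ < ε ∧ Integrable (fun x => H x (D' x)) μ ∧
      0 ≤ ∫ x, H x (D' x) ∂μ) : 0 ≤ ∫ x, H x (D x) ∂μ := by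
  have hp0 : 0 < p := by linarith
  set I := ∫ x, (1 + 2 * ‖D x‖) ^ p ∂μ with hI
  have hI0 : 0 ≤ I := integral_nonneg fun x => by positivity
  have key : ∀ θ : ℝ, 0 < θ → θ ≤ 1 →
      0 ≤ (∫ x, H x (D x) ∂μ) + C * 2 ^ (p - 1) * (I + 1) * θ := by
    intro θ hθ hθ1
    obtain ⟨D', hD', hlt, hInt', hpos⟩ := happ (ENNReal.ofReal θ) (by simpa using hθ)
    have hdiff : MemLp (D - D') (ENNReal.ofReal p) μ := hD.sub hD'
    have hJi := hdiff.integrable_norm_rpow (by simpa using hp0) ENNReal.ofReal_ne_top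
    rw [hdiff.eLpNorm_eq_integral_rpow_norm (by simpa using hp0) ENNReal.ofReal_ne_top,
      ENNReal.toReal_ofReal hp0.le, ENNReal.ofReal_lt_ofReal_iff hθ] at hlt
    rw [ENNReal.toReal_ofReal hp0.le] at hJi
    set J := ∫ x, ‖(D - D') x‖ ^ p ∂μ with hJ
    have hJ0 : 0 ≤ J := integral_nonneg fun x => by positivity
    have hJθ : θ ^ (1 - p) * J ≤ θ := by
      have h1 : J ≤ θ ^ p := by
        have := Real.rpow_le_rpow (by positivity) hlt.le hp0.le
        rwa [← Real.rpow_mul hJ0, inv_mul_cancel₀ hp0.ne', Real.rpow_one] at this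
      calc θ ^ (1 - p) * J ≤ θ ^ (1 - p) * θ ^ p := by gcongr
        _ = θ := by rw [← Real.rpow_add hθ, sub_add_cancel, Real.rpow_one]
    have hg := integrable_growth hp hD
    have hsum : Integrable (fun x => θ * (1 + 2 * ‖D x‖) ^ p + θ ^ (1 - p) * ‖(D - D') x‖ ^ p) μ :=
      (hg.const_mul θ).add (hJi.const_mul _)
    have hbound : ∫ x, H x (D' x) ∂μ ≤ ∫ x, (H x (D x) +
        C * (2 ^ (p - 1) * (θ * (1 + 2 * ‖D x‖) ^ p + θ ^ (1 - p) * ‖(D - D') x‖ ^ p))) ∂μ := by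
      refine integral_mono_ae hInt' (hInt.add ((hsum.const_mul _).const_mul C)) ?_
      filter_upwards [hH] with x hx
      have h1 := (abs_le.1 (hx (D' x) (D x))).2
      have h2 : ‖D' x‖ ≤ ‖D x‖ + ‖(D - D') x‖ := by
        have := norm_le_norm_add_norm_sub' (D' x) (D x)
        rwa [norm_sub_rev] at this
      have h3 := rpow_mul_le_split hp (norm_nonneg (D x)) (norm_nonneg ((D - D') x)) hθ hθ1
      have h4 : (1 + ‖D' x‖ + ‖D x‖) ^ (p - 1) * ‖D' x - D x‖ ≤
          (1 + 2 * ‖D x‖ + ‖(D - D') x‖) ^ (p - 1) * ‖(D - D') x‖ := by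
        rw [norm_sub_rev]
        exact mul_le_mul_of_nonneg_right
          (Real.rpow_le_rpow (by positivity) (by linarith) (by linarith)) (norm_nonneg _)
      have h5 := mul_le_mul_of_nonneg_left (h4.trans h3) hC
      linarith
    rw [integral_add hInt ((hsum.const_mul _).const_mul C),
      integral_const_mul, integral_const_mul, integral_add (hg.const_mul θ) (hJi.const_mul _),
      integral_const_mul, integral_const_mul] at hbound
    have h6 : C * (2 ^ (p - 1) * (θ * I + θ ^ (1 - p) * J)) ≤
        C * 2 ^ (p - 1) * (I + 1) * θ := by
      have : C * (2 ^ (p - 1) * (θ * I + θ ^ (1 - p) * J)) ≤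
        C * (2 ^ (p - 1) * (θ * I + θ)) := by gcongr
      refine this.trans (le_of_eq ?_)
      ring
    linarith
  set B := C * 2 ^ (p - 1) * (I + 1) with hB
  have hB0 : 0 ≤ B := by positivity
  by_contra hneg
  push Not at hneg
  set A := ∫ x, H x (D x) ∂μ with hA
  -- If A < 0, this θ keeps the error below -A/2, so the sum would still be negative.
  have h1 := key (min 1 (-A / (2 * (B + 1)))) (lt_min one_pos (div_pos (by linarith) (by linarith)))
    (min_le_left _ _)
  have h2 : B * min 1 (-A / (2 * (B + 1))) ≤ -A / 2 := by
    calc B * min 1 (-A / (2 * (B + 1))) ≤ (B + 1) * (-A / (2 * (B + 1))) := by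
          have : 0 < -A / (2 * (B + 1)) := div_pos (by linarith) (by linarith)
          have h3 : 0 ≤ min 1 (-A / (2 * (B + 1))) := (lt_min one_pos this).le
          gcongr
          · linarith
          · exact min_le_right _ _
      _ = -A / 2 := by field_simp
  linarith

end Limit

/-! ### The inequality for truncated variations -/

lemma ExcessBound.mono {N n : ℕ} {p c c' : ℝ} {F : Mat N n → ℝ} {z : Mat N n} {S : Set (Vec n)}
    {D : Vec n → Mat N n} (h : ExcessBound p c F z S D) (hc : c' ≤ c) :
    ExcessBound p c' F z S D :=
  le_trans (mul_le_mul_of_nonneg_right hc (integral_nonneg fun x => by positivity)) h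

lemma ExcessBound.congr_grad {N n : ℕ} {p c : ℝ} {F : Mat N n → ℝ} {z : Mat N n}
    {S : Set (Vec n)} (hS : MeasurableSet S) {D D' : Vec n → Mat N n}
    (h : ExcessBound p c F z S D) (hD : ∀ x ∈ S, D x = D' x) : ExcessBound p c F z S D' := by
  unfold ExcessBound at h ⊢
  have e1 : ∫ x in S, ‖V p (D x)‖ ^ 2 = ∫ x in S, ‖V p (D' x)‖ ^ 2 :=
    setIntegral_congr_fun hS fun x hx => by simp only [hD x hx]
  have e2 : ∫ x in S, excess F z (D x) = ∫ x in S, excess F z (D' x) :=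
    setIntegral_congr_fun hS fun x hx => by simp only [hD x hx]
  rwa [e1, e2] at h

/-- Unfreezing the base point costs c/4 out of 3c/4, and the vanishing linear term turns the excess
at `Du` into the difference of F. -/
lemma ExcessBound.integral_bound {N n : ℕ} {p c : ℝ} {F : Mat N n → ℝ} (hF : ContDiff ℝ 2 F)
    {z : Mat N n} {U : Set (Vec n)} (hU : MeasurableSet U) (hU' : volume U < ⊤)
    {D Du : Vec n → Mat N n} (h : ExcessBound p (3 / 4 * c) F z U D)
    (hDm : AEStronglyMeasurable D (volume.restrict U))
    (hDum : AEStronglyMeasurable Du (volume.restrict U)) {M M' : ℝ} (hM : ∀ x ∈ U, ‖D x‖ ≤ M)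
    (hM' : ∀ x ∈ U, ‖Du x‖ ≤ M')
    (hbase : ∀ x ∈ U, |excess F (Du x) (D x) - excess F z (D x)| ≤ c / 4 * vfun p ‖D x‖)
    (hEL : ∫ x in U, fderiv ℝ F (Du x) (D x) = 0) :
    c / 2 * ∫ x in U, ‖V p (D x)‖ ^ 2 ≤ ∫ x in U, (F (Du x + D x) - F (Du x)) := by
  have : IsFiniteMeasure (volume.restrict U) := isFiniteMeasure_restrict.2 hU'.ne
  have hmem := ae_restrict_mem hU (μ := volume)
  have hMae : ∀ᵐ x ∂(volume.restrict U), ‖D x‖ ≤ M := hmem.mono hM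
  have hpair : AEStronglyMeasurable (fun x => (Du x, D x)) (volume.restrict U) :=
    hDum.prodMk hDm
  have hpairM : ∀ᵐ x ∂(volume.restrict U), ‖(Du x, D x)‖ ≤ max M' M := by
    filter_upwards [hmem] with x hx
    exact max_le_max (hM' x hx) (hM x hx)
  have hF0 := hF.continuous
  have hF' : Continuous (fderiv ℝ F) := hF.continuous_fderiv (by norm_num)
  have i1 := integrable_continuous_comp hDm hMae (continuous_norm_V_sq p)
  have i2 := integrable_continuous_comp hDm hMae (continuous_excess_right hF z)
  have i3 := integrable_continuous_comp hpair hpairM (continuous_excess hF)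
  have i4 : Integrable (fun x => F (Du x + D x) - F (Du x)) (volume.restrict U) :=
    integrable_continuous_comp (H := fun q : Mat N n × Mat N n => F (q.1 + q.2) - F q.1)
      hpair hpairM (by fun_prop)
  have i5 : Integrable (fun x => fderiv ℝ F (Du x) (D x)) (volume.restrict U) :=
    integrable_continuous_comp (H := fun q : Mat N n × Mat N n => fderiv ℝ F q.1 q.2)
      hpair hpairM ((hF'.comp continuous_fst).clm_apply continuous_snd)
  have e1 : ∫ x in U, excess F (Du x) (D x) = ∫ x in U, (F (Du x + D x) - F (Du x)) := by
    unfold excess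
    rw [integral_sub i4 i5, hEL, sub_zero]
  have e2 : ∫ x in U, excess F z (D x) ≤
      (∫ x in U, excess F (Du x) (D x)) + c / 4 * ∫ x in U, ‖V p (D x)‖ ^ 2 := by
    rw [← integral_const_mul, ← integral_add i3 (i1.const_mul _)]
    refine setIntegral_mono_on i2 (i3.add (i1.const_mul _)) hU fun x hx => ?_
    have := (abs_le.1 (hbase x hx)).1
    rw [norm_V_sq]
    linarith
  rw [← e1]
  unfold ExcessBound at h
  linarith

section TruncBound

variable {N n : ℕ} {p c₂ δ : ℝ} {F : Mat N n → ℝ} {Ω ΓD U : Set (Vec n)} {ψ : Vec n → Vec N}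
  {Dψ : Vec n → Mat N n}

lemma truncGrad_eq_zero (hU : IsOpen U) (h : IsC1Closure U ψ Dψ)
    (h0 : ∀ x ∈ frontier U ∩ Ω, ψ x = 0) {x : Vec n} (hx : x ∈ Ω) (hxU : x ∉ U) :
    truncGrad δ U ψ Dψ x = 0 :=
  (trunc_eventually_eq_zero h.continuousOn fun hxc =>
    h0 x ⟨by rw [hU.frontier_eq]; exact ⟨hxc, hxU⟩, hx⟩).self_of_nhds.2

/-- Here ψ vanishes on all of ∂U, so its truncation is C¹ with compact support. At a point in the
closure of Γ_D with ψ ≠ 0, nearby points of Γ_D would lie in the closure of U; ψ is zero there, and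
continuity gives a contradiction. -/
lemma excessBound_truncGrad_of_dirichlet (hc₂ : 0 < c₂) (hF : ContDiff ℝ 2 F)
    (H2 : IsStronglyQuasiconvex p c₂ F) (z : Mat N n) (hΩ : IsBoundedC1Domain Ω)
    (hΓD : ΓD ⊆ frontier Ω) (hδ : 0 < δ) (hU : IsOpen U) (hUΩ : U ⊆ Ω)
    (h : IsC1Closure U ψ Dψ) (h0 : ∀ x ∈ (ΓD ∩ closure U) ∪ (frontier U ∩ Ω), ψ x = 0)
    (hD : closure U ∩ frontier Ω ⊆ closure ΓD) {x₀ : Vec n} {s : ℝ} (hs : 0 < s)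
    (hUs : closure U ⊆ ball x₀ s) : ExcessBound p c₂ F z U (truncGrad δ U ψ Dψ) := by
  have hfr : ∀ x ∈ closure U, x ∉ U → ψ x = 0 := by
    intro x hxc hxU
    have hxf : x ∈ frontier U := by rw [hU.frontier_eq]; exact ⟨hxc, hxU⟩
    by_cases hxΩ : x ∈ Ω
    · exact h0 x (Or.inr ⟨hxf, hxΩ⟩)
    have hxcΩ : x ∈ closure Ω := closure_mono hUΩ hxc
    have hxD := hD ⟨hxc, by rw [hΩ.isOpen.frontier_eq]; exact ⟨hxcΩ, hxΩ⟩⟩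
    by_contra hne
    have hn := closure_mem_nhdsWithin hΩ hU hUΩ h.continuousOn (fun y hy => h0 y (Or.inr hy))
      hxcΩ hxc hne
    obtain ⟨W, hW, hxW, hWsub⟩ := mem_nhdsWithin.1 hn
    refine hne (eq_zero_of_mem_closure h.continuousOn (A := ΓD ∩ closure U) inter_subset_right
      (fun y hy => h0 y (Or.inl hy)) ?_)
    rw [_root_.mem_closure_iff]
    intro O hO hxO
    obtain ⟨y, hy, hyD⟩ := _root_.mem_closure_iff.1 hxD (O ∩ W) (hO.inter hW) ⟨hxO, hxW⟩
    exact ⟨y, hy.1, hyD, hWsub ⟨hy.2, frontier_subset_closure (hΓD hyD)⟩⟩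
  have hz : ∀ x ∉ U, ∀ᶠ y in 𝓝 x, trunc δ U ψ y = 0 ∧ truncGrad δ U ψ Dψ y = 0 := fun x hx =>
    trunc_eventually_eq_zero h.continuousOn fun hxc => hfr x hxc hx
  have hC1 : ContDiff ℝ 1 (trunc δ U ψ) := by
    rw [contDiff_iff_contDiffAt]
    intro x
    by_cases hx : x ∈ U
    · exact contDiffAt_trunc hU h hx
    · exact contDiffAt_const.congr_of_eventuallyEq
        (f := fun _ => (0 : Vec N)) ((hz x hx).mono fun y hy => hy.1)
  have hsub : tsupport (trunc δ U ψ) ⊆ closure U :=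
    closure_minimal (fun x hx => by
      by_contra hxU
      exact hx (indicator_of_notMem hxU _)) isClosed_closure
  have hcs : HasCompactSupport (trunc δ U ψ) :=
    (hΩ.isBounded.subset hUΩ).isCompact_closure.of_isClosed_subset (isClosed_tsupport _) hsub
  have hb := H2.excessBound hc₂ hF z x₀ hs hC1 hcs (hsub.trans hUs)
  rw [← ExcessBound.congr_set (subset_closure.trans hUs) measurableSet_ball fun x hx => ?_] at hb
  · exact hb.congr_grad hU.measurableSet fun x hx => (grad_trunc hδ hU h hx).2
  · have : trunc δ U ψ =ᶠ[𝓝 x] fun _ => 0 := (hz x hx.2).mono fun y hy => hy.1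
    rw [grad_eq_matEquiv, this.fderiv_eq]
    simp

/-- The zero extension of the truncation is C¹ up to ∂Ω. Shifting and flattening then reduce the
bound to (H2') at x₁. Any Dirichlet part of the boundary nearby only restricts ψ further. -/
lemma excessBound_truncGrad_of_freeBoundary {K C γ : ℝ} (hp : 1 < p) (hc₂ : 0 < c₂)
    (hF : ContDiff ℝ 2 F) {Du : Vec n → Mat N n}
    (H2' : IsStronglyQuasiconvexAtFreeBoundary p c₂ F Ω ΓD Du) (hΩ : IsBoundedC1Domain Ω)
    (hδ : 0 < δ) (hU : IsOpen U) (hUΩ : U ⊆ Ω)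
    (h : IsC1Closure U ψ Dψ) (h0 : ∀ x ∈ frontier U ∩ Ω, ψ x = 0)
    {x₁ : Vec n} (hx₁ : x₁ ∈ freeBoundary Ω ΓD) {R ρ : ℝ} (hR : 0 < R) (hRρ : 6 * R ≤ ρ)
    (hUR : closure U ⊆ closedBall x₁ (2 * R)) {e : Vec n} {g : Vec n → ℝ}
    (hG : IsC1Graph Ω x₁ ρ e g) (hγ1 : γ ≤ 1)
    (hγ : ∀ x ∈ ball x₁ ρ, ‖fderiv ℝ g x - fderiv ℝ g x₁‖ ≤ γ)
    (hC0 : 0 < C) (hC : ∀ (ξ : Mat N n) (A : Vec n →L[ℝ] Vec n),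
      ‖mulRight ξ A - ξ‖ ≤ C * ‖A - ContinuousLinearMap.id ℝ _‖ * ‖ξ‖) (hd : C * γ < 1)
    (hK : ∀ (d : ℝ) (ξ ξ' : Mat N n), 0 ≤ d → d ≤ 1 → ‖ξ' - ξ‖ ≤ d * ‖ξ‖ →
      |excess F (Du x₁) ξ' - excess F (Du x₁) ξ| ≤ K * d * vfun p ‖ξ‖) :
    ExcessBound p (c₂ - (c₂ * (|p - 2| + 2) + K) * (C * γ)) F (Du x₁) U
      (truncGrad δ U ψ Dψ) := by
  obtain ⟨M, hM⟩ := exists_truncGrad_bound (ψ := ψ) (hΩ.isBounded.subset hUΩ) h.continuousOn_grad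
  -- The radii 2R < 3R leave room for the translation, and flattening doubles 3R, whence 6R ≤ ρ.
  have hb := excessBound_of_shift (a := 2 * R) (s := 3 * R) hF hΩ.isOpen hG (by linarith)
    (by linarith) (fun φ hφ hφc hφs => excessBound_of_graph hp hc₂ hF hΩ.isOpen hG hx₁.1 hγ1 hγ
      (by positivity) (by linarith) (fun φ h1 h2 h3 => H2'.excessBound hc₂ hF hx₁
        ⟨ρ, e, g, hG, rfl⟩ (by positivity) h1 h2 h3) hC0 hC hd hK hφ hφc hφs)
    (isC1Closure_trunc hΩ hδ hU hUΩ h h0)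
    (fun x hx => indicator_of_notMem (fun hxU => hx (hUR hxU)) _) (fun x _ => hM δ x)
  have hsub : U ⊆ Ω ∩ ball x₁ (3 * R) := fun x hx =>
    ⟨hUΩ hx, closedBall_subset_ball (by linarith) (hUR (subset_closure hx))⟩
  rwa [← ExcessBound.congr_set hsub (hΩ.isOpen.inter isOpen_ball).measurableSet
    fun x hx => truncGrad_eq_zero hU h h0 hx.1.1 hx.2] at hb

end TruncBound

lemma exists_radius {N n : ℕ} {p c₂ : ℝ} (hp : 1 < p) (hc₂ : 0 < c₂)
    {Ω ΓD : Set (Vec n)} (hΩ : IsBoundedC1Domain Ω) (hΓD : ΓD ⊆ frontier Ω)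
    {F : Mat N n → ℝ} {u : Vec n → Vec N} {Du : Vec n → Mat N n}
    (H0 : ContDiff ℝ 2 F) {CF : ℝ} (hCF : HasGradGrowth p F CF)
    (H2 : IsStronglyQuasiconvex p c₂ F) (hu : IsC1Closure Ω u Du)
    (H2' : IsStronglyQuasiconvexAtFreeBoundary p c₂ F Ω ΓD Du)
    (hext : IsExtremal p F Ω ΓD u Du) :
    ∃ R : ℝ, 0 < R ∧ ∀ x₀ ∈ closure Ω, ∀ (ψ : Vec n → Vec N) (Dψ : Vec n → Mat N n),
      IsC1Closure (Ω ∩ ball x₀ R) ψ Dψ →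
      (∀ x ∈ (ΓD ∩ closure (Ω ∩ ball x₀ R)) ∪ (frontier (Ω ∩ ball x₀ R) ∩ Ω), ψ x = 0) →
      ∀ δ : ℝ, 0 < δ →
        c₂ / 2 * ∫ x in Ω ∩ ball x₀ R, ‖V p (truncGrad δ (Ω ∩ ball x₀ R) ψ Dψ x)‖ ^ 2 ≤
          ∫ x in Ω ∩ ball x₀ R,
            (F (Du x + truncGrad δ (Ω ∩ ball x₀ R) ψ Dψ x) - F (Du x)) := by
  have hcomp := hΩ.isBounded.isCompact_closure
  obtain ⟨M, hM⟩ := hcomp.exists_bound_of_continuousOn hu.continuousOn_grad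
  obtain ⟨K, hK0, hK⟩ := excess_sub_arg hp H0 hCF M
  obtain ⟨τ, hτ, hbase⟩ := excess_sub_base hp H0 hCF M (show 0 < c₂ / 4 by positivity)
  obtain ⟨C, hC0, hC⟩ := exists_mulRight_bound N n
  set A := (c₂ * (|p - 2| + 2) + K) * C with hA
  have hA0 : 0 ≤ A := by positivity
  -- The three bounds keep the shear displacement controlled, the relative gradient error below 1,
  -- and the flattening loss at most c₂/4.
  set γ := min 1 (min (1 / (2 * C)) (c₂ / 4 / (A + 1))) with hγ
  have hγ0 : 0 < γ := by positivity
  have hγ1 : γ ≤ 1 := min_le_left _ _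
  have hγC : C * γ < 1 := by
    have h1 : γ ≤ 1 / (2 * C) := (min_le_right _ _).trans (min_le_left _ _)
    have h2 : C * γ ≤ C * (1 / (2 * C)) := by gcongr
    have h3 : C * (1 / (2 * C)) = 1 / 2 := by field_simp
    linarith
  have hγA : (c₂ * (|p - 2| + 2) + K) * (C * γ) ≤ c₂ / 4 := by
    have h1 : γ ≤ c₂ / 4 / (A + 1) := (min_le_right _ _).trans (min_le_right _ _)
    calc _ = A * γ := by rw [hA]; ring
      _ ≤ (A + 1) * (c₂ / 4 / (A + 1)) := by gcongr; linarith
      _ = c₂ / 4 := by field_simp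
  obtain ⟨ρ, hρ, hgraph⟩ := hΩ.exists_uniform_graph hγ0
  have huc := hcomp.uniformContinuousOn_of_continuous hu.continuousOn_grad
  rw [Metric.uniformContinuousOn_iff] at huc
  obtain ⟨κ, hκ, huc⟩ := huc τ hτ
  -- The first bound leaves room for the flattening. By the second, points of U, which lie within 2R
  -- of either possible frozen point, are closer to it than κ.
  set R := min (ρ / 6) (κ / 4) with hR
  have hR0 : 0 < R := by positivity
  have hRρ : 6 * R ≤ ρ := by linarith [min_le_left (ρ / 6) (κ / 4)]
  have hRκ : 4 * R ≤ κ := by linarith [min_le_right (ρ / 6) (κ / 4)]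
  refine ⟨R, hR0, fun x₀ hx₀ ψ Dψ hψ h0 δ hδ => ?_⟩
  set U := Ω ∩ ball x₀ R with hUdef
  have hU : IsOpen U := hΩ.isOpen.inter isOpen_ball
  have hUΩ : U ⊆ Ω := inter_subset_left
  have hUb : Bornology.IsBounded U := hΩ.isBounded.subset hUΩ
  have hUcl : closure U ⊆ closedBall x₀ R :=
    closure_minimal (fun x hx => ball_subset_closedBall hx.2) isClosed_closedBall
  have hEL : ∫ x in U, fderiv ℝ F (Du x) (truncGrad δ U ψ Dψ x) = 0 := by
    have h1 := isC1Closure_trunc hΩ hδ hU hUΩ hψ (fun y hy => h0 y (Or.inr hy))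
    have h2 := hext.integral_eq_zero hΩ.isOpen hΩ.isBounded h1 fun x hx =>
      trunc_apply_of_eq_zero fun hxU => h0 x (Or.inl ⟨hx, hxU⟩)
    rwa [setIntegral_eq_of_subset_of_forall_sdiff_eq_zero hΩ.isOpen.measurableSet hUΩ fun x hx => by
      rw [truncGrad_eq_zero hU hψ (fun y hy => h0 y (Or.inr hy)) hx.1 hx.2, map_zero]] at h2
  obtain ⟨M', hM'⟩ := exists_truncGrad_bound (ψ := ψ) hUb hψ.continuousOn_grad
  have hDm : AEStronglyMeasurable (truncGrad δ U ψ Dψ) (volume.restrict U) :=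
    ((continuousOn_truncGrad hψ.continuousOn hψ.continuousOn_grad).mono
      subset_closure).aestronglyMeasurable hU.measurableSet
  have hDum : AEStronglyMeasurable Du (volume.restrict U) :=
    (hu.continuousOn_grad.mono (hUΩ.trans subset_closure)).aestronglyMeasurable hU.measurableSet
  suffices hz : ∃ z ∈ closure Ω, (∀ x ∈ U, dist x z < κ) ∧
      ExcessBound p (3 / 4 * c₂) F (Du z) U (truncGrad δ U ψ Dψ) by
    obtain ⟨z, hzΩ, hzU, hb⟩ := hz
    refine hb.integral_bound H0 hU.measurableSet hUb.measure_lt_top hDm hDum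
      (fun x _ => hM' δ x) (fun x hx => hM x (subset_closure (hUΩ hx))) (fun x hx => ?_) hEL
    have hxΩ := subset_closure (hUΩ hx)
    refine hbase _ _ (hM x hxΩ) (hM z hzΩ) ?_ _
    rw [← dist_eq_norm]
    exact (huc x hxΩ z hzΩ (hzU x hx)).le
  -- The frozen point is the centre in the Dirichlet or interior case, but must be a free boundary
  -- point otherwise, since (H2') is only known at the gradient there.
  by_cases hD : closure U ∩ frontier Ω ⊆ closure ΓD
  · refine ⟨x₀, hx₀, fun x hx => ?_, ?_⟩
    · have := mem_ball.1 hx.2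
      linarith
    · exact (excessBound_truncGrad_of_dirichlet hc₂ H0 H2 _ hΩ hΓD hδ hU hUΩ hψ h0 hD
        (s := 2 * R) (by positivity)
        (hUcl.trans (closedBall_subset_ball (by linarith)))).mono (by linarith)
  · obtain ⟨x₁, hx₁, hx₁D⟩ := not_subset.1 hD
    obtain ⟨e, g, hG, hg⟩ := hgraph x₁ hx₁.2
    have hx₁R := mem_closedBall.1 (hUcl hx₁.1)
    have hUR : closure U ⊆ closedBall x₁ (2 * R) := by
      intro x hx
      have h1 := mem_closedBall.1 (hUcl hx)
      have h2 := dist_triangle_right x x₁ x₀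
      rw [mem_closedBall]
      linarith
    have hx₁Ω : x₁ ∈ closure Ω := frontier_subset_closure hx₁.2
    refine ⟨x₁, hx₁Ω, fun x hx => ?_, ?_⟩
    · have := mem_closedBall.1 (hUR (subset_closure hx))
      linarith
    · exact (excessBound_truncGrad_of_freeBoundary hp hc₂ H0 H2' hΩ hδ hU hUΩ hψ
        (fun y hy => h0 y (Or.inr hy)) ⟨hx₁.2, hx₁D⟩ hR0 hRρ hUR hG hγ1 hg hC0 hC hγC
        (hK _ (hM x₁ hx₁Ω))).mono (by linarith)

end Zhang

end

/-! ### Conclusion: removing the truncation and closing up in W^{1,p}. -/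

theorem theorem3p6 {N n : ℕ} (p c₂ : ℝ) (hp : 1 < p) (hc₂ : 0 < c₂)
    (Ω ΓD : Set (Zhang.Vec n)) (hΩ : Zhang.IsBoundedC1Domain Ω) (hΓD : ΓD ⊆ frontier Ω)
    (F : Zhang.Mat N n → ℝ) (u : Zhang.Vec n → Zhang.Vec N) (Du : Zhang.Vec n → Zhang.Mat N n)
    (H0 : ContDiff ℝ 2 F) (H1 : Zhang.HasPGrowth p F)
    (H2 : Zhang.IsStronglyQuasiconvex p c₂ F)
    (hu : Zhang.IsC1Closure Ω u Du)
    (H2' : Zhang.IsStronglyQuasiconvexAtFreeBoundary p c₂ F Ω ΓD Du)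
    (hext : Zhang.IsExtremal p F Ω ΓD u Du) :
    ∃ R : ℝ, 0 < R ∧ ∀ x₀ ∈ closure Ω,
      ∀ (φ : Zhang.Vec n → Zhang.Vec N) (Dφ : Zhang.Vec n → Zhang.Mat N n),
        Zhang.IsVariation Ω ΓD p (Ω ∩ Metric.ball x₀ R) φ Dφ →
          c₂ / 2 * ∫ x in Ω ∩ Metric.ball x₀ R, ‖Zhang.V p (Dφ x)‖ ^ 2 ≤
            ∫ x in Ω ∩ Metric.ball x₀ R, (F (Du x + Dφ x) - F (Du x)) := by
  open Zhang MeasureTheory Filter Topology Metric Set in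
  obtain ⟨CF, hCF⟩ := exists_hasGradGrowth hp hc₂ H0 H1 H2
  have hCF0 := hCF.nonneg
  obtain ⟨CV, hCV0, hCV⟩ := exists_vfun_lipschitz hp
  obtain ⟨R, hR, hmain⟩ := exists_radius hp hc₂ hΩ hΓD H0 hCF H2 hu H2' hext
  obtain ⟨M, hM⟩ := hΩ.isBounded.isCompact_closure.exists_bound_of_continuousOn hu.continuousOn_grad
  refine ⟨R, hR, fun x₀ hx₀ φ Dφ hφ => ?_⟩
  have hmain₀ := hmain x₀ hx₀
  set U := Ω ∩ Metric.ball x₀ R with hUdef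
  have hU : IsOpen U := hΩ.isOpen.inter Metric.isOpen_ball
  have hUb : Bornology.IsBounded U := hΩ.isBounded.subset inter_subset_left
  have hUfin : IsFiniteMeasure (volume.restrict U) :=
    isFiniteMeasure_restrict.2 hUb.measure_lt_top.ne
  have hUmem := ae_restrict_mem hU.measurableSet (μ := volume)
  have hDum : AEStronglyMeasurable Du (volume.restrict U) :=
    (hu.continuousOn_grad.mono (inter_subset_left.trans subset_closure)).aestronglyMeasurable
      hU.measurableSet
  have hDuM : ∀ x ∈ U, ‖Du x‖ ≤ M := fun x hx => hM x (subset_closure hx.1)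
  have hF0 := H0.continuous
  have hdF : Differentiable ℝ F := H0.differentiable (by norm_num)
  -- the inequality for functions that are `C¹` up to the boundary
  have hC1 : ∀ (ψ : Vec n → Vec N) (Dψ : Vec n → Mat N n), IsC1Closure U ψ Dψ →
      (∀ x ∈ (ΓD ∩ closure U) ∪ (frontier U ∩ Ω), ψ x = 0) →
      c₂ / 2 * ∫ x in U, ‖V p (Dψ x)‖ ^ 2 ≤ ∫ x in U, (F (Du x + Dψ x) - F (Du x)) := by
    intro ψ Dψ hψ h0
    obtain ⟨M', hM'⟩ := exists_truncGrad_bound (ψ := ψ) hUb hψ.continuousOn_grad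
    have hm : ∀ δ : ℝ, AEStronglyMeasurable (truncGrad δ U ψ Dψ) (volume.restrict U) := fun δ =>
      ((continuousOn_truncGrad hψ.continuousOn hψ.continuousOn_grad).mono
        subset_closure).aestronglyMeasurable hU.measurableSet
    have hlim := tendsto_truncGrad hU hψ
    refine le_of_tendsto_of_tendsto (b := 𝓝[>] (0 : ℝ))
      ((tendsto_integral_continuous_comp (Eventually.of_forall hm)
        (Eventually.of_forall fun δ => Eventually.of_forall (hM' δ)) hlim
        (continuous_norm_V_sq p)).const_mul (c₂ / 2))
      (tendsto_integral_continuous_comp (H := fun q : Mat N n × Mat N n => F (q.1 + q.2) - F q.1)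
        (f := fun δ x => (Du x, truncGrad δ U ψ Dψ x)) (g := fun x => (Du x, Dψ x))
        (M := max M M') (Eventually.of_forall fun δ => hDum.prodMk (hm δ)) ?_ ?_ (by fun_prop)) ?_
    · refine Eventually.of_forall fun δ => ?_
      filter_upwards [hUmem] with x hx
      exact max_le_max (hDuM x hx) (hM' δ x)
    · filter_upwards [hlim] with x hx
      exact tendsto_const_nhds.prodMk_nhds hx
    · filter_upwards [self_mem_nhdsWithin] with δ hδ
      exact hmain₀ ψ Dψ hψ h0 δ hδ
  -- the Lipschitz estimates
  have hM0 : 0 ≤ |M| := abs_nonneg M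
  set C := CF * (1 + 2 * |M|) ^ (p - 1) with hC
  have hC0 : 0 ≤ C := by positivity
  have hL1 : ∀ᵐ x ∂(volume.restrict U), ∀ ξ η : Mat N n,
      |(F (Du x + ξ) - F (Du x)) - (F (Du x + η) - F (Du x))| ≤
        C * (1 + ‖ξ‖ + ‖η‖) ^ (p - 1) * ‖ξ - η‖ := by
    filter_upwards [hUmem] with x hx ξ η
    have h1 := hCF.lipschitz hp hdF (Du x + ξ) (Du x + η)
    rw [add_sub_add_left_eq_sub] at h1
    rw [sub_sub_sub_cancel_right]
    have h2 : (1 + ‖Du x + ξ‖ + ‖Du x + η‖) ^ (p - 1) ≤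
        (1 + 2 * |M|) ^ (p - 1) * (1 + ‖ξ‖ + ‖η‖) ^ (p - 1) := by
      rw [← Real.mul_rpow (by positivity) (by positivity)]
      refine Real.rpow_le_rpow (by positivity) ?_ (by linarith)
      have h3 := norm_add_le (Du x) ξ
      have h4 := norm_add_le (Du x) η
      have h5 := (hDuM x hx).trans (le_abs_self M)
      nlinarith [norm_nonneg ξ, norm_nonneg η,
        mul_nonneg hM0 (add_nonneg (norm_nonneg ξ) (norm_nonneg η))]
    calc _ ≤ _ := h1
      _ ≤ CF * ((1 + 2 * |M|) ^ (p - 1) * (1 + ‖ξ‖ + ‖η‖) ^ (p - 1)) * ‖ξ - η‖ := by gcongr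
      _ = _ := by rw [hC]; ring
  have hL2 : ∀ᵐ x ∂(volume.restrict U), ∀ ξ η : Mat N n,
      |‖V p ξ‖ ^ 2 - ‖V p η‖ ^ 2| ≤ CV * (1 + ‖ξ‖ + ‖η‖) ^ (p - 1) * ‖ξ - η‖ := by
    refine Eventually.of_forall fun x ξ η => ?_
    rw [norm_V_sq, norm_V_sq]
    refine (hCV _ _ (norm_nonneg ξ) (norm_nonneg η)).trans ?_
    gcongr
    exact abs_norm_sub_norm_le ξ η
  have hInt : ∀ D : Vec n → Mat N n, MemLp D (ENNReal.ofReal p) (volume.restrict U) →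
      Integrable (fun x => F (Du x + D x) - F (Du x)) (volume.restrict U) ∧
        Integrable (fun x => ‖V p (D x)‖ ^ 2) (volume.restrict U) := by
    intro D hD
    refine ⟨integrable_of_lipschitz_growth hp (H := fun x ξ => F (Du x + ξ) - F (Du x))
      (fun x => by simp) hL1 hC0 hD ?_,
      integrable_of_lipschitz_growth hp (H := fun _ ξ => ‖V p ξ‖ ^ 2)
      (fun x => by simp [V_zero]) hL2 hCV0.le hD ?_⟩
    · exact (by fun_prop : Continuous fun q : Mat N n × Mat N n =>
        F (q.1 + q.2) - F q.1).comp_aestronglyMeasurable (hDum.prodMk hD.aestronglyMeasurable)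
    · exact (continuous_norm_V_sq p).comp_aestronglyMeasurable hD.aestronglyMeasurable
  have hsub : ∀ D : Vec n → Mat N n, MemLp D (ENNReal.ofReal p) (volume.restrict U) →
      ∫ x in U, (F (Du x + D x) - F (Du x) - c₂ / 2 * ‖V p (D x)‖ ^ 2) =
        (∫ x in U, (F (Du x + D x) - F (Du x))) - c₂ / 2 * ∫ x in U, ‖V p (D x)‖ ^ 2 := by
    intro D hD
    rw [integral_sub (hInt D hD).1 ((hInt D hD).2.const_mul _), integral_const_mul]
  have hDφ := hφ.isSobolev.memLp_grad
  have hfinal : 0 ≤ ∫ x in U, (F (Du x + Dφ x) - F (Du x) - c₂ / 2 * ‖V p (Dφ x)‖ ^ 2) := by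
    -- The two sides are combined into one integrand, so that a single approximation argument passes
    -- the inequality to the closure; its Lipschitz constant adds those of both parts.
    refine integral_nonneg_of_approx hp (C := C + c₂ / 2 * CV)
      (H := fun x ξ => F (Du x + ξ) - F (Du x) - c₂ / 2 * ‖V p ξ‖ ^ 2) (by positivity) ?_ hDφ
      ((hInt Dφ hDφ).1.sub ((hInt Dφ hDφ).2.const_mul _)) fun ε hε => ?_
    · filter_upwards [hL1, hL2] with x h1 h2 ξ η
      have e1 := abs_le.1 (h1 ξ η)
      have e2 := abs_le.1 (h2 ξ η)
      have e3 := mul_le_mul_of_nonneg_left e2.1 (half_pos hc₂).le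
      have e4 := mul_le_mul_of_nonneg_left e2.2 (half_pos hc₂).le
      rw [abs_le]
      constructor <;> nlinarith [e1.1, e1.2, e3, e4]
    · obtain ⟨ψ, Dψ, hψ, h0, hdist⟩ := hφ.approx ε hε
      have hDψ := (hψ.isSobolev hU hUb (ENNReal.ofReal p)).memLp_grad
      refine ⟨Dψ, hDψ, lt_of_le_of_lt le_add_self hdist,
        (hInt Dψ hDψ).1.sub ((hInt Dψ hDψ).2.const_mul _), ?_⟩
      rw [hsub Dψ hDψ]
      linarith [hC1 ψ Dψ hψ h0]
  rw [hsub Dφ hDφ] at hfinal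
  linarith
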